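/- Let $K=\mathbb Q(t,q)$, and let $[A,B]=AB-BA$. **The algebra.** $\mathbb A_{t,q}$ is the path algebra of the quiver with vertices $k=0,1,2,\dots$, arrows $d_+,d_+^*:k\to k+1$, $d_-:k+1\to k$ and loops $T_1,\dots,T_{k-1}$ at $k$, modulo the relations (for paths starting at $k$, whenever they make sense): $T_iT_j=T_jT_i$ for $|i-j|>1$; $T_iT_{i+1}T_i=T_{i+1}T_iT_{i+1}$; $(T_i-1)(T_i+t)=0$; $d_-^2T_{k-1}=d_-^2$; $T_id_-=d_-T_i$ ($1\le i\le k-2$); $T_1d_+^2=d_+^2$, $d_+T_i=T_{i+1}d_+$ ($1\le i\le k-1$); $d_-[d_+,d_-]T_{k-1}=t[d_+,d_-]d_-$ ($k\ge2$); $T_1[d_+,d_-]d_+=t\,d_+[d_+,d_-]$ ($k\ge1$); $T_1(d_+^*)^2=(d_+^*)^2$, $d_+^*T_i=T_{i+1}d_+^*$ ($1\le i\le k-1$); $t\,d_-[d_+^*,d_-]=[d_+^*,d_-]d_-T_{k-1}$ ($k\ge2$); $t[d_+^*,d_-]d_+^*=T_1d_+^*[d_+^*,d_-]$ ($k\ge1$);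 $d_+z_i=z_{i+1}d_+$ and $d_+^*y_i=y_{i+1}d_+^*$ ($1\le i\le k-1$); $z_1d_+=-q\,t^{k+1}y_1d_+^*$. Here, at the vertex $k\geq 1$, $y_1=\frac{1}{t^{k-1}(t-1)}[d_+,d_-]T_{k-1}\cdots T_1$, $y_{i+1}=t\,T_i^{-1}y_iT_i^{-1}$, $z_1=\frac{t^k}{1-t}[d_+^*,d_-]T_{k-1}^{-1}\cdots T_1^{-1}$, $z_{i+1}=t^{-1}T_iz_iT_i$. A representation of $\mathbb A_{t,q}$ is a family of $K$-vector spaces $(M_k)_{k\ge0}$ with linear maps for all arrows that satisfy these relations. **The spaces $\mathcal P(k)^+$.** Let $\mathcal P_k^+=K[x_1,\dots,x_k]$ and let $\mathcal P_\infty^+$ be the graded inverse limit of these rings along $x_k\mapsto0$, that is, the ring of power series of bounded degree in $x_1,x_2,\dots$. Let $s_i$ exchange $x_i$ and $x_{i+1}$, let $\mathscr T_iF=s_iF+(1-t)x_i\frac{F-s_iF}{x_i-x_{i+1}}$ on $\mathcal P_\infty^+$, and let $\mathcal P(k)^+=\{F\in\mathcal P_\infty^+:\mathscr T_iF=F\text{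 for all }i>k\}$. Thus $\mathrm{Sym}[X]=\mathcal P(0)^+$ is the ring of symmetric functions over $K$ in $x_1,x_2,\dots$. For $F\in\mathrm{Sym}[X]$, $F[\mathbf X_k]$ denotes $F$ in the alphabet $\mathbf X_k=(x_{k+1},x_{k+2},\dots)$. With $p_n$ the power sums, $F\mapsto F[A]$ denotes the plethystic substitution, the $K$-algebra morphism on $\mathrm{Sym}[X]$ with $p_n[X]\mapsto p_n[A]$ for $n\geq 1$, where $p_n[\cdot]$ raises all variables and the parameters to the $n$-th power, and $\mathrm{Exp}[A]=\exp\left(\sum_{n\ge1}p_n[A]/n\right)$. **The operators on $\mathcal P_\bullet=(\mathcal P(k)^+)_{k\ge0}$.** $T_i$ acts as $\mathscr T_i$. The arrow $d_+$ at $k$ acts as $\partial_kF=-\mathscr T_1\cdots\mathscr T_k(x_{k+1}F)$. The arrow $d_+^*$ at $k$ acts as $\partial_k^*$, the restriction to $\mathcal P(k)^+$ of the substitution $x_i\mapsto x_{i+1}$ $(1\le i\le k)$, $x_{k+1}\mapsto q\,x_1$, which fixes $x_i$ for $i>k+1$. The arrow $d_-$ from $k$ to $k-1$ ($k\geq 1$)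 acts as $\partial_k^-:\mathcal P(k)^+\to\mathcal P(k-1)^+$, the $\mathcal P_{k-1}^+$-linear map with $\partial_k^-(x_k^nF[\mathbf X_k])=(\mathscr B_nF)[\mathbf X_{k-1}]$ for $n\ge0$ and $F\in\mathrm{Sym}[X]$. Here $\mathscr B_0$ is the linear operator on $\mathrm{Sym}[X]$ with $\mathscr B_0P_\mu(X,t^{-1})=t^{\ell(\mu)}P_\mu(X,t^{-1})$ for all Hall–Littlewood functions $P_\mu$, and $\mathscr B_{n+1}=[\mathscr B_\infty,\mathscr B_n]$, where $\mathscr B_\infty$ is the multiplication by $e_1[X]$. **The standard representation $V_\bullet$.** Let $V_k=K[y_1,\dots,y_k]\otimes\mathrm{Sym}[X]$. The arrows starting at $k$ act by $$T_iF=s_iF+(1-t)y_i\frac{F-s_iF}{y_i-y_{i+1}},\qquad d_-F=\mathrm{ct}_{y_k}\left(F[X-(t-1)y_k]\,\mathrm{Exp}[-y_k^{-1}X]\right)\ (k\geq 1),$$ $$d_+F=-T_1\cdots T_k\left(y_{k+1}F[X+(t-1)y_{k+1}]\right),\qquad d_+^*F=\zeta_{k+1}F[X+(t-1)y_{k+1}],$$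 where $s_i$ exchanges $y_i$ and $y_{i+1}$, $\mathrm{ct}_{y_k}$ is the constant term in $y_k$, and $\zeta_{k+1}$ is the algebra morphism of $V_{k+1}$ that is trivial on $\mathrm{Sym}[X]$ and sends $y_i\mapsto y_{i+1}$ $(i\le k)$, $y_{k+1}\mapsto q\,y_1$. **Theorem.** For every $k\ge0$ the multiplication map $\mathcal P_k^+\otimes\mathrm{Sym}[X]\to\mathcal P(k)^+$, $f\otimes F\mapsto f\,F[\mathbf X_k]$, is an isomorphism of algebras. The operators above make $\mathcal P_\bullet$ and $V_\bullet$ representations of $\mathbb A_{t,q}$. There are $K$-algebra isomorphisms $\Phi_k:\mathcal P(k)^+\to V_k$, $k\ge0$, with $$\Phi_k\left(f(x_1,\dots,x_k)\,F[\mathbf X_k]\right)=f(y_1,\dots,y_k)\,F\left[\tfrac{X}{t-1}\right]\qquad(f\in\mathcal P_k^+,\ F\in\mathrm{Sym}[X]),$$ and $\Phi_\bullet=(\Phi_k)_{k\ge0}$ is an isomorphism of representations of $\mathbb A_{t,q}$ from $\mathcal P_\bullet$ to $V_\bullet$. -/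

import Mathlib

open scoped TensorProduct

noncomputable section

namespace DoubleDyck

/-! ### The field of coefficients -/

/-- The field `ℚ(t, q)` of rational functions in two parameters. -/
def Kqt : Type := FractionRing (MvPolynomial (Fin 2) ℚ)

instance : Field Kqt := inferInstanceAs (Field (FractionRing (MvPolynomial (Fin 2) ℚ)))

/-- The parameter `t`. -/
def tc : Kqt :=
  algebraMap (MvPolynomial (Fin 2) ℚ) (FractionRing (MvPolynomial (Fin 2) ℚ)) (MvPolynomial.X 0)

/-- The parameter `q`. -/
def qc : Kqt :=
  algebraMap (MvPolynomial (Fin 2) ℚ) (FractionRing (MvPolynomial (Fin 2) ℚ)) (MvPolynomial.X 1)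

/-! ### Representations of the double Dyck path algebra

Loops `T_1, …, T_k` sit at the node `k + 1`; the arrow `T_{i+1}` is indexed by `i : Fin k`. -/

/-- A representation over `ℚ(t, q)` of the quiver with vertices `k = 0, 1, 2, …`, arrows
`d₊, d₊* : k → k + 1` and `d₋ : k + 1 → k`, and loops `T_1, …, T_{k-1}` at the vertex `k`. -/
structure QuiverRep where
  V : ℕ → Type
  [addCommGroup : ∀ k, AddCommGroup (V k)]
  [module : ∀ k, Module Kqt (V k)]
  T : ∀ k, Fin k → Module.End Kqt (V (k + 1))
  dPlus : ∀ k, V k →ₗ[Kqt] V (k + 1)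
  dPlusStar : ∀ k, V k →ₗ[Kqt] V (k + 1)
  dMinus : ∀ k, V (k + 1) →ₗ[Kqt] V k

namespace QuiverRep

attribute [instance] QuiverRep.addCommGroup QuiverRep.module

variable (M : QuiverRep)

/-- `T_{i+1}⁻¹`; by the quadratic relation `(T - 1)(T + t) = 0` it is `t⁻¹ (T + t - 1)`. -/
def Tinv (k : ℕ) (i : Fin k) : Module.End Kqt (M.V (k + 1)) := tc⁻¹ • (M.T k i + (tc - 1) • 1)

/-- The loop `[d₊, d₋]` at the node `k + 1`. -/
def comm (k : ℕ) : Module.End Kqt (M.V (k + 1)) :=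
  M.dPlus k ∘ₗ M.dMinus k - M.dMinus (k + 1) ∘ₗ M.dPlus (k + 1)

/-- The loop `[d₊*, d₋]` at the node `k + 1`. -/
def commStar (k : ℕ) : Module.End Kqt (M.V (k + 1)) :=
  M.dPlusStar k ∘ₗ M.dMinus k - M.dMinus (k + 1) ∘ₗ M.dPlusStar (k + 1)

/-- `y k i` is the loop `y_{i+1}` at the node `k + 1`, for `0 ≤ i ≤ k` (and `0` for `i > k`):
`y_1 = (t^k (t - 1))⁻¹ [d₊, d₋] T_k ⋯ T_1` and `y_{i+1} = t T_i⁻¹ y_i T_i⁻¹`. -/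
def y (k : ℕ) : ℕ → Module.End Kqt (M.V (k + 1))
  | 0 => (tc ^ k * (tc - 1))⁻¹ • (M.comm k * (List.ofFn (M.T k)).reverse.prod)
  | i + 1 => if h : i < k then tc • (M.Tinv k ⟨i, h⟩ * y k i * M.Tinv k ⟨i, h⟩) else 0

/-- `z k i` is the loop `z_{i+1}` at the node `k + 1`, for `0 ≤ i ≤ k` (and `0` for `i > k`):
`z_1 = t^(k+1) (1 - t)⁻¹ [d₊*, d₋] T_k⁻¹ ⋯ T_1⁻¹` and `z_{i+1} = t⁻¹ T_i z_i T_i`. -/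
def z (k : ℕ) : ℕ → Module.End Kqt (M.V (k + 1))
  | 0 => (tc ^ (k + 1) * (1 - tc)⁻¹) • (M.commStar k * (List.ofFn (M.Tinv k)).reverse.prod)
  | i + 1 => if h : i < k then tc⁻¹ • (M.T k ⟨i, h⟩ * z k i * M.T k ⟨i, h⟩) else 0

/-- The defining relations of the double Dyck path algebra `𝔸_{t,q}`: a representation of
`𝔸_{t,q}`, which is the path algebra of the quiver modulo these relations, is a representation
of the quiver in which they hold. -/
structure IsDDPARep : Prop where
  T_comm : ∀ k (i j : Fin k), i.val + 1 < j.val → M.T k i * M.T k j = M.T k j * M.T k i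
  T_braid : ∀ k (i j : Fin k), j.val = i.val + 1 →
    M.T k i * M.T k j * M.T k i = M.T k j * M.T k i * M.T k j
  T_quadratic : ∀ k (i : Fin k), (M.T k i - 1) * (M.T k i + tc • 1) = 0
  dMinus_sq_T : ∀ k, M.dMinus k ∘ₗ M.dMinus (k + 1) ∘ₗ M.T (k + 1) (Fin.last k) =
    M.dMinus k ∘ₗ M.dMinus (k + 1)
  T_dMinus : ∀ k (i : Fin k), M.T k i ∘ₗ M.dMinus (k + 1) =
    M.dMinus (k + 1) ∘ₗ M.T (k + 1) i.castSucc
  T_dPlus_sq : ∀ k, M.T (k + 1) 0 ∘ₗ M.dPlus (k + 1) ∘ₗ M.dPlus k = M.dPlus (k + 1) ∘ₗ M.dPlus k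
  dPlus_T : ∀ k (i : Fin k), M.dPlus (k + 1) ∘ₗ M.T k i = M.T (k + 1) i.succ ∘ₗ M.dPlus (k + 1)
  dMinus_comm : ∀ k, M.dMinus (k + 1) ∘ₗ M.comm (k + 1) ∘ₗ M.T (k + 1) (Fin.last k) =
    tc • (M.comm k ∘ₗ M.dMinus (k + 1))
  comm_dPlus : ∀ k, M.T (k + 1) 0 ∘ₗ M.comm (k + 1) ∘ₗ M.dPlus (k + 1) =
    tc • (M.dPlus (k + 1) ∘ₗ M.comm k)
  T_dPlusStar_sq : ∀ k, M.T (k + 1) 0 ∘ₗ M.dPlusStar (k + 1) ∘ₗ M.dPlusStar k =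
    M.dPlusStar (k + 1) ∘ₗ M.dPlusStar k
  dPlusStar_T : ∀ k (i : Fin k), M.dPlusStar (k + 1) ∘ₗ M.T k i =
    M.T (k + 1) i.succ ∘ₗ M.dPlusStar (k + 1)
  dMinus_commStar : ∀ k, tc • (M.dMinus (k + 1) ∘ₗ M.commStar (k + 1)) =
    M.commStar k ∘ₗ M.dMinus (k + 1) ∘ₗ M.T (k + 1) (Fin.last k)
  commStar_dPlusStar : ∀ k, tc • (M.commStar (k + 1) ∘ₗ M.dPlusStar (k + 1)) =
    M.T (k + 1) 0 ∘ₗ M.dPlusStar (k + 1) ∘ₗ M.commStar k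
  dPlus_z : ∀ k i, i < k → M.dPlus (k + 1) ∘ₗ M.z k i = M.z (k + 1) (i + 1) ∘ₗ M.dPlus (k + 1)
  dPlusStar_y : ∀ k i, i < k →
    M.dPlusStar (k + 1) ∘ₗ M.y k i = M.y (k + 1) (i + 1) ∘ₗ M.dPlusStar (k + 1)
  z_dPlus : ∀ k, M.z k 0 ∘ₗ M.dPlus k = -(qc * tc ^ (k + 1)) • (M.y k 0 ∘ₗ M.dPlusStar k)

/-- `Φ` is a morphism of quiver representations: it commutes with all arrows. -/
structure IsHom (M N : QuiverRep) (Φ : ∀ k, M.V k →ₗ[Kqt] N.V k) : Prop where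
  T : ∀ k (i : Fin k), Φ (k + 1) ∘ₗ M.T k i = N.T k i ∘ₗ Φ (k + 1)
  dPlus : ∀ k, Φ (k + 1) ∘ₗ M.dPlus k = N.dPlus k ∘ₗ Φ k
  dPlusStar : ∀ k, Φ (k + 1) ∘ₗ M.dPlusStar k = N.dPlusStar k ∘ₗ Φ k
  dMinus : ∀ k, Φ k ∘ₗ M.dMinus k = N.dMinus k ∘ₗ Φ (k + 1)

end QuiverRep

/-! ### The graded inverse limit `𝒫_∞⁺` and the operators `𝒯_i`

The graded inverse limit of the rings `ℚ(t,q)[x_1, …, x_k]` along `x_k ↦ 0` is the ring of formal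
power series of bounded degree in `x_1, x_2, …`. The variable `x_{i+1}` is `MvPowerSeries.X i`. -/

/-- Formal power series in the variables `x_1, x_2, …`. -/
abbrev PS : Type := MvPowerSeries ℕ Kqt

/-- Series of bounded degree. -/
def IsBdd (F : PS) : Prop := ∃ d : ℕ, ∀ m : ℕ →₀ ℕ, d < m.degree → MvPowerSeries.coeff m F = 0

/-- `s_{i+1}`, which exchanges `x_{i+1}` and `x_{i+2}`. -/
def swapPS (i : ℕ) : PS →ₐ[Kqt] PS :=
  (MvPowerSeries.renameEquiv Kqt (Equiv.swap i (i + 1)) : PS ≃ₐ[Kqt] PS).toAlgHom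

/-- The monomial obtained from `m` by giving `x_{i+1}`, `x_{i+2}` the exponents `a`, `b`. -/
def setExp (m : ℕ →₀ ℕ) (i a b : ℕ) : ℕ →₀ ℕ := (m.update i a).update (i + 1) b

/-- The divided difference `F ↦ (F - s_{i+1} F) / (x_{i+1} - x_{i+2})` on power series, given by its
coefficients; see `divDiffPS_spec`. -/
def divDiffPS (i : ℕ) : PS →ₗ[Kqt] PS where
  toFun F := fun m =>
    ∑ a ∈ Finset.Ioc (max (m i) (m (i + 1))) (m i + m (i + 1) + 1),
      (MvPowerSeries.coeff (setExp m i a (m i + m (i + 1) + 1 - a)) F -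
        MvPowerSeries.coeff (setExp m i (m i + m (i + 1) + 1 - a) a) F)
  map_add' F G := by
    funext m
    change _ = (_ : Kqt) + _
    rw [← Finset.sum_add_distrib]
    refine Finset.sum_congr rfl fun a _ => ?_
    simp only [map_add]; ring
  map_smul' c F := by
    funext m
    change _ = c * (_ : Kqt)
    rw [Finset.mul_sum]
    refine Finset.sum_congr rfl fun a _ => ?_
    simp only [map_smul, smul_eq_mul]; ring

lemma setExp_apply (m : ℕ →₀ ℕ) (i a b j : ℕ) :
    setExp m i a b j = if j = i + 1 then b else if j = i then a else m j := by
  simp [setExp, Finsupp.update_apply]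

lemma coeff_swapPS (i : ℕ) (F : PS) (m : ℕ →₀ ℕ) :
    MvPowerSeries.coeff m (swapPS i F) =
      MvPowerSeries.coeff (setExp m i (m (i + 1)) (m i)) F := by
  have h : m = Finsupp.embDomain (Equiv.swap i (i + 1)).toEmbedding
      (setExp m i (m (i + 1)) (m i)) := by
    ext j
    rw [← Equiv.apply_symm_apply (Equiv.swap i (i + 1)) j]
    have := Finsupp.embDomain_apply_self (Equiv.swap i (i + 1)).toEmbedding
      (setExp m i (m (i + 1)) (m i)) ((Equiv.swap i (i + 1)).symm j)
    simp only [Equiv.coe_toEmbedding] at this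
    rw [this, setExp_apply]
    simp only [Equiv.symm_swap, Equiv.swap_apply_def]
    split_ifs <;> first | rfl | omega
  conv_lhs => rw [h]
  exact MvPowerSeries.coeff_embDomain_rename _ _ _

lemma coeff_X_mul' (s : ℕ) (F : PS) (m : ℕ →₀ ℕ) :
    MvPowerSeries.coeff m (MvPowerSeries.X s * F) =
      if 1 ≤ m s then MvPowerSeries.coeff (m - Finsupp.single s 1) F else 0 := by
  rw [MvPowerSeries.X, MvPowerSeries.coeff_monomial_mul]
  simp [Finsupp.single_le_iff]

lemma coeff_divDiffPS (i : ℕ) (F : PS) (m : ℕ →₀ ℕ) :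
    MvPowerSeries.coeff m (divDiffPS i F) =
      ∑ a ∈ Finset.Ioc (max (m i) (m (i + 1))) (m i + m (i + 1) + 1),
        (MvPowerSeries.coeff (setExp m i a (m i + m (i + 1) + 1 - a)) F -
          MvPowerSeries.coeff (setExp m i (m i + m (i + 1) + 1 - a) a) F) := rfl

lemma divDiffPS_spec (i : ℕ) (F : PS) :
    (MvPowerSeries.X i - MvPowerSeries.X (i + 1)) * divDiffPS i F = F - swapPS i F := by
  ext m
  rw [sub_mul, map_sub, map_sub, coeff_X_mul', coeff_X_mul', coeff_swapPS]
  set N := m i + m (i + 1) with hN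
  set g : ℕ → Kqt := fun a => MvPowerSeries.coeff (setExp m i a (N - a)) F -
    MvPowerSeries.coeff (setExp m i (N - a) a) F with hg
  have hs : ∀ (s : ℕ) (a b : ℕ), (s = i ∨ s = i + 1) →
      setExp (m - Finsupp.single s 1) i a b = setExp m i a b := by
    intro s a b hs
    ext j
    simp only [setExp_apply]
    split_ifs with h1 h2
    · rfl
    · rfl
    · have : s ≠ j := by omega
      simp [this]
  have e1 : 1 ≤ m i → MvPowerSeries.coeff (m - Finsupp.single i 1) (divDiffPS i F) =
      ∑ a ∈ Finset.Ioc (max (m i - 1) (m (i + 1))) N, g a := by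
    intro h
    rw [coeff_divDiffPS]
    have h1 : (m - Finsupp.single i 1 : ℕ →₀ ℕ) i = m i - 1 := by simp
    have h2 : (m - Finsupp.single i 1 : ℕ →₀ ℕ) (i + 1) = m (i + 1) := by simp
    rw [h1, h2]
    have h3 : m i - 1 + m (i + 1) + 1 = N := by omega
    rw [h3]
    simp only [hs i _ _ (Or.inl rfl), hg]
  have e2 : 1 ≤ m (i + 1) → MvPowerSeries.coeff (m - Finsupp.single (i + 1) 1) (divDiffPS i F) =
      ∑ a ∈ Finset.Ioc (max (m i) (m (i + 1) - 1)) N, g a := by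
    intro h
    rw [coeff_divDiffPS]
    have h1 : (m - Finsupp.single (i + 1) 1 : ℕ →₀ ℕ) i = m i := by simp
    have h2 : (m - Finsupp.single (i + 1) 1 : ℕ →₀ ℕ) (i + 1) = m (i + 1) - 1 := by simp
    rw [h1, h2]
    have h3 : m i + (m (i + 1) - 1) + 1 = N := by omega
    rw [h3]
    simp only [hs (i + 1) _ _ (Or.inr rfl), hg]
  have hgm : MvPowerSeries.coeff m F - MvPowerSeries.coeff (setExp m i (m (i + 1)) (m i)) F
      = g (m i) := by
    have h1 : N - m i = m (i + 1) := by omega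
    have h2 : setExp m i (m i) (m (i + 1)) = m := by
      ext j; rw [setExp_apply]; split_ifs with h h <;> simp [h]
    simp only [hg, h1, h2]
  have hganti : g (m i) = - g (m (i + 1)) := by
    have h1 : N - m i = m (i + 1) := by omega
    have h2 : N - m (i + 1) = m i := by omega
    simp only [hg, h1, h2]; ring
  have hfst : (if 1 ≤ m i then
      MvPowerSeries.coeff (m - Finsupp.single i 1) (divDiffPS i F) else 0) =
      ∑ a ∈ Finset.Ioc (max (m i - 1) (m (i + 1))) N, g a := by
    split_ifs with h
    · exact e1 h
    · rw [Finset.Ioc_eq_empty (by omega), Finset.sum_empty]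
  have hsnd : (if 1 ≤ m (i + 1) then
      MvPowerSeries.coeff (m - Finsupp.single (i + 1) 1) (divDiffPS i F) else 0) =
      ∑ a ∈ Finset.Ioc (max (m i) (m (i + 1) - 1)) N, g a := by
    split_ifs with h
    · exact e2 h
    · rw [Finset.Ioc_eq_empty (by omega), Finset.sum_empty]
  rw [hfst, hsnd, hgm]
  rcases lt_trichotomy (m i) (m (i + 1)) with h | h | h
  · have h1 : max (m i - 1) (m (i + 1)) = m (i + 1) := by omega
    have h2 : max (m i) (m (i + 1) - 1) = m (i + 1) - 1 := by omega
    rw [h1, h2, hganti]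
    have : Finset.Ioc (m (i + 1) - 1) N = insert (m (i + 1)) (Finset.Ioc (m (i + 1)) N) := by
      ext a; simp only [Finset.mem_Ioc, Finset.mem_insert]; omega
    rw [this, Finset.sum_insert (by simp)]
    ring
  · have h1 : max (m i - 1) (m (i + 1)) = max (m i) (m (i + 1) - 1) := by omega
    have h3 : g (m i) = 0 := by
      have : N - m i = m i := by omega
      simp [hg, this]
    rw [h1, h3, sub_self]
  · have h1 : max (m i - 1) (m (i + 1)) = m i - 1 := by omega
    have h2 : max (m i) (m (i + 1) - 1) = m i := by omega
    rw [h1, h2]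
    have : Finset.Ioc (m i - 1) N = insert (m i) (Finset.Ioc (m i) N) := by
      ext a; simp only [Finset.mem_Ioc, Finset.mem_insert]; omega
    rw [this, Finset.sum_insert (by simp)]
    ring

lemma X_sub_X_ne_zero (i : ℕ) :
    (MvPowerSeries.X i - MvPowerSeries.X (i + 1) : PS) ≠ 0 := by
  intro h
  have := congrArg (MvPowerSeries.coeff (Finsupp.single i 1)) h
  rw [map_sub, MvPowerSeries.coeff_index_single_self_X, MvPowerSeries.coeff_index_single_X] at this
  simp at this

/-- The operator `𝒯_{i+1}`:
`F ↦ s_{i+1} F + (1 - t) x_{i+1} (F - s_{i+1} F) / (x_{i+1} - x_{i+2})`. -/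
def TPS (i : ℕ) : PS →ₗ[Kqt] PS :=
  (swapPS i).toLinearMap + (1 - tc) • (LinearMap.mulLeft Kqt (MvPowerSeries.X i) ∘ₗ divDiffPS i)

lemma X_sub_mul_TPS (i : ℕ) (F : PS) :
    (MvPowerSeries.X i - MvPowerSeries.X (i + 1)) * (TPS i F - F) =
      (MvPowerSeries.X (i + 1) - tc • MvPowerSeries.X i) * (F - swapPS i F) := by
  have h := divDiffPS_spec i F
  simp only [TPS, LinearMap.add_apply, LinearMap.smul_apply, LinearMap.comp_apply,
    AlgHom.toLinearMap_apply, LinearMap.mulLeft_apply]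
  rw [MvPowerSeries.smul_eq_C_mul, MvPowerSeries.smul_eq_C_mul, map_sub, map_one]
  linear_combination (1 - MvPowerSeries.C tc) * MvPowerSeries.X i * h

lemma TPS_eq_self_iff (i : ℕ) (F : PS) : TPS i F = F ↔ swapPS i F = F := by
  have h := X_sub_mul_TPS i F
  have hne : (MvPowerSeries.X (i + 1) - tc • MvPowerSeries.X i : PS) ≠ 0 := by
    intro h
    have := congrArg (MvPowerSeries.coeff (Finsupp.single (i + 1) 1)) h
    rw [map_sub, map_smul, MvPowerSeries.coeff_index_single_self_X,
      MvPowerSeries.coeff_index_single_X] at this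
    simp at this
  constructor
  · intro h1
    rw [h1, sub_self, mul_zero] at h
    exact (sub_eq_zero.1 ((mul_eq_zero.1 h.symm).resolve_left hne)).symm
  · intro h1
    rw [h1, sub_self, mul_zero] at h
    exact sub_eq_zero.1 ((mul_eq_zero.1 h).resolve_left (X_sub_X_ne_zero i))


lemma IsBdd.add {F G : PS} (hF : IsBdd F) (hG : IsBdd G) : IsBdd (F + G) := by
  obtain ⟨a, ha⟩ := hF
  obtain ⟨b, hb⟩ := hG
  refine ⟨max a b, fun m hm => ?_⟩
  rw [map_add, ha m (by omega), hb m (by omega), add_zero]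

lemma IsBdd.mul {F G : PS} (hF : IsBdd F) (hG : IsBdd G) : IsBdd (F * G) := by
  obtain ⟨a, ha⟩ := hF
  obtain ⟨b, hb⟩ := hG
  refine ⟨a + b, fun m hm => ?_⟩
  rw [MvPowerSeries.coeff_mul]
  refine Finset.sum_eq_zero fun p hp => ?_
  rw [Finset.HasAntidiagonal.mem_antidiagonal] at hp
  have hd : p.1.degree + p.2.degree = m.degree := by rw [← hp, map_add]
  rcases lt_or_ge a p.1.degree with h | h
  · rw [ha _ h, zero_mul]
  · rw [hb _ (by omega), mul_zero]

lemma isBdd_algebraMap (c : Kqt) : IsBdd (algebraMap Kqt PS c) := by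
  refine ⟨0, fun m hm => ?_⟩
  have : m ≠ 0 := by rintro rfl; simp at hm
  rw [MvPowerSeries.algebraMap_apply, Algebra.algebraMap_self_apply, MvPowerSeries.coeff_C,
    if_neg this]

lemma isBdd_X (i : ℕ) : IsBdd (MvPowerSeries.X i) := by
  refine ⟨1, fun m hm => ?_⟩
  rw [MvPowerSeries.coeff_X, if_neg]
  rintro rfl
  simp at hm

lemma IsBdd.rename {F : PS} (hF : IsBdd F) (e : ℕ ↪ ℕ) : IsBdd (MvPowerSeries.rename e F) := by
  obtain ⟨d, hd⟩ := hF
  refine ⟨d, fun m hm => ?_⟩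
  by_cases h : m ∈ Set.range (Finsupp.mapDomain e)
  · obtain ⟨n, rfl⟩ := h
    rw [← Finsupp.embDomain_eq_mapDomain, MvPowerSeries.coeff_embDomain_rename]
    refine hd n ?_
    rwa [Finsupp.degree_mapDomain] at hm
  · exact MvPowerSeries.coeff_rename_eq_zero e F h

lemma degree_setExp (m : ℕ →₀ ℕ) (i a b : ℕ) :
    (setExp m i a b).degree + m i + m (i + 1) = m.degree + a + b := by
  have h : setExp m i a b + Finsupp.single i (m i) + Finsupp.single (i + 1) (m (i + 1)) =
      m + Finsupp.single i a + Finsupp.single (i + 1) b := by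
    ext j
    simp only [Finsupp.add_apply, setExp_apply, Finsupp.single_apply]
    split_ifs <;> first | omega | (subst_vars; omega)
  simpa using congrArg Finsupp.degree h

lemma IsBdd.divDiffPS {F : PS} (hF : IsBdd F) (i : ℕ) : IsBdd (divDiffPS i F) := by
  obtain ⟨d, hd⟩ := hF
  refine ⟨d, fun m hm => ?_⟩
  rw [coeff_divDiffPS]
  refine Finset.sum_eq_zero fun a ha => ?_
  rw [Finset.mem_Ioc] at ha
  rw [hd, hd, sub_zero]
  · have := degree_setExp m i (m i + m (i + 1) + 1 - a) a
    omega
  · have := degree_setExp m i a (m i + m (i + 1) + 1 - a)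
    omega

lemma IsBdd.TPS {F : PS} (hF : IsBdd F) (i : ℕ) : IsBdd (TPS i F) := by
  refine IsBdd.add (hF.rename (Equiv.swap i (i + 1)).toEmbedding) ?_
  change IsBdd ((1 - tc) • (MvPowerSeries.X i * DoubleDyck.divDiffPS i F))
  rw [Algebra.smul_def]
  exact (isBdd_algebraMap _).mul ((isBdd_X i).mul (hF.divDiffPS i))

lemma swapPS_X (i j : ℕ) : swapPS i (MvPowerSeries.X j) =
    MvPowerSeries.X (Equiv.swap i (i + 1) j) :=
  MvPowerSeries.rename_X (Equiv.swap i (i + 1)) j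

lemma swapPS_X_of_ne {i j : ℕ} (h : j ≠ i) (h' : j ≠ i + 1) :
    swapPS i (MvPowerSeries.X j) = MvPowerSeries.X j := by
  rw [swapPS_X, Equiv.swap_apply_of_ne_of_ne h h']

lemma swapPS_comm {i j : ℕ} (h : i + 1 < j) (F : PS) :
    swapPS j (swapPS i F) = swapPS i (swapPS j F) := by
  change MvPowerSeries.rename (Equiv.swap j (j + 1))
      (MvPowerSeries.rename (Equiv.swap i (i + 1)) F) =
    MvPowerSeries.rename (Equiv.swap i (i + 1)) (MvPowerSeries.rename (Equiv.swap j (j + 1)) F)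
  rw [MvPowerSeries.rename_rename, MvPowerSeries.rename_rename]
  have : (Equiv.swap j (j + 1) ∘ Equiv.swap i (i + 1) : ℕ → ℕ) =
      Equiv.swap i (i + 1) ∘ Equiv.swap j (j + 1) := by
    funext a
    simp only [Function.comp_apply, Equiv.swap_apply_def]
    grind
  simp only [this]

lemma swapPS_TPS {i j : ℕ} (h : i + 1 < j) (F : PS) :
    swapPS j (TPS i F) = TPS i (swapPS j F) := by
  have h1 := congrArg (swapPS j) (X_sub_mul_TPS i F)
  simp only [map_mul, map_sub, map_smul] at h1
  rw [swapPS_X_of_ne (by omega) (by omega), swapPS_X_of_ne (by omega) (by omega),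
    swapPS_comm h, ← X_sub_mul_TPS] at h1
  have h2 := mul_left_cancel₀ (X_sub_X_ne_zero i) h1
  exact sub_left_injective h2

/-! ### The spaces `𝒫(k)⁺` and the ring `Sym[X]` -/

/-- `𝒫(k)⁺ = {F ∈ 𝒫_∞⁺ | 𝒯_i F = F for all i > k}`, a subalgebra of `𝒫_∞⁺`. -/
def calP (k : ℕ) : Subalgebra Kqt PS where
  carrier := {F | IsBdd F ∧ ∀ i, k ≤ i → TPS i F = F}
  mul_mem' := by
    rintro F G ⟨hF, hF'⟩ ⟨hG, hG'⟩
    refine ⟨hF.mul hG, fun i hi => ?_⟩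
    rw [TPS_eq_self_iff, map_mul, (TPS_eq_self_iff i F).1 (hF' i hi),
      (TPS_eq_self_iff i G).1 (hG' i hi)]
  add_mem' := by
    rintro F G ⟨hF, hF'⟩ ⟨hG, hG'⟩
    refine ⟨hF.add hG, fun i hi => ?_⟩
    rw [map_add, hF' i hi, hG' i hi]
  algebraMap_mem' c := by
    refine ⟨isBdd_algebraMap c, fun i _ => ?_⟩
    rw [TPS_eq_self_iff, AlgHom.commutes]

lemma mem_calP {k : ℕ} {F : PS} :
    F ∈ calP k ↔ IsBdd F ∧ ∀ i, k ≤ i → swapPS i F = F := by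
  change (IsBdd F ∧ ∀ i, k ≤ i → TPS i F = F) ↔ _
  simp only [TPS_eq_self_iff]

lemma X_mem_calP {i k : ℕ} (h : i < k) : (MvPowerSeries.X i : PS) ∈ calP k :=
  mem_calP.2 ⟨isBdd_X i, fun j hj => swapPS_X_of_ne (by omega) (by omega)⟩

lemma calP_le_succ (k : ℕ) : calP k ≤ calP (k + 1) :=
  fun _ hF => ⟨hF.1, fun i hi => hF.2 i (by omega)⟩

/-- The ring `Sym[X]` of symmetric functions in `x_1, x_2, …`, which is `𝒫(0)⁺`. -/
abbrev SymFun : Type := calP 0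

/-- The substitution `x_i ↦ x_{i+k}`. -/
def shiftPS (k : ℕ) : PS →ₐ[Kqt] PS := MvPowerSeries.rename (addRightEmbedding k)

lemma shiftPS_mem {k : ℕ} {F : PS} (hF : F ∈ calP 0) : shiftPS k F ∈ calP k := by
  rw [mem_calP] at hF ⊢
  refine ⟨hF.1.rename _, fun i hi => ?_⟩
  obtain ⟨j, rfl⟩ := Nat.exists_eq_add_of_le' hi
  conv_rhs => rw [← hF.2 j (Nat.zero_le j)]
  change MvPowerSeries.rename (Equiv.swap (j + k) (j + k + 1))
      (MvPowerSeries.rename (addRightEmbedding k) F) =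
    MvPowerSeries.rename (addRightEmbedding k) (MvPowerSeries.rename (Equiv.swap j (j + 1)) F)
  rw [MvPowerSeries.rename_rename, MvPowerSeries.rename_rename]
  have : (Equiv.swap (j + k) (j + k + 1) ∘ addRightEmbedding k : ℕ → ℕ) =
      addRightEmbedding k ∘ Equiv.swap j (j + 1) := by
    funext a
    simp only [Function.comp_apply, Equiv.swap_apply_def, addRightEmbedding_apply]
    grind
  simp only [this]

/-- `F ↦ F[𝐗_k]`: the symmetric function `F` in the alphabet `𝐗_k = (x_{k+1}, x_{k+2}, …)`. -/
def symShift (k : ℕ) : SymFun →ₐ[Kqt] calP k :=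
  ((shiftPS k).comp (calP 0).val).codRestrict (calP k) fun F => shiftPS_mem F.2

/-- The inclusion `𝒫_k⁺ = ℚ(t,q)[x_1, …, x_k] → 𝒫(k)⁺`. -/
def polyIncl (k : ℕ) : MvPolynomial (Fin k) Kqt →ₐ[Kqt] calP k :=
  MvPolynomial.aeval fun i => ⟨MvPowerSeries.X i.val, X_mem_calP i.isLt⟩

/-- The multiplication map `𝒫_k⁺ ⊗ Sym[𝐗_k] → 𝒫(k)⁺`, `f ⊗ F ↦ f(x_1, …, x_k) F[𝐗_k]`. -/
def mulMap (k : ℕ) : MvPolynomial (Fin k) Kqt ⊗[Kqt] SymFun →ₐ[Kqt] calP k :=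
  Algebra.TensorProduct.lift (polyIncl k) (symShift k) fun _ _ => Commute.all _ _

/-- The power sum `p_n[X] = ∑ x_i ^ n`, for `n ≥ 1`. -/
def psumPS (n : ℕ) : PS := fun m =>
  open Classical in if ∃ i, m = Finsupp.single i n then 1 else 0

lemma coeff_psumPS (n : ℕ) (m : ℕ →₀ ℕ) : MvPowerSeries.coeff m (psumPS n) =
    open Classical in if ∃ i, m = Finsupp.single i n then 1 else 0 := rfl

lemma psumPS_mem (n : ℕ) : psumPS n ∈ calP 0 := by
  refine mem_calP.2 ⟨⟨n, fun m hm => ?_⟩, fun i _ => ?_⟩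
  · rw [coeff_psumPS, if_neg]
    rintro ⟨i, rfl⟩
    simp at hm
  · ext m
    have hm : m = (m.equivMapDomain (Equiv.swap i (i + 1))).embDomain
        (Equiv.swap i (i + 1)).toEmbedding := by
      ext j
      rw [Finsupp.embDomain_eq_mapDomain, Equiv.coe_toEmbedding,
        ← Finsupp.equivMapDomain_eq_mapDomain]
      simp
    have : MvPowerSeries.coeff m (swapPS i (psumPS n)) = MvPowerSeries.coeff
        (m.equivMapDomain (Equiv.swap i (i + 1))) (psumPS n) := by
      conv_lhs => rw [hm]
      exact MvPowerSeries.coeff_embDomain_rename _ _ _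
    rw [this, coeff_psumPS, coeff_psumPS]
    congr 1
    refine propext ⟨fun ⟨j, hj⟩ => ⟨Equiv.swap i (i + 1) j, ?_⟩,
      fun ⟨j, hj⟩ => ⟨Equiv.swap i (i + 1) j, ?_⟩⟩
    · have := congrArg (Finsupp.equivMapDomain (Equiv.swap i (i + 1))) hj
      rw [← Finsupp.equivMapDomain_trans, Finsupp.equivMapDomain_single] at this
      rw [← this]
      ext; simp
    · rw [hj, Finsupp.equivMapDomain_single]

/-- The power sum `p_n[X]` as a symmetric function, for `n ≥ 1`. -/
def psum (n : ℕ) : SymFun := ⟨psumPS n, psumPS_mem n⟩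

/-! ### Plethystic substitution -/

/-- The `ℚ(t,q)`-algebra morphism `Sym[X] → ℚ(t,q)` that sets all variables to `0`. -/
def symConst : SymFun →ₐ[Kqt] Kqt where
  toRingHom := (MvPowerSeries.constantCoeff (σ := ℕ) (R := Kqt)).comp (calP 0).val.toRingHom
  commutes' c := by
    change MvPowerSeries.constantCoeff (algebraMap Kqt PS c) = c
    rw [MvPowerSeries.algebraMap_apply]
    exact MvPowerSeries.constantCoeff_C c

open Classical in
/-- Plethystic substitution `F ↦ F[A]` into an expression `A` with power sums `p_n[A] = a n`,
`n ≥ 1`: the unique morphism of `ℚ(t,q)`-algebras `Sym[X] → R` that sends `p_n[X]` to `a n` for all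
`n ≥ 1`. -/
def pleth {R : Type} [CommRing R] [Algebra Kqt R] (a : ℕ → R) : SymFun →ₐ[Kqt] R :=
  if h : ∃ φ : SymFun →ₐ[Kqt] R, ∀ n, 1 ≤ n → φ (psum n) = a n then h.choose
  else (Algebra.ofId Kqt R).comp symConst

/-- `h_n[A]` for an expression `A` with power sums `p_m[A] = a m`, `m ≥ 1`: the coefficient of
`w ^ n` in `Exp[w A] = exp (∑_{m ≥ 1} p_m[A] w ^ m / m)`. The exponential series is cut off after
its `n`-th term since the inner series has no constant term. -/
def plethH {R : Type} [CommRing R] [Algebra Kqt R] (a : ℕ → R) (n : ℕ) : R :=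
  ∑ j ∈ Finset.range (n + 1), ((j.factorial : Kqt)⁻¹) •
    PowerSeries.coeff n ((PowerSeries.mk fun m => if m = 0 then 0 else (m : Kqt)⁻¹ • a m) ^ j)

/-! ### Hall–Littlewood functions and the operators `ℬ_n` -/

/-- The normalization `v_μ(s) = ∏_{r ≥ 0} ∏_{a = 1}^{m_r} (1 - s ^ a) / (1 - s)` for `n` variables,
where `m_r` is the number of parts equal to `r` among `μ_1, …, μ_n`. -/
def hlNorm (s : Kqt) (μ : YoungDiagram) (n : ℕ) : Kqt :=
  ∏ r ∈ Finset.range (μ.rowLen 0 + 1),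
    ∏ a ∈ Finset.Icc 1 (Finset.univ.filter fun i : Fin n => μ.rowLen i = r).card,
      (1 - s ^ a) / (1 - s)

/-- The numerator `∑_w sgn(w) w(x^μ ∏_{i<j} (x_i - s x_j))` of the Hall–Littlewood polynomial. -/
def hlNumerator (s : Kqt) (μ : YoungDiagram) (n : ℕ) : MvPolynomial (Fin n) Kqt :=
  ∑ w : Equiv.Perm (Fin n), (Equiv.Perm.sign w : ℤ) • MvPolynomial.rename w
    ((∏ i : Fin n, MvPolynomial.X i ^ μ.rowLen i) *
      ∏ i : Fin n, ∏ j ∈ Finset.Ioi i, (MvPolynomial.X i - MvPolynomial.C s * MvPolynomial.X j))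

/-- `F` is the Hall–Littlewood symmetric function `P_μ(X, s)`: for all `n ≥ ℓ(μ)`, setting
`x_i = 0` for `i > n` in `F` gives the Hall–Littlewood polynomial
`v_μ(s)⁻¹ ∑_{w ∈ S_n} w(x^μ ∏_{i<j} (x_i - s x_j) / (x_i - x_j))`
(the equation is multiplied by `v_μ(s) ∏_{i<j} (x_i - x_j)`). -/
def IsHallLittlewood (s : Kqt) (μ : YoungDiagram) (F : SymFun) : Prop :=
  ∀ n, μ.colLen 0 ≤ n →
    ((MvPolynomial.C (hlNorm s μ n) * ∏ i : Fin n, ∏ j ∈ Finset.Ioi i,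
        (MvPolynomial.X i - MvPolynomial.X j) : MvPolynomial (Fin n) Kqt) :
          MvPowerSeries (Fin n) Kqt) *
      MvPowerSeries.killCompl Fin.valEmbedding (F : PS) =
    (hlNumerator s μ n : MvPowerSeries (Fin n) Kqt)

open Classical in
/-- The operator `ℬ_0` on `Sym[X]`: the linear operator with
`ℬ_0 P_μ(X, t⁻¹) = t ^ ℓ(μ) P_μ(X, t⁻¹)` for all partitions `μ`. -/
def opBZero : SymFun →ₗ[Kqt] SymFun :=
  if h : ∃ B : SymFun →ₗ[Kqt] SymFun, ∀ (μ : YoungDiagram) (F : SymFun), IsHallLittlewood tc⁻¹ μ F →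
    B F = tc ^ μ.colLen 0 • F then h.choose else 0

/-- The operators `ℬ_n`: `ℬ_{n+1} = [ℬ_∞, ℬ_n]`, where `ℬ_∞` is the multiplication by
`e_1[X] = p_1[X]`. -/
def opB : ℕ → (SymFun →ₗ[Kqt] SymFun)
  | 0 => opBZero
  | n + 1 => LinearMap.mulLeft Kqt (psum 1) ∘ₗ opB n - opB n ∘ₗ LinearMap.mulLeft Kqt (psum 1)

/-! ### The representation on `𝒫_• = (𝒫(k)⁺)_k` -/

lemma TPS_mem {i k : ℕ} (h : i < k) {F : PS} (hF : F ∈ calP (k + 1)) :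
    TPS i F ∈ calP (k + 1) := by
  refine ⟨hF.1.TPS i, fun j hj => ?_⟩
  rw [TPS_eq_self_iff, swapPS_TPS (by omega), (TPS_eq_self_iff j F).1 (hF.2 j hj)]

/-- The operator `𝒯_{i+1}` on `𝒫(k+1)⁺`, for `0 ≤ i < k`. -/
def calT (k : ℕ) (i : Fin k) : Module.End Kqt (calP (k + 1)) where
  toFun F := ⟨TPS i F.1, TPS_mem i.isLt F.2⟩
  map_add' F G := Subtype.ext (map_add (TPS i) F.1 G.1)
  map_smul' c F := Subtype.ext (map_smul (TPS i) c F.1)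

/-- The inclusion `ι(k) : 𝒫(k)⁺ → 𝒫(k+1)⁺`. -/
def calIncl (k : ℕ) : calP k →ₐ[Kqt] calP (k + 1) := Subalgebra.inclusion (calP_le_succ k)

/-- `x_{k+1}` as an element of `𝒫(k+1)⁺`. -/
def xLast (k : ℕ) : calP (k + 1) := ⟨MvPowerSeries.X k, X_mem_calP (Nat.lt_succ_self k)⟩

/-- `∂_k = - ω̃_{k+1}⁻¹ ι(k)`, with `ω̃_{k+1}⁻¹ = 𝒯_1 ⋯ 𝒯_k x_{k+1}`. -/
def calDPlus (k : ℕ) : calP k →ₗ[Kqt] calP (k + 1) :=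
  -((List.ofFn (calT k)).prod ∘ₗ LinearMap.mulLeft Kqt (xLast k) ∘ₗ (calIncl k).toLinearMap)

/-- The permutation `1 ↦ 2 ↦ ⋯ ↦ k + 1 ↦ 1` of the indices (shifted by one: it permutes
`0, …, k`). -/
def cyc (k : ℕ) : Equiv.Perm ℕ where
  toFun i := if i < k then i + 1 else if i = k then 0 else i
  invFun i := if i = 0 then k else if i ≤ k then i - 1 else i
  left_inv i := by grind
  right_inv i := by grind

/-- `ω_{k+1}⁻¹`, extended linearly over the symmetric functions in `x_{k+2}, x_{k+3}, …`: the
substitution `x_i ↦ x_{i+1}` for `i ≤ k` and `x_{k+1} ↦ q x_1`, which fixes `x_i` for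
`i > k + 1`. -/
def omegaInvPS (k : ℕ) : PS →ₗ[Kqt] PS where
  toFun F := MvPowerSeries.rescale (Function.update 1 0 qc) (MvPowerSeries.rename (cyc k) F)
  map_add' F G := by rw [map_add, map_add]
  map_smul' c F := by
    rw [map_smul, MvPowerSeries.smul_eq_C_mul, map_mul, MvPowerSeries.smul_eq_C_mul]
    congr 1
    ext m
    rw [MvPowerSeries.coeff_rescale, MvPowerSeries.coeff_C, RingHom.id_apply,
      MvPowerSeries.coeff_C]
    split_ifs with h
    · simp [h]
    · rw [mul_zero]

lemma swapPS_omegaInvPS {k j : ℕ} (h : k + 1 ≤ j) (F : PS) :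
    swapPS j (omegaInvPS k F) = omegaInvPS k (swapPS j F) := by
  have hq : ∀ G : PS, swapPS j (MvPowerSeries.rescale (Function.update 1 0 qc) G) =
      MvPowerSeries.rescale (Function.update 1 0 qc) (swapPS j G) := by
    intro G
    have hprod : ∀ m : ℕ →₀ ℕ,
        (m.prod fun s e => (Function.update (1 : ℕ → Kqt) 0 qc s) ^ e) = qc ^ m 0 := by
      intro m
      rw [Finsupp.prod_eq_single 0]
      · simp
      · intro b _ hb
        simp [Function.update_of_ne hb]
      · simp
    ext m
    rw [coeff_swapPS, MvPowerSeries.coeff_rescale, MvPowerSeries.coeff_rescale, coeff_swapPS,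
      hprod, hprod, setExp_apply, if_neg (by omega), if_neg (by omega)]
  change swapPS j (MvPowerSeries.rescale _ _) = MvPowerSeries.rescale _ _
  rw [hq]
  congr 1
  change MvPowerSeries.rename (Equiv.swap j (j + 1)) (MvPowerSeries.rename (cyc k) F) =
    MvPowerSeries.rename (cyc k) (MvPowerSeries.rename (Equiv.swap j (j + 1)) F)
  rw [MvPowerSeries.rename_rename, MvPowerSeries.rename_rename]
  have : (Equiv.swap j (j + 1) ∘ cyc k : ℕ → ℕ) = cyc k ∘ Equiv.swap j (j + 1) := by
    funext a
    simp only [Function.comp_apply, Equiv.swap_apply_def, cyc, Equiv.coe_fn_mk]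
    grind
  simp only [this]

lemma omegaInvPS_mem {k : ℕ} {F : PS} (hF : F ∈ calP (k + 1)) : omegaInvPS k F ∈ calP (k + 1) := by
  rw [mem_calP] at hF ⊢
  refine ⟨?_, fun i hi => by rw [swapPS_omegaInvPS hi, hF.2 i hi]⟩
  obtain ⟨d, hd⟩ := hF.1.rename (cyc k).toEmbedding
  refine ⟨d, fun m hm => ?_⟩
  change MvPowerSeries.coeff m (MvPowerSeries.rescale _ _) = 0
  rw [MvPowerSeries.coeff_rescale]
  exact mul_eq_zero_of_right _ (hd m hm)

/-- `∂_k* = ω_{k+1}⁻¹ ι(k)`. -/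
def calDPlusStar (k : ℕ) : calP k →ₗ[Kqt] calP (k + 1) where
  toFun F := ⟨omegaInvPS k (calIncl k F), omegaInvPS_mem (calIncl k F).2⟩
  map_add' F G := Subtype.ext (map_add (omegaInvPS k) F.1 G.1)
  map_smul' c F := Subtype.ext (map_smul (omegaInvPS k) c F.1)

open Classical in
/-- `∂⁻_{k+1} : 𝒫(k+1)⁺ → 𝒫(k)⁺`, the `𝒫_k⁺`-linear map with
`∂⁻_{k+1} (x_{k+1}^n F[𝐗_{k+1}]) = (ℬ_n F)[𝐗_k]` for all `n ≥ 0` and `F ∈ Sym[X]`. -/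
def calDMinus (k : ℕ) : calP (k + 1) →ₗ[Kqt] calP k :=
  if h : ∃ D : calP (k + 1) →ₗ[Kqt] calP k,
      (∀ (f : MvPolynomial (Fin k) Kqt) (G : calP (k + 1)),
        D (calIncl k (polyIncl k f) * G) = polyIncl k f * D G) ∧
      ∀ (n : ℕ) (F : SymFun), D (xLast k ^ n * symShift (k + 1) F) = symShift k (opB n F)
  then h.choose else 0

/-- The quiver representation `𝒫_• = (𝒫(k)⁺)_{k ≥ 0}`. -/
abbrev calPRep : QuiverRep where
  V k := calP k
  T := calT
  dPlus := calDPlus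
  dPlusStar := calDPlusStar
  dMinus := calDMinus

/-! ### The standard representation on `V_• = (V_k)_k` -/

lemma X_sub_X_dvd {n : ℕ} (i j : Fin n) (f : MvPolynomial (Fin n) Kqt) :
    (MvPolynomial.X i - MvPolynomial.X j) ∣ f - MvPolynomial.rename (Equiv.swap i j) f := by
  induction f using MvPolynomial.induction_on with
  | C a => simp
  | add f g hf hg =>
    have := dvd_add hf hg
    rwa [map_add, add_sub_add_comm]
  | mul_X f a hf =>
    have h1 : (MvPolynomial.X i - MvPolynomial.X j : MvPolynomial (Fin n) Kqt) ∣
        MvPolynomial.X a - MvPolynomial.X (Equiv.swap i j a) := by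
      rw [Equiv.swap_apply_def]
      split_ifs with h h'
      · rw [h]
      · rw [h']; exact ⟨-1, by ring⟩
      · simp
    rw [map_mul, MvPolynomial.rename_X]
    have := dvd_add (hf.mul_right (MvPolynomial.X a))
      (h1.mul_left (MvPolynomial.rename (Equiv.swap i j) f))
    convert this using 1
    ring

/-- The divided difference `f ↦ (f - s_{i+1} f) / (y_{i+1} - y_{i+2})` on polynomials in
`y_1, …, y_{k+1}`. -/
def divDiffPoly (k : ℕ) (i : Fin k) :
    MvPolynomial (Fin (k + 1)) Kqt →ₗ[Kqt] MvPolynomial (Fin (k + 1)) Kqt :=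
  have hne : (MvPolynomial.X i.castSucc - MvPolynomial.X i.succ :
      MvPolynomial (Fin (k + 1)) Kqt) ≠ 0 := fun h =>
    (Fin.castSucc_lt_succ (i := i)).ne (MvPolynomial.X_injective (sub_eq_zero.1 h))
  { toFun f := (X_sub_X_dvd i.castSucc i.succ f).choose
    map_add' f g := by
      apply mul_left_cancel₀ hne
      rw [mul_add, ← (X_sub_X_dvd i.castSucc i.succ (f + g)).choose_spec,
        ← (X_sub_X_dvd i.castSucc i.succ f).choose_spec,
        ← (X_sub_X_dvd i.castSucc i.succ g).choose_spec, map_add]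
      ring
    map_smul' c f := by
      apply mul_left_cancel₀ hne
      rw [RingHom.id_apply, mul_smul_comm, ← (X_sub_X_dvd i.castSucc i.succ (c • f)).choose_spec,
        ← (X_sub_X_dvd i.castSucc i.succ f).choose_spec, map_smul, smul_sub] }

lemma divDiffPoly_spec (k : ℕ) (i : Fin k) (f : MvPolynomial (Fin (k + 1)) Kqt) :
    (MvPolynomial.X i.castSucc - MvPolynomial.X i.succ) * divDiffPoly k i f =
      f - MvPolynomial.rename (Equiv.swap i.castSucc i.succ) f :=
  (X_sub_X_dvd i.castSucc i.succ f).choose_spec.symm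

/-- `f ↦ s_{i+1} f + (1 - t) y_{i+1} (f - s_{i+1} f) / (y_{i+1} - y_{i+2})` on polynomials in
`y_1, …, y_{k+1}`. -/
def polyT (k : ℕ) (i : Fin k) :
    MvPolynomial (Fin (k + 1)) Kqt →ₗ[Kqt] MvPolynomial (Fin (k + 1)) Kqt :=
  (MvPolynomial.rename (Equiv.swap i.castSucc i.succ)).toLinearMap +
    (1 - tc) • (LinearMap.mulLeft Kqt (MvPolynomial.X i.castSucc) ∘ₗ divDiffPoly k i)

/-- `V_k = ℚ(t,q)[y_1, …, y_k] ⊗ Sym[X]`. -/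
abbrev VStd (k : ℕ) : Type := MvPolynomial (Fin k) Kqt ⊗[Kqt] SymFun

/-- The element `y_{i+1}` of `V_k`. -/
def yv {k : ℕ} (i : Fin k) : VStd k := MvPolynomial.X i ⊗ₜ 1

/-- The operators `T_{i+1}` on `V_{k+1}`, linear over `Sym[X]`. -/
def stdT (k : ℕ) (i : Fin k) : Module.End Kqt (VStd (k + 1)) :=
  TensorProduct.map (polyT k i) LinearMap.id

/-- `V_k → V_{k+1}`, `F ↦ F[X + (t - 1) y_{k+1}]`. -/
def addVar (k : ℕ) : VStd k →ₐ[Kqt] VStd (k + 1) :=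
  Algebra.TensorProduct.lift (MvPolynomial.aeval fun i => yv i.castSucc)
    (pleth fun n => 1 ⊗ₜ psum n + (tc ^ n - 1) • yv (Fin.last k) ^ n) fun _ _ => Commute.all _ _

/-- `d₊ F = - T_1 ⋯ T_k (y_{k+1} F[X + (t - 1) y_{k+1}])`. -/
def stdDPlus (k : ℕ) : VStd k →ₗ[Kqt] VStd (k + 1) :=
  -((List.ofFn (stdT k)).prod ∘ₗ LinearMap.mulLeft Kqt (yv (Fin.last k)) ∘ₗ
    (addVar k).toLinearMap)

/-- `ζ_{k+1}` on `V_{k+1}`: `y_i ↦ y_{i+1}` for `i ≤ k`, `y_{k+1} ↦ q y_1`, trivial on `Sym[X]`. -/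
def zeta (k : ℕ) : VStd (k + 1) →ₐ[Kqt] VStd (k + 1) :=
  Algebra.TensorProduct.map
    (MvPolynomial.aeval (Fin.lastCases (qc • MvPolynomial.X 0) fun i => MvPolynomial.X i.succ))
    (AlgHom.id Kqt SymFun)

/-- `d₊* F = ζ_{k+1} F[X + (t - 1) y_{k+1}]`. -/
def stdDPlusStar (k : ℕ) : VStd k →ₗ[Kqt] VStd (k + 1) :=
  ((zeta k).comp (addVar k)).toLinearMap

/-- `F ↦ F[X - (t - 1) y_{k+1}]`, as a map from `V_{k+1}` to the polynomials in `y_{k+1}` with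
coefficients in `V_k`. -/
def subVar (k : ℕ) : VStd (k + 1) →ₐ[Kqt] Polynomial (VStd k) :=
  Algebra.TensorProduct.lift
    (MvPolynomial.aeval (Fin.lastCases Polynomial.X fun i => Polynomial.C (yv i)))
    (pleth (R := Polynomial (VStd k)) fun n => Polynomial.C (1 ⊗ₜ psum n : VStd k) - (tc ^ n - 1) • Polynomial.X ^ n)
    fun _ _ => Commute.all (S := Polynomial (VStd k)) _ _

/-- `d₋ F`, the constant term with respect to `y_{k+1}` of
`F[X - (t - 1) y_{k+1}] Exp[- y_{k+1}⁻¹ X]`. Since `Exp[- y⁻¹ X] = ∑_n h_n[-X] y⁻ⁿ`, this is the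
sum of `c_n h_n[-X]` over the coefficients `c_n` of `F[X - (t - 1) y_{k+1}] = ∑_n c_n y_{k+1}^n`. -/
def stdDMinus (k : ℕ) : VStd (k + 1) →ₗ[Kqt] VStd k :=
  (Polynomial.lsum fun n =>
    LinearMap.mulRight Kqt (1 ⊗ₜ plethH (fun m => -psum m) n : VStd k)) ∘ₗ (subVar k).toLinearMap

/-- The standard representation `V_• = (V_k)_{k ≥ 0}`. -/
abbrev stdRep : QuiverRep where
  V k := VStd k
  T := stdT
  dPlus := stdDPlus
  dPlusStar := stdDPlusStar
  dMinus := stdDMinus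

end DoubleDyck

end

open DoubleDyck

/-!
All relations are checked in the standard representation `V_•` and carried over to `𝒫_•` along an
isomorphism.

**The spaces `𝒫(k)⁺`.** An element of `𝒫(k)⁺` is symmetric in `x_{k+1}, x_{k+2}, …`. Hence its
coefficient at a monomial in `x_1, …, x_k` is a symmetric function of `𝐗_k`, and bounded degree leaves
finitely many of these coefficients: the multiplication map is bijective (`mulMap_bijective`). That
the power sums generate `Sym[X]` freely follows from Newton's identities, which make them generators,
and from the fact that a surjective endomorphism of a Noetherian ring is injective. So plethystic
substitutions exist, and morphisms out of `Sym[X]` or `V_k` are determined by power sums and the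
`y_i`.

**The standard representation.** Every operator is written with algebra morphisms: `addVar` is
`F ↦ F[X + (t - 1) y_{k+1}]`, `psi` is `d₊*`, `subVar` is `F ↦ F[X - (t - 1) u]` with the last variable
renamed to `u`, and `d₋ F` is the constant term of the product of `subVar F` and `Exp[-u⁻¹ X]`. The
operators `T_i` are known by the equation that defines them (`HeckeOp`), which morphisms respect. Since
`d₊ = -T_1 ⋯ T_k δ` with `δ F = y_{k+1} F[X + (t - 1) y_{k+1}]`, the relations of the algebra follow from
simpler ones between `T_i`, `d₋`, `d₊*`, `δ` and multiplication by `y_i`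
(`QuiverRep.CoreRelations.isDDPARep`). The essential ones among these are identities of constant terms
in one or two variables: adding a variable to `X` multiplies `Exp[-u⁻¹ X]` by a quotient of two linear
factors, and antisymmetric polynomials pair to zero with symmetric kernels (`stdRep_isDDPARep`).

**The operators `ℬ_n`.** They are the vertex operators that send `F` to the constant term in `u` of
`u ^ n F[X - u] Exp[(1 - t) u⁻¹ X]` (`opB_apply`). For `n = 0`, partial fractions
(`prod_partialFractions`) compute this operator in finitely many variables, and the expansion of the
Hall–Littlewood numerator along one variable (`hlNumerator_succ`) shows that `P_μ(X, t⁻¹)` is an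
eigenvector with eigenvalue `t ^ ℓ(μ)`. Conversely the operator acts by `t ^ n` on the functions that
vanish in fewer than `n` variables modulo those that vanish in `n` variables. So every symmetric
function is a sum of eigenvectors, and an eigenvector for `t ^ l` is determined by its restriction to
`l` variables, which is divisible by `x_1 ⋯ x_l`. As multiplication by `x_1 ⋯ x_l` adds a column to the
diagram of a Hall–Littlewood function, induction on the degree shows that these functions span
`Sym[X]` (`hlSpan_eq_top`), and `ℬ_0` is the operator just described. The recursion for `ℬ_{n+1}` is the
effect of `e_1` on the constant term.

**The isomorphism.** The morphism `calOfV` sends `y_i` to `x_i` and `p_n` to `(t ^ n - 1) p_n[𝐗_k]`. It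
turns `X - (t - 1) u` into `𝐗_k - u` and `Exp[-u⁻¹ X]` into `Exp[(1 - t) u⁻¹ 𝐗_k]`, hence the
constant term for `d₋` into the vertex operators; the other arrows are compared on generators
(`isHom_calOfV_symm`). A representation that embeds into one satisfying the relations satisfies them
itself (`QuiverRep.IsHom.isDDPARep`).
-/

open scoped TensorProduct Polynomial

noncomputable section

namespace DoubleDyck

/-! ### The parameters -/

instance : CharZero Kqt :=
  inferInstanceAs (CharZero (FractionRing (MvPolynomial (Fin 2) ℚ)))

lemma tc_ne_zero : tc ≠ 0 := by
  intro h
  have := (IsFractionRing.injective (MvPolynomial (Fin 2) ℚ)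
    (FractionRing (MvPolynomial (Fin 2) ℚ))) (h.trans (map_zero _).symm)
  exact MvPolynomial.X_ne_zero _ this

lemma tc_pow_sub_one_ne_zero {n : ℕ} (hn : n ≠ 0) : tc ^ n - 1 ≠ 0 := by
  intro h
  have h1 : algebraMap (MvPolynomial (Fin 2) ℚ) (FractionRing (MvPolynomial (Fin 2) ℚ))
      (MvPolynomial.X 0 ^ n) = algebraMap _ _ 1 := by
    rw [map_pow, map_one]; exact sub_eq_zero.1 h
  have h2 := (IsFractionRing.injective (MvPolynomial (Fin 2) ℚ)
    (FractionRing (MvPolynomial (Fin 2) ℚ))) h1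
  have := congrArg (MvPolynomial.eval fun _ => (2 : ℚ)) h2
  simp only [map_pow, MvPolynomial.eval_X, map_one] at this
  exact absurd ((pow_eq_one_iff_of_nonneg (by norm_num) hn).1 this) (by norm_num)

lemma tc_sub_one_ne_zero : tc - 1 ≠ 0 := by
  simpa using tc_pow_sub_one_ne_zero one_ne_zero

/-! ### Power sums in finitely many variables -/

/-- By Newton's identities, elementary symmetric polynomials are polynomials in power sums. -/
lemma esymm_mem_adjoin_psum {σ K : Type*} [Fintype σ] [Field K] [CharZero K] (k : ℕ) :
    MvPolynomial.esymm σ K k ∈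
      Algebra.adjoin K (Set.range fun i : Fin k => MvPolynomial.psum σ K (i + 1)) := by
  classical
  induction k using Nat.strong_induction_on with
  | _ k ih =>
    rcases Nat.eq_zero_or_pos k with rfl | hk
    · simp
    have h := MvPolynomial.mul_esymm_eq_sum σ K k
    have hk' : (k : K) ≠ 0 := by exact_mod_cast hk.ne'
    have h2 : MvPolynomial.esymm σ K k = (k : K)⁻¹ • ((k : MvPolynomial σ K) *
        MvPolynomial.esymm σ K k) := by
      rw [← nsmul_eq_mul, ← Nat.cast_smul_eq_nsmul K, smul_smul, inv_mul_cancel₀ hk', one_smul]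
    rw [h2, h]
    refine Subalgebra.smul_mem _ (Subalgebra.mul_mem _ ?_ (Subalgebra.sum_mem _ ?_)) _
    · exact Subalgebra.pow_mem _ (Subalgebra.neg_mem _ (Subalgebra.one_mem _)) _
    · intro a ha
      rw [Finset.mem_filter, Finset.HasAntidiagonal.mem_antidiagonal] at ha
      refine Subalgebra.mul_mem _ (Subalgebra.mul_mem _ ?_ ?_) ?_
      · exact Subalgebra.pow_mem _ (Subalgebra.neg_mem _ (Subalgebra.one_mem _)) _
      · refine Algebra.adjoin_mono ?_ (ih a.1 ha.2)
        rintro _ ⟨i, rfl⟩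
        exact ⟨⟨i, by omega⟩, rfl⟩
      · refine Algebra.subset_adjoin ⟨⟨a.2 - 1, by omega⟩, ?_⟩
        have : a.2 - 1 + 1 = a.2 := by omega
        simp [this]

/-- Every symmetric polynomial in `n` variables is a polynomial in the first `n` power sums. -/
lemma exists_aeval_psum_eq {K : Type*} [Field K] [CharZero K] {n : ℕ}
    {p : MvPolynomial (Fin n) K} (hp : p.IsSymmetric) :
    ∃ P : MvPolynomial (Fin n) K,
      MvPolynomial.aeval (fun i : Fin n => MvPolynomial.psum (Fin n) K (i + 1)) P = p := by
  obtain ⟨q, hq⟩ := (MvPolynomial.esymmAlgHom_fin_bijective K n).2 ⟨p, hp⟩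
  have hq' := congrArg Subtype.val hq
  rw [MvPolynomial.esymmAlgHom_apply] at hq'
  change p ∈ Set.range _
  rw [← AlgHom.coe_range, ← Algebra.adjoin_range_eq_range_aeval]
  change p ∈ Algebra.adjoin _ _
  change _ = p at hq'
  rw [← hq']
  have : MvPolynomial.aeval (fun i : Fin n => MvPolynomial.esymm (Fin n) K (i + 1)) q ∈
      Algebra.adjoin K (Set.range fun i : Fin n => MvPolynomial.esymm (Fin n) K (i + 1)) := by
    rw [Algebra.adjoin_range_eq_range_aeval]; exact ⟨q, rfl⟩
  refine Algebra.adjoin_le ?_ this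
  rintro _ ⟨i, rfl⟩
  refine Algebra.adjoin_mono ?_ (esymm_mem_adjoin_psum (σ := Fin n) (K := K) (i + 1))
  rintro _ ⟨j, rfl⟩
  exact ⟨⟨j, by omega⟩, rfl⟩

/-- A surjective endomorphism of a Noetherian ring is injective. -/
lemma injective_of_surjective_ringHom {R : Type*} [CommRing R] [IsNoetherianRing R] (f : R →+* R)
    (hf : Function.Surjective f) : Function.Injective f := by
  have hmono : Monotone fun n : ℕ => RingHom.ker (f ^ n) := by
    refine monotone_nat_of_le_succ fun n x hx => ?_
    rw [RingHom.mem_ker] at hx ⊢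
    rw [pow_succ', RingHom.mul_def, RingHom.comp_apply, hx, map_zero]
  obtain ⟨n, hn⟩ := monotone_stabilizes_iff_noetherian.2 ‹IsNoetherianRing R› ⟨_, hmono⟩
  rw [injective_iff_map_eq_zero]
  intro x hx
  have hs : Function.Surjective (f ^ n) := by
    rw [RingHom.coe_pow]; exact hf.iterate n
  obtain ⟨y, rfl⟩ := hs x
  have : y ∈ RingHom.ker (f ^ (n + 1)) := by
    rw [RingHom.mem_ker, pow_succ', RingHom.mul_def, RingHom.comp_apply, hx]
  have h2 := hn (n + 1) (Nat.le_succ n)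
  change RingHom.ker (f ^ n) = RingHom.ker (f ^ (n + 1)) at h2
  exact RingHom.mem_ker.1 (by rwa [h2])

/-- The first `n` power sums in `n` variables are algebraically independent: by Newton's identities
they generate the ring of symmetric polynomials, which is a polynomial ring in `n` variables, and a
surjective endomorphism of a Noetherian ring is injective. -/
lemma aeval_psum_injective {K : Type*} [Field K] [CharZero K] (n : ℕ) :
    Function.Injective
      (MvPolynomial.aeval (R := K) fun i : Fin n => MvPolynomial.psum (Fin n) K (i + 1)) := by
  let e := MvPolynomial.esymmAlgEquiv (Fin n) (R := K) (n := n) (Fintype.card_fin n)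
  let g : MvPolynomial (Fin n) K →ₐ[K] MvPolynomial.symmetricSubalgebra (Fin n) K :=
    MvPolynomial.aeval fun i => ⟨MvPolynomial.psum (Fin n) K (i + 1),
      MvPolynomial.psum_isSymmetric _ _ _⟩
  have hg : ∀ P, (g P).1 = MvPolynomial.aeval
      (fun i : Fin n => MvPolynomial.psum (Fin n) K (i + 1)) P := fun P =>
    (Subalgebra.mvPolynomial_aeval_coe _ _ _).symm
  have hgs : Function.Surjective g := by
    intro p
    obtain ⟨P, hP⟩ := exists_aeval_psum_eq p.2
    exact ⟨P, Subtype.ext ((hg P).trans hP)⟩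
  have hi := injective_of_surjective_ringHom (e.symm.toAlgHom.comp g).toRingHom
    (e.symm.surjective.comp hgs)
  intro P Q h
  apply hi
  rw [← hg, ← hg] at h
  exact congrArg e.symm (Subtype.ext h)

/-! ### Restriction of symmetric functions to finitely many variables -/

/-- Setting `x_i = 0` for `i > n` in a symmetric function. -/
def resPoly (n : ℕ) (F : SymFun) : MvPolynomial (Fin n) Kqt :=
  MvPowerSeries.truncTotal (F.2.1.choose + 1) (MvPowerSeries.killCompl Fin.valEmbedding (F : PS))

lemma coeff_resPoly (n : ℕ) (F : SymFun) (m : Fin n →₀ ℕ) :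
    (resPoly n F).coeff m =
      MvPowerSeries.coeff (m.embDomain Fin.valEmbedding) (F : PS) := by
  rw [resPoly, MvPowerSeries.coeff_truncTotal_eq_ite, MvPowerSeries.coeff_killCompl]
  split_ifs with h
  · rfl
  · refine (F.2.1.choose_spec _ ?_).symm
    rw [Finsupp.embDomain_eq_mapDomain, Finsupp.degree_mapDomain]
    omega

lemma coe_resPoly (n : ℕ) (F : SymFun) : (resPoly n F : MvPowerSeries (Fin n) Kqt) =
    MvPowerSeries.killCompl Fin.valEmbedding (F : PS) := by
  ext m
  rw [MvPolynomial.coeff_coe, coeff_resPoly, MvPowerSeries.coeff_killCompl]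

/-- Setting `x_i = 0` for `i > n`, as a morphism from symmetric functions to polynomials. -/
def res (n : ℕ) : SymFun →ₐ[Kqt] MvPolynomial (Fin n) Kqt where
  toFun := resPoly n
  map_one' := by apply MvPolynomial.coe_injective; rw [coe_resPoly]; simp
  map_mul' F G := by
    apply MvPolynomial.coe_injective
    rw [MvPolynomial.coe_mul, coe_resPoly, coe_resPoly, coe_resPoly]; simp
  map_zero' := by apply MvPolynomial.coe_injective; rw [coe_resPoly]; simp
  map_add' F G := by
    apply MvPolynomial.coe_injective
    rw [MvPolynomial.coe_add, coe_resPoly, coe_resPoly, coe_resPoly]; simp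
  commutes' c := by
    apply MvPolynomial.coe_injective
    rw [coe_resPoly, MvPolynomial.algebraMap_eq, MvPolynomial.coe_C]
    exact MvPowerSeries.killCompl_C c

lemma coe_res (n : ℕ) (F : SymFun) : (res n F : MvPowerSeries (Fin n) Kqt) =
    MvPowerSeries.killCompl Fin.valEmbedding (F : PS) := coe_resPoly n F

lemma coeff_res (n : ℕ) (F : SymFun) (m : Fin n →₀ ℕ) : (res n F).coeff m =
    MvPowerSeries.coeff (m.embDomain Fin.valEmbedding) (F : PS) := coeff_resPoly n F m

lemma coeff_setExp_eq (F : SymFun) (i : ℕ) (m : ℕ →₀ ℕ) :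
    MvPowerSeries.coeff (setExp m i (m (i + 1)) (m i)) (F : PS) =
      MvPowerSeries.coeff m (F : PS) := by
  rw [← coeff_swapPS, (mem_calP.1 F.2).2 i (Nat.zero_le i)]

/-- An exponent that involves at most `d` variables has the same coefficient in every symmetric
function as some exponent of the same degree that only involves the first `d` variables: a variable
that occurs can be moved down to a lower index that does not. -/
lemma exists_coeff_eq_coeff_res {d : ℕ} (m : ℕ →₀ ℕ) (hm : m.support.card ≤ d) :
    ∃ x : Fin d →₀ ℕ, x.degree = m.degree ∧
      ∀ F : SymFun, MvPowerSeries.coeff m (F : PS) = (res d F).coeff x := by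
  induction hw : ∑ j ∈ m.support, j using Nat.strong_induction_on generalizing m with
  | _ N ih =>
  subst hw
  by_cases hsup : ∀ j ∈ m.support, j < d
  · refine ⟨m.comapDomain Fin.val (Fin.val_injective.injOn), ?_, ?_⟩
    all_goals
      have he : (m.comapDomain Fin.val (Fin.val_injective.injOn)).embDomain
          (Fin.valEmbedding (n := d)) = m := by
        ext j
        by_cases hj : j < d
        · exact (Finsupp.embDomain_apply_self Fin.valEmbedding _ (⟨j, hj⟩ : Fin d)).trans
            (by simp)
        · rw [Finsupp.embDomain_of_notMem_range]
          · by_contra h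
            exact hj (hsup j (Finsupp.mem_support_iff.2 (Ne.symm h)))
          · rintro ⟨a, rfl⟩; exact hj a.2
    · conv_rhs => rw [← he]
      rw [Finsupp.embDomain_eq_mapDomain, Finsupp.degree_mapDomain]
    · intro F; rw [coeff_res, he]
  · push Not at hsup
    obtain ⟨j, hj, hjd⟩ := hsup
    -- some index below `j` is missing from the support, hence a missing one has its successor in it
    have hmiss : ∃ i, m i = 0 ∧ m (i + 1) ≠ 0 := by
      by_contra hcon
      push Not at hcon
      have hall : ∀ i, i ≤ j → m (j - i) ≠ 0 := by
        intro i
        induction i with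
        | zero => intro _; simpa using hj
        | succ i ihi =>
          intro hi h0
          have := hcon _ h0
          rw [show j - (i + 1) + 1 = j - i by omega] at this
          exact ihi (by omega) this
      have hsub : Finset.range (j + 1) ⊆ m.support := by
        intro i hi
        rw [Finset.mem_range] at hi
        rw [Finsupp.mem_support_iff]
        have := hall (j - i) (by omega)
        rwa [show j - (j - i) = i by omega] at this
      have := Finset.card_le_card hsub
      rw [Finset.card_range] at this
      omega
    obtain ⟨i, hi0, hi1⟩ := hmiss
    set m' := setExp m i (m (i + 1)) (m i) with hm'
    have hsupp : m'.support = insert i (m.support.erase (i + 1)) := by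
      ext a
      simp only [hm', Finsupp.mem_support_iff, setExp_apply, Finset.mem_insert, Finset.mem_erase]
      split_ifs with h1 h2
      · subst h1; simp [hi0]
      · subst h2; simp [hi1]
      · simp [h1, h2]
    have hi1' : i + 1 ∈ m.support := Finsupp.mem_support_iff.2 hi1
    have hi0' : i ∉ m.support.erase (i + 1) := by simp [hi0]
    have hlt : ∑ j ∈ m'.support, j < ∑ j ∈ m.support, j := by
      rw [hsupp, Finset.sum_insert hi0', ← Finset.add_sum_erase _ _ hi1']
      omega
    have hcard : m'.support.card ≤ d := by
      rw [hsupp, Finset.card_insert_of_notMem hi0', Finset.card_erase_of_mem hi1']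
      have := Finset.card_pos.2 ⟨_, hi1'⟩
      omega
    obtain ⟨x, hx, hF⟩ := ih _ hlt m' hcard rfl
    refine ⟨x, ?_, fun F => ?_⟩
    · have := degree_setExp m i (m (i + 1)) (m i)
      rw [← hm'] at this
      omega
    · rw [← hF, coeff_setExp_eq]

lemma card_support_le_degree (m : ℕ →₀ ℕ) : m.support.card ≤ m.degree := by
  rw [Finsupp.degree, Finset.card_eq_sum_ones]
  exact Finset.sum_le_sum fun i hi => Nat.one_le_iff_ne_zero.2 (Finsupp.mem_support_iff.1 hi)

lemma symFun_eq_of_res_eq {F G : SymFun} (N : ℕ) (h : ∀ n, N ≤ n → res n F = res n G) :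
    F = G := by
  apply Subtype.ext
  ext m
  obtain ⟨x, -, hx⟩ := exists_coeff_eq_coeff_res (d := m.degree + N) m
    ((card_support_le_degree m).trans (by omega))
  rw [hx, hx, h _ (by omega)]

/-- Adjacent transpositions generate the symmetric group. -/
lemma isSymmetric_of_rename_swap {n : ℕ} {p : MvPolynomial (Fin n) Kqt}
    (h : ∀ (i : ℕ) (hi : i + 1 < n), MvPolynomial.rename
      (Equiv.swap (⟨i, by omega⟩ : Fin n) ⟨i + 1, hi⟩) p = p) : p.IsSymmetric := by
  have h' : ∀ x y : Fin n, y.1 = x.1 + 1 → MvPolynomial.rename (Equiv.swap x y) p = p := by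
    rintro ⟨x, hx⟩ ⟨y, hy⟩ hxy
    simp only at hxy
    subst hxy
    exact h x hy
  have hstep : ∀ (d : ℕ) (x y : Fin n), y.1 = x.1 + d + 1 →
      MvPolynomial.rename (Equiv.swap x y) p = p := by
    intro d
    induction d with
    | zero =>
      intro x y hxy
      exact h' x y hxy
    | succ d ih =>
      intro x y hxy
      obtain ⟨z, hz⟩ : ∃ z : Fin n, z.1 = x.1 + d + 1 := ⟨⟨x.1 + d + 1, by omega⟩, rfl⟩
      have h1 := ih x z hz
      have h2 : MvPolynomial.rename (Equiv.swap z y) p = p := by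
        exact h' z y (by omega)
      have key : Equiv.swap x y = Equiv.swap z y * Equiv.swap x z * Equiv.swap z y := by
        rw [Equiv.swap_mul_swap_mul_swap, Equiv.swap_comm]
        all_goals
          rintro rfl
          omega
      rw [key, Equiv.Perm.coe_mul, Equiv.Perm.coe_mul, ← MvPolynomial.rename_rename,
        ← MvPolynomial.rename_rename, h2, h1, h2]
  intro e
  induction e using Equiv.Perm.swap_induction_on with
  | one => simp
  | swap_mul f x y hxy ih =>
    rw [Equiv.Perm.coe_mul, ← MvPolynomial.rename_rename, ih]
    rcases lt_or_gt_of_ne hxy with hlt | hlt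
    · exact hstep (y.1 - x.1 - 1) x y (by have := Fin.lt_def.1 hlt; omega)
    · rw [Equiv.swap_comm]
      exact hstep (x.1 - y.1 - 1) y x (by have := Fin.lt_def.1 hlt; omega)

lemma res_isSymmetric (n : ℕ) (F : SymFun) : (res n F).IsSymmetric := by
  refine isSymmetric_of_rename_swap fun i hi => ?_
  set s := Equiv.swap (⟨i, by omega⟩ : Fin n) ⟨i + 1, hi⟩ with hs
  ext m
  have hm : m = (m.mapDomain s).mapDomain s := by
    rw [← Finsupp.mapDomain_comp]
    have : (s ∘ s : Fin n → Fin n) = id := by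
      funext a; simp [hs]
    rw [this, Finsupp.mapDomain_id]
  conv_lhs => rw [hm]
  rw [MvPolynomial.coeff_rename_mapDomain _ s.injective, coeff_res, coeff_res,
    ← coeff_setExp_eq F i]
  congr 1
  congr 1
  ext j
  rw [setExp_apply]
  have hval : ∀ (x : Fin n →₀ ℕ) (a : ℕ) (ha : a < n),
      x.embDomain Fin.valEmbedding a = x ⟨a, ha⟩ := fun x a ha =>
    Finsupp.embDomain_apply_self Fin.valEmbedding x (⟨a, ha⟩ : Fin n)
  have hmap : ∀ a : Fin n, m.mapDomain s a = m (s a) := by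
    intro a
    have := Finsupp.mapDomain_apply s.injective m (s a)
    rwa [show s (s a) = a by simp [hs]] at this
  by_cases hj : j < n
  · rw [hval _ j hj, hmap, hval _ (i + 1) hi, hval _ i (by omega), hmap, hmap]
    simp only [hs, Equiv.swap_apply_left, Equiv.swap_apply_right]
    split_ifs with h1 h2
    · subst h1; rw [hval _ _ hi]
    · subst h2; rw [hval _ _ hj]
    · rw [Equiv.swap_apply_of_ne_of_ne, hval _ j hj]
      all_goals simp only [ne_eq, Fin.mk.injEq]; omega
  · rw [if_neg (by omega), if_neg (by omega), Finsupp.embDomain_of_notMem_range,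
      Finsupp.embDomain_of_notMem_range]
    all_goals
      rintro ⟨a, rfl⟩
      exact hj a.2

/-! ### Power sums generate the symmetric functions freely -/

lemma res_psum (n : ℕ) {r : ℕ} (hr : r ≠ 0) :
    res n (psum r) = MvPolynomial.psum (Fin n) Kqt r := by
  classical
  ext m
  rw [coeff_res, MvPolynomial.psum, MvPolynomial.coeff_sum]
  change MvPowerSeries.coeff _ (psumPS r) = _
  rw [coeff_psumPS]
  simp only [MvPolynomial.coeff_X_pow]
  split_ifs with h
  · obtain ⟨i, hi⟩ := h
    have hin : i < n := by
      by_contra hcon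
      have h1 := DFunLike.congr_fun hi i
      rw [Finsupp.embDomain_of_notMem_range, Finsupp.single_eq_same] at h1
      · exact hr h1.symm
      · rintro ⟨a, rfl⟩; exact hcon a.2
    have hm : m = Finsupp.single ⟨i, hin⟩ r := by
      apply Finsupp.embDomain_injective Fin.valEmbedding
      rw [hi, Finsupp.embDomain_single]; rfl
    subst hm
    rw [Finset.sum_eq_single ⟨i, hin⟩]
    · simp
    · intro b _ hb
      rw [if_neg]
      intro h2
      exact hb ((Finsupp.single_left_inj hr).1 h2)
    · simp
  · symm
    refine Finset.sum_eq_zero fun i _ => ?_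
    rw [if_neg]
    rintro rfl
    exact h ⟨i, Finsupp.embDomain_single _ _ _⟩

/-- A power series all of whose monomials have degree `d`. -/
def IsHomog (d : ℕ) (F : PS) : Prop := ∀ m : ℕ →₀ ℕ, m.degree ≠ d → MvPowerSeries.coeff m F = 0

lemma IsHomog.mul {a b : ℕ} {F G : PS} (hF : IsHomog a F) (hG : IsHomog b G) :
    IsHomog (a + b) (F * G) := by
  intro m hm
  rw [MvPowerSeries.coeff_mul]
  refine Finset.sum_eq_zero fun p hp => ?_
  rw [Finset.HasAntidiagonal.mem_antidiagonal] at hp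
  have hd : p.1.degree + p.2.degree = m.degree := by rw [← hp, map_add]
  by_cases h : p.1.degree = a
  · rw [hG _ (by omega), mul_zero]
  · rw [hF _ h, zero_mul]

lemma isHomog_psum (n : ℕ) : IsHomog n (psum n : PS) := by
  intro m hm
  change MvPowerSeries.coeff m (psumPS n) = 0
  rw [coeff_psumPS, if_neg]
  rintro ⟨i, rfl⟩
  simp at hm

/-- `K[p_1, p_2, …] → Sym[X]`, with `X n ↦ p_{n+1}`. -/
def powerSumHom : MvPolynomial ℕ Kqt →ₐ[Kqt] SymFun := MvPolynomial.aeval fun n => psum (n + 1)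

@[simp] lemma powerSumHom_X (n : ℕ) : powerSumHom (MvPolynomial.X n) = psum (n + 1) :=
  MvPolynomial.aeval_X _ _

lemma isHomog_powerSumHom_monomial (s : ℕ →₀ ℕ) (a : Kqt) :
    ∃ d, IsHomog d (powerSumHom (MvPolynomial.monomial s a) : PS) := by
  refine MvPolynomial.induction_on_monomial
    (motive := fun P => ∃ d, IsHomog d (powerSumHom P : PS)) ?_ ?_ s a
  · intro a
    refine ⟨0, fun m hm => ?_⟩
    rw [← MvPolynomial.algebraMap_eq, AlgHom.commutes]
    change MvPowerSeries.coeff m (algebraMap Kqt PS a) = 0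
    have : m ≠ 0 := by rintro rfl; simp at hm
    rw [MvPowerSeries.algebraMap_apply, Algebra.algebraMap_self_apply, MvPowerSeries.coeff_C,
      if_neg this]
  · rintro P n ⟨d, hd⟩
    refine ⟨d + (n + 1), ?_⟩
    rw [map_mul, powerSumHom_X]
    exact hd.mul (isHomog_psum (n + 1))

/-- Polynomials in power sums are closed under truncation of the degree. -/
lemma exists_powerSumHom_trunc (P : MvPolynomial ℕ Kqt) (d : ℕ) :
    ∃ Q, ∀ m : ℕ →₀ ℕ, MvPowerSeries.coeff m (powerSumHom Q : PS) =
      if m.degree ≤ d then MvPowerSeries.coeff m (powerSumHom P : PS) else 0 := by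
  induction P using MvPolynomial.induction_on' with
  | monomial s a =>
    obtain ⟨e, he⟩ := isHomog_powerSumHom_monomial s a
    by_cases hed : e ≤ d
    · refine ⟨MvPolynomial.monomial s a, fun m => ?_⟩
      split_ifs with h
      · rfl
      · exact he m (by omega)
    · refine ⟨0, fun m => ?_⟩
      rw [map_zero]
      split_ifs with h
      · rw [he m (by omega)]; rfl
      · rfl
  | add P Q hP hQ =>
    obtain ⟨P', hP'⟩ := hP
    obtain ⟨Q', hQ'⟩ := hQ
    refine ⟨P' + Q', fun m => ?_⟩
    rw [map_add, map_add, Subalgebra.coe_add, Subalgebra.coe_add, map_add, map_add, hP', hQ']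
    split_ifs <;> simp

lemma res_comp_powerSumHom (n : ℕ) (P : MvPolynomial (Fin n) Kqt) :
    res n (powerSumHom (MvPolynomial.rename Fin.val P)) =
      MvPolynomial.aeval (fun i : Fin n => MvPolynomial.psum (Fin n) Kqt (i + 1)) P := by
  have : ((res n).comp powerSumHom).comp (MvPolynomial.rename Fin.val) =
      MvPolynomial.aeval (fun i : Fin n => MvPolynomial.psum (Fin n) Kqt (i + 1)) := by
    ext1 i
    simp [res_psum]
  exact DFunLike.congr_fun this P

lemma powerSumHom_injective : Function.Injective powerSumHom := by
  rw [injective_iff_map_eq_zero]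
  intro P hP
  obtain ⟨N, hN⟩ : ∃ N, ∀ i ∈ P.vars, i < N :=
    ⟨P.vars.sup id + 1, fun i hi => Nat.lt_succ_of_le (Finset.le_sup (f := id) hi)⟩
  obtain ⟨Q, rfl⟩ := MvPolynomial.exists_rename_eq_of_vars_subset_range P (Fin.val : Fin N → ℕ)
    Fin.val_injective (fun i hi => ⟨⟨i, hN i hi⟩, rfl⟩)
  have := res_comp_powerSumHom N Q
  rw [hP, map_zero, ← map_zero (MvPolynomial.aeval (R := Kqt)
    (fun i : Fin N => MvPolynomial.psum (Fin N) Kqt (i + 1)))] at this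
  rw [← aeval_psum_injective N this, map_zero]

lemma powerSumHom_surjective : Function.Surjective powerSumHom := by
  intro F
  obtain ⟨d, hd⟩ := F.2.1
  obtain ⟨P, hP⟩ := exists_aeval_psum_eq (res_isSymmetric d F)
  obtain ⟨Q, hQ⟩ := exists_powerSumHom_trunc (MvPolynomial.rename Fin.val P) d
  refine ⟨Q, Subtype.ext ?_⟩
  ext m
  rw [hQ]
  split_ifs with h
  · obtain ⟨x, -, hx⟩ := exists_coeff_eq_coeff_res (d := d) m
      ((card_support_le_degree m).trans h)
    rw [hx, hx, res_comp_powerSumHom, hP]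
  · exact (hd m (by omega)).symm

/-- The ring of symmetric functions is the polynomial ring in the power sums. -/
def powerSumEquiv : MvPolynomial ℕ Kqt ≃ₐ[Kqt] SymFun :=
  AlgEquiv.ofBijective powerSumHom ⟨powerSumHom_injective, powerSumHom_surjective⟩

section Pleth

variable {R : Type} [CommRing R] [Algebra Kqt R]

lemma symFun_algHom_ext {R : Type*} [Semiring R] [Algebra Kqt R] {φ ψ : SymFun →ₐ[Kqt] R}
    (h : ∀ n, n ≠ 0 → φ (psum n) = ψ (psum n)) : φ = ψ := by
  have : φ.comp powerSumEquiv.toAlgHom = ψ.comp powerSumEquiv.toAlgHom := by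
    ext1 n
    change φ (powerSumHom _) = ψ (powerSumHom _)
    rw [powerSumHom_X, h _ (Nat.succ_ne_zero n)]
  ext F
  obtain ⟨P, rfl⟩ := powerSumEquiv.surjective F
  exact DFunLike.congr_fun this P

lemma pleth_psum (a : ℕ → R) {n : ℕ} (hn : n ≠ 0) : pleth a (psum n) = a n := by
  have h : ∃ φ : SymFun →ₐ[Kqt] R, ∀ n, 1 ≤ n → φ (psum n) = a n := by
    refine ⟨(MvPolynomial.aeval fun n => a (n + 1)).comp powerSumEquiv.symm.toAlgHom,
      fun n hn => ?_⟩
    obtain ⟨n, rfl⟩ := Nat.exists_eq_add_of_le' hn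
    have : powerSumEquiv.symm (psum (n + 1)) = MvPolynomial.X n := by
      rw [AlgEquiv.symm_apply_eq]
      exact (powerSumHom_X n).symm
    change MvPolynomial.aeval _ (powerSumEquiv.symm (psum (n + 1))) = _
    rw [this, MvPolynomial.aeval_X]
  rw [pleth, dif_pos h]
  exact h.choose_spec n (Nat.one_le_iff_ne_zero.2 hn)

end Pleth

/-! ### The multiplication map is bijective -/

/-- The exponent with entries `x` in the first `k` variables and `m` in the remaining ones. -/
def joinExp {k : ℕ} (x : Fin k →₀ ℕ) (m : ℕ →₀ ℕ) : ℕ →₀ ℕ :=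
  x.embDomain Fin.valEmbedding + m.embDomain (addRightEmbedding k)

lemma joinExp_lt {k : ℕ} (x : Fin k →₀ ℕ) (m : ℕ →₀ ℕ) (i : Fin k) : joinExp x m i = x i := by
  rw [joinExp, Finsupp.add_apply, Finsupp.embDomain_of_notMem_range (addRightEmbedding k)]
  · exact (add_zero _).trans (Finsupp.embDomain_apply_self Fin.valEmbedding x i)
  · rintro ⟨a, ha⟩
    have := i.2
    simp only [addRightEmbedding_apply] at ha
    omega

lemma joinExp_add {k : ℕ} (x : Fin k →₀ ℕ) (m : ℕ →₀ ℕ) (i : ℕ) : joinExp x m (i + k) = m i := by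
  rw [joinExp, Finsupp.add_apply, Finsupp.embDomain_of_notMem_range Fin.valEmbedding]
  · exact (zero_add _).trans (Finsupp.embDomain_apply_self (addRightEmbedding k) m i)
  · rintro ⟨a, ha⟩
    have := a.2
    simp only [Fin.valEmbedding_apply] at ha
    omega

lemma exists_joinExp_eq (k : ℕ) (n : ℕ →₀ ℕ) : ∃ (x : Fin k →₀ ℕ) (m : ℕ →₀ ℕ), joinExp x m = n := by
  refine ⟨n.comapDomain Fin.val Fin.val_injective.injOn,
    n.comapDomain (· + k) (add_left_injective k).injOn, ?_⟩
  ext j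
  rcases lt_or_ge j k with h | h
  · rw [joinExp_lt _ _ ⟨j, h⟩, Finsupp.comapDomain_apply]
  · obtain ⟨i, rfl⟩ := Nat.exists_eq_add_of_le' h
    rw [joinExp_add, Finsupp.comapDomain_apply]

lemma degree_joinExp {k : ℕ} (x : Fin k →₀ ℕ) (m : ℕ →₀ ℕ) :
    (joinExp x m).degree = x.degree + m.degree := by
  rw [joinExp, map_add, Finsupp.embDomain_eq_mapDomain, Finsupp.embDomain_eq_mapDomain,
    Finsupp.degree_mapDomain, Finsupp.degree_mapDomain]

lemma coe_symShift (k : ℕ) (F : SymFun) : (symShift k F : PS) = shiftPS k (F : PS) := rfl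

lemma coe_polyIncl_X (k : ℕ) (i : Fin k) :
    (polyIncl k (MvPolynomial.X i) : PS) = MvPowerSeries.X i.val := by
  rw [polyIncl, MvPolynomial.aeval_X]

lemma coe_polyIncl_monomial (k : ℕ) (x : Fin k →₀ ℕ) :
    (polyIncl k (MvPolynomial.monomial x 1) : PS) =
      MvPowerSeries.monomial (x.embDomain Fin.valEmbedding) 1 := by
  induction x using Finsupp.induction_linear with
  | zero =>
    have : (MvPolynomial.monomial (0 : Fin k →₀ ℕ) (1 : Kqt)) = 1 := rfl
    rw [this, map_one, Finsupp.embDomain_zero]; rfl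
  | add x y hx hy =>
    have : (MvPolynomial.monomial (x + y) (1 : Kqt)) =
        MvPolynomial.monomial x 1 * MvPolynomial.monomial y 1 := by
      rw [MvPolynomial.monomial_mul, one_mul]
    rw [this, map_mul, Subalgebra.coe_mul, hx, hy, MvPowerSeries.monomial_mul_monomial, one_mul,
      Finsupp.embDomain_eq_mapDomain, Finsupp.embDomain_eq_mapDomain,
      Finsupp.embDomain_eq_mapDomain, Finsupp.mapDomain_add]
  | single i n =>
    have : (MvPolynomial.monomial (Finsupp.single i n) (1 : Kqt)) = MvPolynomial.X i ^ n :=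
      (MvPolynomial.X_pow_eq_monomial).symm
    rw [this, map_pow, Subalgebra.coe_pow, coe_polyIncl_X, MvPowerSeries.X_pow_eq,
      Finsupp.embDomain_single]; rfl

lemma coeff_joinExp_mul {k : ℕ} (x y : Fin k →₀ ℕ) (m : ℕ →₀ ℕ) (F : SymFun) :
    MvPowerSeries.coeff (joinExp x m)
      (polyIncl k (MvPolynomial.monomial y 1) * symShift k F : calP k).1 =
      if y = x then MvPowerSeries.coeff m (F : PS) else 0 := by
  classical
  rw [Subalgebra.coe_mul, coe_polyIncl_monomial, MvPowerSeries.coeff_monomial_mul, one_mul,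
    coe_symShift]
  by_cases hyx : y = x
  · subst hyx
    rw [if_pos rfl, if_pos (by rw [joinExp]; exact le_self_add), joinExp, add_tsub_cancel_left]
    exact MvPowerSeries.coeff_embDomain_rename _ _ _
  · rw [if_neg hyx]
    split_ifs with hle
    · refine MvPowerSeries.coeff_rename_eq_zero (addRightEmbedding k) _ ?_
      rintro ⟨m', hm'⟩
      apply hyx
      ext i
      have h1 := DFunLike.congr_fun hm' i.val
      have h2 := hle i.val
      rw [joinExp_lt] at h2
      rw [Finsupp.tsub_apply, joinExp_lt, Finsupp.mapDomain_of_notMem_range] at h1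
      · have h3 : y.embDomain Fin.valEmbedding i.val = y i :=
          Finsupp.embDomain_apply_self Fin.valEmbedding y i
        omega
      · rintro ⟨a, ha⟩
        have := i.2
        simp only [addRightEmbedding_apply] at ha
        omega
    · rfl

/-- The coefficient of the monomial `x` in the first `k` variables, in the remaining variables. -/
def coeffPS {k : ℕ} (G : PS) (x : Fin k →₀ ℕ) : PS := fun m => MvPowerSeries.coeff (joinExp x m) G

lemma coeff_coeffPS {k : ℕ} (G : PS) (x : Fin k →₀ ℕ) (m : ℕ →₀ ℕ) :
    MvPowerSeries.coeff m (coeffPS G x) = MvPowerSeries.coeff (joinExp x m) G := rfl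

/-- The coefficients of a series in `𝒫(k)⁺` with respect to the monomials in `x_1, …, x_k` are
symmetric functions of the remaining variables. -/
def coeffSym {k : ℕ} (G : calP k) (x : Fin k →₀ ℕ) : SymFun := by
  refine ⟨coeffPS G.1 x, mem_calP.2 ⟨?_, fun i _ => ?_⟩⟩
  · obtain ⟨d, hd⟩ := G.2.1
    refine ⟨d, fun m hm => hd _ ?_⟩
    rw [degree_joinExp]; omega
  · ext m
    rw [coeff_swapPS, coeff_coeffPS, coeff_coeffPS]
    have h := congrArg (MvPowerSeries.coeff (joinExp x m)) ((mem_calP.1 G.2).2 (i + k) (by omega))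
    rw [coeff_swapPS] at h
    rw [← h]
    congr 1
    congr 1
    ext j
    have e1 : i + k + 1 = i + 1 + k := by ring
    rw [setExp_apply, e1, joinExp_add, joinExp_add]
    rcases lt_or_ge j k with hj | hj
    · rw [if_neg (by omega), if_neg (by omega)]
      exact (joinExp_lt x _ ⟨j, hj⟩).trans (joinExp_lt x _ ⟨j, hj⟩).symm
    · obtain ⟨j, rfl⟩ := Nat.exists_eq_add_of_le' hj
      rw [joinExp_add, setExp_apply, joinExp_add]
      simp only [add_left_inj]

lemma coeff_coeffSym {k : ℕ} (G : calP k) (x : Fin k →₀ ℕ) (m : ℕ →₀ ℕ) :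
    MvPowerSeries.coeff m (coeffSym G x : PS) = MvPowerSeries.coeff (joinExp x m) G.1 := rfl

lemma finite_support_coeffSym {k : ℕ} (G : calP k) : (Function.support (coeffSym G)).Finite := by
  obtain ⟨d, hd⟩ := G.2.1
  refine (Finsupp.finite_of_degree_le (σ := Fin k) d).subset fun x hx => ?_
  by_contra hcon
  simp only [Set.mem_ofPred_eq, not_le] at hcon
  apply hx
  apply Subtype.ext
  ext m
  rw [coeff_coeffSym, hd _ (by rw [degree_joinExp]; omega)]
  rfl

lemma mulMap_tmul (k : ℕ) (f : MvPolynomial (Fin k) Kqt) (F : SymFun) :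
    mulMap k (f ⊗ₜ F) = polyIncl k f * symShift k F := by
  rw [mulMap, Algebra.TensorProduct.lift_tmul]

lemma mulMap_bijective (k : ℕ) : Function.Bijective (mulMap k) := by
  classical
  let e := TensorProduct.equivFinsuppOfBasisLeft (N := SymFun)
    (MvPolynomial.basisMonomials (Fin k) Kqt)
  have he : ∀ (b : (Fin k →₀ ℕ) →₀ SymFun) (x : Fin k →₀ ℕ) (m : ℕ →₀ ℕ),
      MvPowerSeries.coeff (joinExp x m) (mulMap k (e.symm b)).1 =
        MvPowerSeries.coeff m (b x : PS) := by
    intro b x m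
    induction b using Finsupp.induction_linear with
    | zero => rw [map_zero, map_zero]; rfl
    | add b c hb hc =>
      rw [map_add, map_add, Subalgebra.coe_add, map_add, hb, hc, Finsupp.add_apply,
        Subalgebra.coe_add, map_add]
    | single y F =>
      rw [TensorProduct.equivFinsuppOfBasisLeft_symm_apply, Finsupp.sum_single_index (by simp),
        MvPolynomial.coe_basisMonomials, mulMap_tmul, coeff_joinExp_mul, Finsupp.single_apply]
      split_ifs <;> rfl
  have hbij : Function.Bijective fun b => mulMap k (e.symm b) := by
    constructor
    · intro b c hbc
      ext1 x
      apply Subtype.ext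
      ext m
      rw [← he, ← he]
      exact congrArg (fun G : calP k => MvPowerSeries.coeff (joinExp x m) G.1) hbc
    · intro G
      refine ⟨Finsupp.ofSupportFinite (coeffSym G) (finite_support_coeffSym G), Subtype.ext ?_⟩
      ext n
      obtain ⟨x, m, rfl⟩ := exists_joinExp_eq k n
      rw [he]
      exact coeff_coeffSym G x m
  have := hbij.comp e.bijective
  convert this using 1
  funext v
  simp

/-! ### The series of complete homogeneous functions -/

section Exp

variable {R : Type} [CommRing R] [Algebra Kqt R]

/-- `∑_{m ≥ 1} a_m w ^ m / m`. -/
def logSeries (a : ℕ → R) : PowerSeries R :=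
  PowerSeries.mk fun m => if m = 0 then 0 else (m : Kqt)⁻¹ • a m

/-- `Exp[w A] = ∑_n h_n[A] w ^ n`, for an expression `A` with power sums `a m`. -/
def expSeries (a : ℕ → R) : PowerSeries R := PowerSeries.mk (plethH a)

/-- The truncations of the exponential series of `logSeries a`. -/
def expTrunc (a : ℕ → R) (N : ℕ) : PowerSeries R :=
  ∑ j ∈ Finset.range (N + 1), ((j.factorial : Kqt)⁻¹) • logSeries a ^ j

lemma X_dvd_logSeries (a : ℕ → R) : PowerSeries.X ∣ logSeries a := by
  rw [PowerSeries.X_dvd_iff]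
  simp [logSeries]

lemma coeff_logSeries_pow_eq_zero (a : ℕ → R) {n j : ℕ} (h : n < j) :
    PowerSeries.coeff n (logSeries a ^ j) = 0 :=
  PowerSeries.X_pow_dvd_iff.1 (pow_dvd_pow_of_dvd (X_dvd_logSeries a) j) n h

lemma coeff_expTrunc (a : ℕ → R) {n N : ℕ} (h : n ≤ N) :
    PowerSeries.coeff n (expTrunc a N) = plethH a n := by
  rw [expTrunc, map_sum, plethH]
  simp only [PowerSeries.coeff_smul]
  symm
  refine Finset.sum_subset (fun j hj => ?_) fun j _ hj => ?_
  · rw [Finset.mem_range] at hj ⊢; omega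
  · rw [Finset.mem_range] at hj
    change _ • PowerSeries.coeff n (logSeries a ^ j) = 0
    rw [coeff_logSeries_pow_eq_zero a (by omega), smul_zero]

lemma derivative_expTrunc (a : ℕ → R) (N : ℕ) :
    PowerSeries.derivative R (expTrunc a (N + 1)) =
      PowerSeries.derivative R (logSeries a) * expTrunc a N := by
  rw [expTrunc, Finset.sum_range_succ', map_add, map_sum, expTrunc, Finset.mul_sum]
  have hc : ∀ (c : Kqt) (F : PowerSeries R), PowerSeries.derivative R (c • F) =
      c • PowerSeries.derivative R F := by
    intro c F
    rw [← algebraMap_smul R c F, Derivation.map_smul, algebraMap_smul]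
  simp only [hc, pow_zero]
  rw [show PowerSeries.derivative R (1 : PowerSeries R) = 0 from Derivation.map_one_eq_zero _,
    smul_zero, add_zero]
  refine Finset.sum_congr rfl fun j _ => ?_
  rw [Derivation.leibniz_pow, Nat.add_sub_cancel, ← Nat.cast_smul_eq_nsmul Kqt, smul_smul,
    smul_eq_mul, mul_smul_comm, mul_comm]
  rw [mul_comm (logSeries a ^ j)]
  congr 1
  have : ((j + 1 : ℕ) : Kqt) ≠ 0 := Nat.cast_ne_zero.2 (Nat.succ_ne_zero j)
  have h2 : (j.factorial : Kqt) ≠ 0 := Nat.cast_ne_zero.2 j.factorial_ne_zero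
  rw [Nat.factorial_succ, Nat.cast_mul]
  field_simp

lemma coeff_derivative_logSeries (a : ℕ → R) (n : ℕ) :
    PowerSeries.coeff n (PowerSeries.derivative R (logSeries a)) = a (n + 1) := by
  rw [PowerSeries.coeff_derivative, logSeries, PowerSeries.coeff_mk, if_neg (Nat.succ_ne_zero n),
    smul_mul_assoc]
  have : (a (n + 1) * ((n : R) + 1)) = ((n + 1 : ℕ) : Kqt) • a (n + 1) := by
    rw [Nat.cast_smul_eq_nsmul, nsmul_eq_mul, mul_comm]; push_cast; rfl
  rw [this, smul_smul, inv_mul_cancel₀ (Nat.cast_ne_zero.2 (Nat.succ_ne_zero n)), one_smul]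

lemma derivative_expSeries (a : ℕ → R) :
    PowerSeries.derivative R (expSeries a) =
      PowerSeries.mk (fun n => a (n + 1)) * expSeries a := by
  have h1 : PowerSeries.mk (fun n => a (n + 1)) = PowerSeries.derivative R (logSeries a) := by
    ext n; rw [coeff_derivative_logSeries, PowerSeries.coeff_mk]
  rw [h1]
  ext n
  have h2 := congrArg (PowerSeries.coeff n) (derivative_expTrunc a n)
  rw [PowerSeries.coeff_derivative, coeff_expTrunc a le_rfl] at h2
  rw [PowerSeries.coeff_derivative, expSeries, PowerSeries.coeff_mk, h2, PowerSeries.coeff_mul,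
    PowerSeries.coeff_mul]
  refine Finset.sum_congr rfl fun p hp => ?_
  rw [Finset.HasAntidiagonal.mem_antidiagonal] at hp
  rw [coeff_expTrunc a (by omega), PowerSeries.coeff_mk]

lemma plethH_zero (a : ℕ → R) : plethH a 0 = 1 := by simp [plethH]

lemma constantCoeff_expSeries (a : ℕ → R) : PowerSeries.constantCoeff (expSeries a) = 1 := by
  rw [← PowerSeries.coeff_zero_eq_constantCoeff_apply, expSeries, PowerSeries.coeff_mk, plethH_zero]

/-- `Exp[w A]` is determined by its logarithmic derivative. -/
lemma eq_expSeries (a : ℕ → R) {S : PowerSeries R} (h0 : PowerSeries.constantCoeff S = 1)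
    (h : PowerSeries.derivative R S = PowerSeries.mk (fun n => a (n + 1)) * S) :
    S = expSeries a := by
  have key : ∀ n, ∀ m ≤ n, PowerSeries.coeff m S = PowerSeries.coeff m (expSeries a) := by
    intro n
    induction n with
    | zero =>
      intro m hm
      obtain rfl : m = 0 := by omega
      rw [PowerSeries.coeff_zero_eq_constantCoeff_apply, h0,
        PowerSeries.coeff_zero_eq_constantCoeff_apply, constantCoeff_expSeries]
    | succ n ih =>
      intro m hm
      rcases Nat.lt_or_ge n m with hlt | hge
      · obtain rfl : m = n + 1 := by omega
        have h1 := congrArg (PowerSeries.coeff n) h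
        have h2 := congrArg (PowerSeries.coeff n) (derivative_expSeries a)
        rw [PowerSeries.coeff_derivative, PowerSeries.coeff_mul] at h1 h2
        have h3 : PowerSeries.coeff (n + 1) S * ((n : R) + 1) =
            PowerSeries.coeff (n + 1) (expSeries a) * ((n : R) + 1) := by
          rw [h1, h2]
          refine Finset.sum_congr rfl fun p hp => ?_
          rw [Finset.HasAntidiagonal.mem_antidiagonal] at hp
          rw [ih p.2 (by omega)]
        have hu : ∀ x : R, ((n + 1 : ℕ) : Kqt)⁻¹ • (x * ((n : R) + 1)) = x := by
          intro x
          have : x * ((n : R) + 1) = ((n + 1 : ℕ) : Kqt) • x := by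
            rw [Nat.cast_smul_eq_nsmul, nsmul_eq_mul, mul_comm]; push_cast; rfl
          rw [this, smul_smul, inv_mul_cancel₀ (Nat.cast_ne_zero.2 (Nat.succ_ne_zero n)), one_smul]
        rw [← hu (PowerSeries.coeff (n + 1) S), h3, hu]
      · exact ih m hge
  ext n
  exact key n n le_rfl

lemma expSeries_congr {a b : ℕ → R} (h : ∀ n, n ≠ 0 → a n = b n) : expSeries a = expSeries b := by
  apply eq_expSeries b (constantCoeff_expSeries a)
  rw [derivative_expSeries]
  congr 2
  funext n
  exact h _ (Nat.succ_ne_zero n)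

lemma expSeries_add (a b : ℕ → R) :
    expSeries (fun n => a n + b n) = expSeries a * expSeries b := by
  symm
  apply eq_expSeries
  · rw [map_mul, constantCoeff_expSeries, constantCoeff_expSeries, one_mul]
  · rw [Derivation.leibniz, derivative_expSeries, derivative_expSeries, smul_eq_mul, smul_eq_mul]
    have : (PowerSeries.mk fun n => a (n + 1) + b (n + 1)) =
        PowerSeries.mk (fun n => a (n + 1)) + PowerSeries.mk (fun n => b (n + 1)) := by
      ext n; simp
    rw [this]; ring

lemma expSeries_neg_pow (x : R) :
    expSeries (fun n => -x ^ n) = 1 - PowerSeries.C x * PowerSeries.X := by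
  symm
  apply eq_expSeries
  · simp
  · have h1 : (PowerSeries.mk fun n => -x ^ (n + 1)) * (1 - PowerSeries.C x * PowerSeries.X) =
        - PowerSeries.C x := by
      ext n
      rw [mul_sub, mul_one, map_sub, ← mul_assoc, mul_comm _ (PowerSeries.C x), mul_assoc,
        PowerSeries.coeff_C_mul]
      cases n with
      | zero => simp
      | succ n =>
        rw [PowerSeries.coeff_succ_mul_X]
        simp
        ring
    rw [h1, map_sub, Derivation.leibniz, PowerSeries.derivative_X, PowerSeries.derivative_C]
    simp

lemma map_expSeries {R' : Type} [CommRing R'] [Algebra Kqt R'] (φ : R →ₐ[Kqt] R') (a : ℕ → R) :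
    (expSeries a).map φ.toRingHom = expSeries fun n => φ (a n) := by
  apply eq_expSeries
  · have := constantCoeff_expSeries a
    rw [← PowerSeries.coeff_zero_eq_constantCoeff_apply] at this ⊢
    rw [PowerSeries.coeff_map, this, map_one]
  · have h := congrArg (PowerSeries.map φ.toRingHom) (derivative_expSeries a)
    rw [map_mul] at h
    have h1 : PowerSeries.map φ.toRingHom (PowerSeries.derivative R (expSeries a)) =
        PowerSeries.derivative R' (PowerSeries.map φ.toRingHom (expSeries a)) := by
      ext n
      simp [PowerSeries.coeff_derivative]
    rw [← h1, h]
    congr 1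

end Exp

/-! ### Constant terms

For a polynomial `g` in `u` and a series `S` in `w`, `pair g S` is the constant term of
`g(u) S(u⁻¹)`. -/

section Pair

variable {R : Type*} [CommRing R]

/-- The constant term of `g(u) S(u⁻¹)`, for a polynomial `g` and a power series `S`. -/
def pair (g : R[X]) (S : PowerSeries R) : R := g.sum fun n a => a * PowerSeries.coeff n S

lemma pair_add_left (g g' : R[X]) (S : PowerSeries R) :
    pair (g + g') S = pair g S + pair g' S :=
  Polynomial.sum_add_index _ _ _ (by simp) (by intros; ring)

lemma pair_monomial (n : ℕ) (a : R) (S : PowerSeries R) :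
    pair (Polynomial.monomial n a) S = a * PowerSeries.coeff n S :=
  Polynomial.sum_monomial_index a _ (by simp)

lemma pair_zero_left (S : PowerSeries R) : pair 0 S = 0 := Polynomial.sum_zero_index _

lemma pair_C_mul (a : R) (g : R[X]) (S : PowerSeries R) :
    pair (Polynomial.C a * g) S = a * pair g S := by
  induction g using Polynomial.induction_on' with
  | add p q hp hq => rw [mul_add, pair_add_left, pair_add_left, hp, hq, mul_add]
  | monomial n b =>
    rw [Polynomial.C_mul_monomial, pair_monomial, pair_monomial, mul_assoc]

lemma pair_neg_left (g : R[X]) (S : PowerSeries R) : pair (-g) S = -pair g S := by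
  have := pair_C_mul (-1) g S
  simpa using this

lemma pair_sub_left (g g' : R[X]) (S : PowerSeries R) :
    pair (g - g') S = pair g S - pair g' S := by
  rw [sub_eq_add_neg, pair_add_left, pair_neg_left, sub_eq_add_neg]

lemma pair_add_right (g : R[X]) (S S' : PowerSeries R) :
    pair g (S + S') = pair g S + pair g S' := by
  induction g using Polynomial.induction_on' with
  | add p q hp hq => rw [pair_add_left, pair_add_left, pair_add_left, hp, hq]; ring
  | monomial n b => rw [pair_monomial, pair_monomial, pair_monomial, map_add, mul_add]

lemma pair_C_mul_right (a : R) (g : R[X]) (S : PowerSeries R) :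
    pair g (PowerSeries.C a * S) = a * pair g S := by
  induction g using Polynomial.induction_on' with
  | add p q hp hq => rw [pair_add_left, pair_add_left, hp, hq, mul_add]
  | monomial n b => rw [pair_monomial, pair_monomial, PowerSeries.coeff_C_mul]; ring

lemma pair_neg_right (g : R[X]) (S : PowerSeries R) : pair g (-S) = -pair g S := by
  have := pair_C_mul_right (-1) g S
  simpa using this

lemma pair_sub_right (g : R[X]) (S S' : PowerSeries R) :
    pair g (S - S') = pair g S - pair g S' := by
  rw [sub_eq_add_neg, pair_add_right, pair_neg_right, sub_eq_add_neg]

lemma pair_C (a : R) (S : PowerSeries R) :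
    pair (Polynomial.C a) S = a * PowerSeries.constantCoeff S := by
  rw [← Polynomial.monomial_zero_left, pair_monomial, PowerSeries.coeff_zero_eq_constantCoeff_apply]

lemma pair_X_mul_X_mul (g : R[X]) (S : PowerSeries R) :
    pair (Polynomial.X * g) (PowerSeries.X * S) = pair g S := by
  induction g using Polynomial.induction_on' with
  | add p q hp hq => rw [mul_add, pair_add_left, pair_add_left, hp, hq]
  | monomial n b =>
    rw [Polynomial.X_mul_monomial, pair_monomial, pair_monomial, PowerSeries.coeff_succ_X_mul]

/-- The factor `u - a` of the polynomial and the factor `1 - a w = w (u - a)` of the series,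
with `w = u⁻¹`, can be exchanged. -/
lemma pair_X_sub_C_mul (a : R) (g : R[X]) (S : PowerSeries R) :
    pair ((Polynomial.X - Polynomial.C a) * g) (PowerSeries.X * S) =
      pair g ((1 - PowerSeries.C a * PowerSeries.X) * S) := by
  rw [sub_mul, sub_mul, pair_sub_left, pair_sub_right, pair_X_mul_X_mul, pair_C_mul, one_mul,
    mul_assoc, pair_C_mul_right]

lemma map_pair {R' : Type*} [CommRing R'] (φ : R →+* R') (g : R[X]) (S : PowerSeries R) :
    φ (pair g S) = pair (g.map φ) (S.map φ) := by
  induction g using Polynomial.induction_on' with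
  | add p q hp hq => rw [pair_add_left, Polynomial.map_add, pair_add_left, map_add, hp, hq]
  | monomial n b =>
    rw [Polynomial.map_monomial, pair_monomial, pair_monomial, map_mul, PowerSeries.coeff_map]

/-- Constant terms in two variables can be taken in either order, as long as the series do not
mix the variables. -/
lemma pair_pair_swap (f : R[X][X]) (S S' : PowerSeries R) :
    pair (pair (Polynomial.Bivariate.swap (R := R) f) (S.map Polynomial.C)) S' =
      pair (pair f (S'.map Polynomial.C)) S := by
  induction f using Polynomial.induction_on' with
  | add p q hp hq =>
    rw [map_add, pair_add_left, pair_add_left, pair_add_left, pair_add_left, hp, hq]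
  | monomial n b =>
    induction b using Polynomial.induction_on' with
    | add p q hp hq =>
      rw [map_add, map_add, pair_add_left, pair_add_left, hp, hq, pair_add_left, pair_add_left]
    | monomial m a =>
      rw [Polynomial.Bivariate.swap_monomial_monomial]
      simp only [pair_monomial, PowerSeries.coeff_map]
      rw [mul_comm (Polynomial.monomial n a), mul_comm (Polynomial.monomial m a), pair_C_mul,
        pair_C_mul, pair_monomial, pair_monomial]
      ring

/-- The series `1 - a w` is invertible. -/
lemma exists_one_sub_mul_eq (a : R) (S : PowerSeries R) :
    ∃ S', (1 - PowerSeries.C a * PowerSeries.X) * S' = S := by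
  refine ⟨PowerSeries.mk (fun n => a ^ n) * S, ?_⟩
  have : (1 - PowerSeries.C a * PowerSeries.X) * PowerSeries.mk (fun n => a ^ n) = 1 := by
    ext n
    rw [sub_mul, one_mul, mul_assoc, map_sub, PowerSeries.coeff_C_mul]
    cases n with
    | zero => simp
    | succ n => rw [PowerSeries.coeff_succ_X_mul]; simp [PowerSeries.coeff_one]; ring
  rw [← mul_assoc, this, one_mul]

/-- A constant term with denominator `u - A`: if `(A - u) τ = (1 - t) A b u - A (u - t A) g`, then
`τ` pairs like `A (1 - t A w) (1 - A w)⁻¹ g`, up to the residue at `u = A`. -/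
lemma pair_eq_of_mul_eq (t A b : R) (τ g : R[X]) (S : PowerSeries R)
    (h : (Polynomial.X - Polynomial.C A) * τ =
      Polynomial.C A * ((Polynomial.X - Polynomial.C (t * A)) * g) -
        Polynomial.C ((1 - t) * A * b) * Polynomial.X) :
    pair τ ((1 - PowerSeries.C A * PowerSeries.X) * S) =
      A * pair g ((1 - PowerSeries.C (t * A) * PowerSeries.X) * S) -
        (1 - t) * A * b * PowerSeries.constantCoeff S := by
  rw [← pair_X_sub_C_mul, h, pair_sub_left, pair_C_mul, pair_X_sub_C_mul, pair_C_mul,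
    ← mul_one (Polynomial.X : R[X]), pair_X_mul_X_mul, ← Polynomial.C_1, pair_C, one_mul]

end Pair

/-! ### Demazure–Lusztig operators -/

/-- `T` is the Demazure–Lusztig operator `F ↦ s F + (1 - t) a (F - s F) / (a - b)` of an involution
`s` of an integral domain that exchanges `a` and `b`; the formula is multiplied by `a - b`. -/
structure HeckeOp {R : Type*} [CommRing R] (t a b : R) (s : R →+* R) (T : R → R) : Prop where
  spec : ∀ F, (a - b) * (T F - F) = (b - t * a) * (F - s F)
  map_a : s a = b
  map_b : s b = a
  map_t : s t = t
  map_map : ∀ F, s (s F) = F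
  ne : a - b ≠ 0

namespace HeckeOp

variable {R : Type*} [CommRing R] [IsDomain R] {t a b : R} {s : R →+* R} {T : R → R}
  (h : HeckeOp t a b s T)
include h

/-- As `a - b` is not a zero divisor, the defining equation of `HeckeOp` determines `T F`. -/
lemma eq_of {F G : R} (hG : (a - b) * (G - F) = (b - t * a) * (F - s F)) : T F = G := by
  have := (h.spec F).trans hG.symm
  have := mul_left_cancel₀ h.ne this
  linear_combination this

lemma mul_of_fixed {c : R} (hc : s c = c) (F : R) : T (c * F) = c * T F := by
  apply h.eq_of
  rw [map_mul, hc]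
  linear_combination c * h.spec F

lemma of_fixed {F : R} (hF : s F = F) : T F = F := by
  apply h.eq_of
  rw [hF]; ring

lemma map_T_add (F : R) : s (T F + t * F) = T F + t * F := by
  apply mul_left_cancel₀ h.ne
  have h1 := h.spec F
  have h2 := congrArg s (h.spec F)
  simp only [map_mul, map_sub, h.map_a, h.map_b, h.map_t, h.map_map] at h2
  rw [map_add, map_mul, h.map_t]
  linear_combination -h2 - h1

lemma quadratic (F : R) : T (T F + t * F) = T F + t * F := h.of_fixed (h.map_T_add F)

/-- For `T = T_i`, the relation `T_i y_{i+1} T_i = t y_i`. -/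
lemma T_mul_T (F : R) : T (b * T F) = t * a * F := by
  apply h.eq_of
  apply mul_left_cancel₀ h.ne
  have h1 := h.spec F
  have h2 := congrArg s (h.spec F)
  simp only [map_mul, map_sub, h.map_a, h.map_b, h.map_t, h.map_map] at h2
  rw [map_mul, h.map_b]
  linear_combination (-(b - t * a) * b - (a - b) * b) * h1 - (b - t * a) * a * h2

/-- `T` commutes with the endomorphisms that fix `a`, `b`, `t` and commute with `s`. -/
lemma map_T_of_commute {θ : R →+* R} (hθa : θ a = a) (hθb : θ b = b) (hθt : θ t = t)
    (hθ : ∀ F, θ (s F) = s (θ F)) (F : R) : θ (T F) = T (θ F) := by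
  symm
  apply h.eq_of
  have := congrArg θ (h.spec F)
  simp only [map_mul, map_sub, hθa, hθb, hθt, hθ] at this
  exact this

omit [IsDomain R] in
lemma map_T {R' : Type*} [CommRing R'] [IsDomain R'] {t' a' b' : R'} {s' : R' →+* R'} {T' : R' → R'}
    (h' : HeckeOp t' a' b' s' T') {θ : R →+* R'} (hθa : θ a = a') (hθb : θ b = b') (hθt : θ t = t')
    (hθ : ∀ F, θ (s F) = s' (θ F)) (F : R) : θ (T F) = T' (θ F) := by
  symm
  apply h'.eq_of
  have := congrArg θ (h.spec F)
  simp only [map_mul, map_sub, hθa, hθb, hθt, hθ] at this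
  exact this

lemma comm {a' b' : R} {s' : R →+* R} {T' : R → R} (h' : HeckeOp t a' b' s' T')
    (ha : s' a = a) (hb : s' b = b) (ha' : s a' = a') (hb' : s b' = b')
    (hs : ∀ F, s (s' F) = s' (s F)) (hsub : ∀ F G, T' (F - G) = T' F - T' G) (F : R) :
    T (T' F) = T' (T F) := by
  apply h.eq_of
  have h1 : ∀ G, T' ((a - b) * G) = (a - b) * T' G := fun G =>
    h'.mul_of_fixed (by rw [map_sub, ha, hb]) G
  have h2 : ∀ G, T' ((b - t * a) * G) = (b - t * a) * T' G := fun G =>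
    h'.mul_of_fixed (by rw [map_sub, map_mul, ha, hb, h'.map_t]) G
  have h3 := congrArg T' (h.spec F)
  rw [h1, h2, hsub, hsub] at h3
  rw [h3, h'.map_T_of_commute ha' hb' h.map_t hs]

/-- The braid relation. All terms are expanded, in the field of fractions, in the images of `F` under
the group generated by the two involutions; comparing coefficients is then an identity of rational
functions in `a`, `b`, `c`, `t`. -/
lemma braid {c : R} {r : R →+* R} {T' : R → R} (h' : HeckeOp t b c r T')
    (hc : s c = c) (ha : r a = a) (hac : a - c ≠ 0)
    (hsr : ∀ F, s (r (s F)) = r (s (r F))) (F : R) :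
    T (T' (T F)) = T' (T (T' F)) := by
  obtain ⟨K, _, ι, hinj⟩ : ∃ (K : Type _) (_ : Field K) (ι : R →+* K), Function.Injective ι :=
    ⟨FractionRing R, inferInstance, algebraMap R _, IsFractionRing.injective R _⟩
  have hn : ∀ x : R, x ≠ 0 → ι x ≠ 0 := fun x hx => by
    rwa [Ne, map_eq_zero_iff ι hinj]
  have hab := hn _ h.ne
  have hbc := hn _ h'.ne
  have hac := hn _ hac
  rw [map_sub] at hab hbc hac
  have hT : ∀ G, ι (T G) = ((1 - ι t) * ι a * ι G + (ι t * ι a - ι b) * ι (s G)) / (ι a - ι b) := by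
    intro G
    rw [eq_div_iff hab]
    have := congrArg ι (h.spec G)
    simp only [map_mul, map_sub] at this
    linear_combination this
  have hT' : ∀ G, ι (T' G) =
      ((1 - ι t) * ι b * ι G + (ι t * ι b - ι c) * ι (r G)) / (ι b - ι c) := by
    intro G
    rw [eq_div_iff hbc]
    have := congrArg ι (h'.spec G)
    simp only [map_mul, map_sub] at this
    linear_combination this
  have hrT : ∀ G, ι (r (T G)) =
      ((1 - ι t) * ι a * ι (r G) + (ι t * ι a - ι c) * ι (r (s G))) / (ι a - ι c) := by
    intro G
    rw [eq_div_iff hac]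
    have := congrArg (fun x => ι (r x)) (h.spec G)
    simp only [map_mul, map_sub, ha, h'.map_a, h'.map_t] at this
    linear_combination this
  have hsT : ∀ G, ι (s (T G)) =
      ((1 - ι t) * ι b * ι (s G) + (ι t * ι b - ι a) * ι G) / (ι b - ι a) := by
    intro G
    rw [eq_div_iff (by rw [← neg_sub]; exact neg_ne_zero.2 hab)]
    have := congrArg (fun x => ι (s x)) (h.spec G)
    simp only [map_mul, map_sub, h.map_a, h.map_b, h.map_t, h.map_map] at this
    linear_combination this
  have hsT' : ∀ G, ι (s (T' G)) =
      ((1 - ι t) * ι a * ι (s G) + (ι t * ι a - ι c) * ι (s (r G))) / (ι a - ι c) := by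
    intro G
    rw [eq_div_iff hac]
    have := congrArg (fun x => ι (s x)) (h'.spec G)
    simp only [map_mul, map_sub, hc, h.map_b, h.map_t] at this
    linear_combination this
  have hrT' : ∀ G, ι (r (T' G)) =
      ((1 - ι t) * ι c * ι (r G) + (ι t * ι c - ι b) * ι G) / (ι c - ι b) := by
    intro G
    rw [eq_div_iff (by rw [← neg_sub]; exact neg_ne_zero.2 hbc)]
    have := congrArg (fun x => ι (r x)) (h'.spec G)
    simp only [map_mul, map_sub, h'.map_a, h'.map_b, h'.map_t, h'.map_map] at this
    linear_combination this
  have hsrT : ∀ G, ι (s (r (T G))) =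
      ((1 - ι t) * ι b * ι (s (r G)) + (ι t * ι b - ι c) * ι (s (r (s G)))) / (ι b - ι c) := by
    intro G
    rw [eq_div_iff hbc]
    have := congrArg (fun x => ι (s (r x))) (h.spec G)
    simp only [map_mul, map_sub, ha, hc, h'.map_a, h.map_a, h.map_t, h'.map_t] at this
    linear_combination this
  have hrsT' : ∀ G, ι (r (s (T' G))) =
      ((1 - ι t) * ι a * ι (r (s G)) + (ι t * ι a - ι b) * ι (r (s (r G)))) / (ι a - ι b) := by
    intro G
    rw [eq_div_iff hab]
    have := congrArg (fun x => ι (r (s x))) (h'.spec G)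
    simp only [map_mul, map_sub, ha, hc, h'.map_b, h.map_b, h.map_t, h'.map_t] at this
    linear_combination this
  apply hinj
  have hba : ι b - ι a ≠ 0 := by rw [← neg_sub]; exact neg_ne_zero.2 hab
  have hcb : ι c - ι b ≠ 0 := by rw [← neg_sub]; exact neg_ne_zero.2 hbc
  simp only [hT, hT', hrT, hsT, hsT', hrT', hsrT, hrsT', hsr]
  field_simp
  ring

end HeckeOp

/-! ### Products of braid generators -/

section Braid

variable {M : Type*} [Monoid M]

/-- `T_1 ⋯ T_{n+1}` conjugates `T_i` into `T_{i+1}`. -/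
lemma braid_prod_mul {n : ℕ} (T : Fin (n + 1) → M)
    (hc : ∀ i j, i.val + 1 < j.val → T i * T j = T j * T i)
    (hb : ∀ i j, j.val = i.val + 1 → T i * T j * T i = T j * T i * T j) (i : Fin n) :
    (List.ofFn T).prod * T i.castSucc = T i.succ * (List.ofFn T).prod := by
  induction n with
  | zero => exact i.elim0
  | succ n ih =>
    have ih' := ih (fun j => T j.succ)
      (fun i j h => hc _ _ (by simpa using h)) (fun i j h => hb _ _ (by simpa using h))
    rw [List.ofFn_succ, List.prod_cons]
    refine Fin.cases ?_ (fun j => ?_) i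
    · rw [List.ofFn_succ, List.prod_cons]
      have hcomm : Commute (T 0) (List.ofFn fun j : Fin n => T j.succ.succ).prod := by
        apply Commute.list_prod_right
        intro x hx
        obtain ⟨j, rfl⟩ := (List.mem_ofFn' _ _).1 hx
        exact hc _ _ (by simp)
      have h01 := hb 0 (Fin.succ 0) (by simp)
      change T 0 * (T (Fin.succ 0) * _) * T 0 = T (Fin.succ 0) * (T 0 * (T (Fin.succ 0) * _))
      rw [mul_assoc, mul_assoc, ← hcomm.eq, ← mul_assoc, ← mul_assoc, ← mul_assoc, ← mul_assoc, h01]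
    · have h1 := ih' j
      rw [← Fin.succ_castSucc, mul_assoc, h1, ← mul_assoc, hc 0 j.succ.succ (by simp), mul_assoc]

/-- `T_1 (T_1 ⋯ T_{n+1}) (T_1 ⋯ T_n) = (T_1 ⋯ T_{n+1}) (T_1 ⋯ T_n) T_{n+1}`. -/
lemma braid_zero_mul_prod_mul_prod {n : ℕ} (T : Fin (n + 1) → M)
    (hc : ∀ i j, i.val + 1 < j.val → T i * T j = T j * T i)
    (hb : ∀ i j, j.val = i.val + 1 → T i * T j * T i = T j * T i * T j) :
    T 0 * (List.ofFn T).prod * (List.ofFn fun i : Fin n => T i.castSucc).prod =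
      (List.ofFn T).prod * (List.ofFn fun i : Fin n => T i.castSucc).prod * T (Fin.last n) := by
  have key : ∀ l : List (Fin n), (List.ofFn T).prod * (l.map fun i => T i.castSucc).prod =
      (l.map fun i => T i.succ).prod * (List.ofFn T).prod := by
    intro l
    induction l with
    | nil => simp
    | cons i l ih =>
      rw [List.map_cons, List.prod_cons, List.map_cons, List.prod_cons, ← mul_assoc,
        braid_prod_mul T hc hb, mul_assoc, ih, mul_assoc]
  have h1 := key (List.finRange n)
  rw [← List.ofFn_eq_map, ← List.ofFn_eq_map] at h1
  have h2 : (List.ofFn T).prod = (List.ofFn fun i : Fin n => T i.castSucc).prod * T (Fin.last n) := by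
    rw [List.ofFn_succ', List.concat_eq_append, List.prod_append, List.prod_singleton]
  have h3 : (List.ofFn T).prod = T 0 * (List.ofFn fun i : Fin n => T i.succ).prod := by
    rw [List.ofFn_succ, List.prod_cons]
  have h4 : T 0 * (List.ofFn T).prod * (List.ofFn fun i : Fin n => T i.castSucc).prod =
      (List.ofFn T).prod * (List.ofFn T).prod := by
    rw [mul_assoc, h1, ← mul_assoc, ← h3]
  rw [h4, mul_assoc, ← h2]

lemma prod_reverse_mul_prod_ofFn {n : ℕ} {T S : Fin n → M} (h : ∀ i, T i * S i = 1) :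
    (List.ofFn T).reverse.prod * (List.ofFn S).prod = 1 := by
  induction n with
  | zero => simp
  | succ n ih =>
    rw [List.ofFn_succ, List.ofFn_succ, List.reverse_cons, List.prod_append, List.prod_singleton,
      List.prod_cons, mul_assoc, ← mul_assoc (T _), h, one_mul, ih fun i => h _]

end Braid

/-! ### Relations that imply those of the double Dyck path algebra -/

namespace QuiverRep

variable (M : QuiverRep)

/-- Relations of a quiver representation in which loops `Y` play the role of the `y_i` and `d₊` is
`- T_1 ⋯ T_k δ`. -/
structure CoreRelations (Y : ∀ k, Fin (k + 1) → Module.End Kqt (M.V (k + 1)))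
    (δ : ∀ k, M.V k →ₗ[Kqt] M.V (k + 1)) : Prop where
  T_comm : ∀ k (i j : Fin k), i.val + 1 < j.val → M.T k i * M.T k j = M.T k j * M.T k i
  T_braid : ∀ k (i j : Fin k), j.val = i.val + 1 →
    M.T k i * M.T k j * M.T k i = M.T k j * M.T k i * M.T k j
  T_quadratic : ∀ k (i : Fin k), (M.T k i - 1) * (M.T k i + tc • 1) = 0
  dMinus_sq_T : ∀ k v, M.dMinus k (M.dMinus (k + 1) (M.T (k + 1) (Fin.last k) v)) =
    M.dMinus k (M.dMinus (k + 1) v)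
  T_dMinus : ∀ k (i : Fin k) v, M.T k i (M.dMinus (k + 1) v) =
    M.dMinus (k + 1) (M.T (k + 1) i.castSucc v)
  dPlus_eq : ∀ k v, M.dPlus k v = -((List.ofFn (M.T k)).prod (δ k v))
  δ_T : ∀ k (i : Fin k) v, δ (k + 1) (M.T k i v) = M.T (k + 1) i.castSucc (δ (k + 1) v)
  T_δ_δ : ∀ k v, M.T (k + 1) (Fin.last k) (δ (k + 1) (δ k v)) = δ (k + 1) (δ k v)
  T_dPlusStar_sq : ∀ k v, M.T (k + 1) 0 (M.dPlusStar (k + 1) (M.dPlusStar k v)) =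
    M.dPlusStar (k + 1) (M.dPlusStar k v)
  dPlusStar_T : ∀ k (i : Fin k) v, M.dPlusStar (k + 1) (M.T k i v) =
    M.T (k + 1) i.succ (M.dPlusStar (k + 1) v)
  dMinus_commStar : ∀ k v, tc • M.dMinus (k + 1) (M.commStar (k + 1) v) =
    M.commStar k (M.dMinus (k + 1) (M.T (k + 1) (Fin.last k) v))
  commStar_dPlusStar : ∀ k v, tc • M.commStar (k + 1) (M.dPlusStar (k + 1) v) =
    M.T (k + 1) 0 (M.dPlusStar (k + 1) (M.commStar k v))
  T_Y_T : ∀ k (i : Fin k), M.T k i * Y k i.succ * M.T k i = tc • Y k i.castSucc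
  Y_T : ∀ k (i : Fin k), i.val ≠ 0 → ∀ v, Y k 0 (M.T k i v) = M.T k i (Y k 0 v)
  comm_δ : ∀ k v, δ k (M.dMinus k v) -
    M.dMinus (k + 1) (M.T (k + 1) (Fin.last k) (δ (k + 1) v)) = (1 - tc) • Y k (Fin.last k) v
  Y_dMinus : ∀ k (i : Fin (k + 1)) v, Y k i (M.dMinus (k + 1) v) =
    M.dMinus (k + 1) (Y (k + 1) i.castSucc v)
  Y_δ : ∀ k v, Y (k + 1) 0 (δ (k + 1) v) = δ (k + 1) (Y k 0 v)
  dPlusStar_Y : ∀ k (i : Fin (k + 1)) v, M.dPlusStar (k + 1) (Y k i v) =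
    Y (k + 1) i.succ (M.dPlusStar (k + 1) v)
  δ_commStar : ∀ k v, δ (k + 1) (M.commStar k v) =
    M.commStar (k + 1) (M.T (k + 1) (Fin.last k) (δ (k + 1) v))
  commStar_δ : ∀ k v, M.commStar k (δ k v) = ((1 - tc) * qc) • Y k 0 (M.dPlusStar k v)

/-- A linear map that intertwines two families of endomorphisms intertwines their products. -/
lemma map_list_prod {ι : Type*} {V W : Type*} [AddCommGroup V] [Module Kqt V] [AddCommGroup W]
    [Module Kqt W] (f : V →ₗ[Kqt] W) {S : ι → Module.End Kqt V} {S' : ι → Module.End Kqt W}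
    (h : ∀ i v, f (S i v) = S' i (f v)) (l : List ι) (v : V) :
    f ((l.map S).prod v) = (l.map S').prod (f v) := by
  induction l generalizing v with
  | nil => rfl
  | cons i l ih =>
    rw [List.map_cons, List.prod_cons, List.map_cons, List.prod_cons, Module.End.mul_apply,
      Module.End.mul_apply, h, ih]

lemma map_ofFn_prod {n : ℕ} {V W : Type*} [AddCommGroup V] [Module Kqt V] [AddCommGroup W]
    [Module Kqt W] (f : V →ₗ[Kqt] W) {S : Fin n → Module.End Kqt V} {S' : Fin n → Module.End Kqt W}
    (h : ∀ i v, f (S i v) = S' i (f v)) (v : V) :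
    f ((List.ofFn S).prod v) = (List.ofFn S').prod (f v) := by
  rw [List.ofFn_eq_map, List.ofFn_eq_map]
  exact map_list_prod f h _ v

lemma map_ofFn_reverse_prod {n : ℕ} {V W : Type*} [AddCommGroup V] [Module Kqt V] [AddCommGroup W]
    [Module Kqt W] (f : V →ₗ[Kqt] W) {S : Fin n → Module.End Kqt V} {S' : Fin n → Module.End Kqt W}
    (h : ∀ i v, f (S i v) = S' i (f v)) (v : V) :
    f ((List.ofFn S).reverse.prod v) = (List.ofFn S').reverse.prod (f v) := by
  rw [List.ofFn_eq_map, List.ofFn_eq_map, ← List.map_reverse, ← List.map_reverse]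
  exact map_list_prod f h _ v

lemma prod_ofFn_castSucc {A : Type*} [Monoid A] {k : ℕ} (T : Fin (k + 1) → A) :
    (List.ofFn T).prod = (List.ofFn fun i : Fin k => T i.castSucc).prod * T (Fin.last k) := by
  rw [List.ofFn_succ', List.concat_eq_append, List.prod_append, List.prod_singleton]

/-- If `T_i y_{i+1} T_i = t y_i`, then `T_1 ⋯ T_n y_{n+1} T_n ⋯ T_1 = t ^ n y_1`. -/
lemma prod_ofFn_Y_prod_reverse {A : Type*} [Ring A] [Algebra Kqt A] (n : ℕ) (T : Fin n → A)
    (y : Fin (n + 1) → A) (hT : ∀ i : Fin n, T i * y i.succ * T i = tc • y i.castSucc) :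
    (List.ofFn T).prod * y (Fin.last n) * (List.ofFn T).reverse.prod = tc ^ n • y 0 := by
  induction n with
  | zero => simp
  | succ n ih =>
    have h1 := ih (fun i => T i.castSucc) (fun i => y i.castSucc) fun i => by
      have := hT i.castSucc
      rwa [Fin.succ_castSucc] at this
    rw [List.ofFn_succ', List.concat_eq_append, List.prod_append, List.prod_singleton,
      List.reverse_append, List.prod_append, List.reverse_singleton, List.prod_singleton]
    have h2 := hT (Fin.last n)
    rw [Fin.succ_last] at h2
    calc _ = (List.ofFn fun i : Fin n => T i.castSucc).prod *
          (T (Fin.last n) * y (Fin.last (n + 1)) * T (Fin.last n)) *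
            (List.ofFn fun i : Fin n => T i.castSucc).reverse.prod := by
          simp only [mul_assoc]
      _ = _ := by
          rw [h2, mul_smul_comm, smul_mul_assoc, h1, smul_smul, pow_succ', Fin.castSucc_zero]

namespace CoreRelations

variable {M} {Y : ∀ k, Fin (k + 1) → Module.End Kqt (M.V (k + 1))}
  {δ : ∀ k, M.V k →ₗ[Kqt] M.V (k + 1)} (h : M.CoreRelations Y δ)
include h

lemma T_mul_Tinv (k : ℕ) (i : Fin k) : M.T k i * M.Tinv k i = 1 := by
  have hq := h.T_quadratic k i
  rw [Tinv, mul_smul_comm]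
  have : M.T k i * (M.T k i + (tc - 1) • 1) = tc • 1 := by
    have e : M.T k i * (M.T k i + (tc - 1) • 1) = (M.T k i - 1) * (M.T k i + tc • 1) + tc • 1 := by
      simp only [mul_add, sub_mul, mul_smul_comm, mul_one, one_mul]; module
    rw [e, hq, zero_add]
  rw [this, smul_smul, inv_mul_cancel₀ tc_ne_zero, one_smul]

lemma Tinv_mul_T (k : ℕ) (i : Fin k) : M.Tinv k i * M.T k i = 1 := by
  have : M.Tinv k i * M.T k i = M.T k i * M.Tinv k i := by
    rw [Tinv, mul_smul_comm, smul_mul_assoc]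
    congr 1
    simp only [mul_add, add_mul, mul_smul_comm, smul_mul_assoc, mul_one, one_mul]
  rw [this, h.T_mul_Tinv]

/-- `[d₊, d₋] = (t - 1) T_1 ⋯ T_k y_{k+1}`. -/
lemma comm_eq (k : ℕ) :
    M.comm k = (tc - 1) • ((List.ofFn (M.T k)).prod * Y k (Fin.last k)) := by
  ext v
  have e := congrArg (List.ofFn (M.T k)).prod (h.comm_δ k v)
  rw [map_sub, map_smul] at e
  rw [comm, LinearMap.sub_apply, LinearMap.comp_apply, LinearMap.comp_apply, h.dPlus_eq, h.dPlus_eq,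
    prod_ofFn_castSucc, map_neg, Module.End.mul_apply,
    map_ofFn_prod (M.dMinus (k + 1)) (S' := M.T k) fun i v => (h.T_dMinus k i v).symm,
    LinearMap.smul_apply, Module.End.mul_apply, ← neg_sub 1 tc, neg_smul, ← e]
  abel

/-- The elements `y_i` of the algebra, defined through `[d₊, d₋]`, act by the given operators. -/
lemma y_eq (k : ℕ) (i : ℕ) (hi : i < k + 1) : M.y k i = Y k ⟨i, hi⟩ := by
  induction i with
  | zero =>
    rw [y, h.comm_eq, smul_mul_assoc, prod_ofFn_Y_prod_reverse _ _ _ (h.T_Y_T k), smul_smul,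
      smul_smul]
    have h1 : tc ^ k ≠ 0 := pow_ne_zero _ tc_ne_zero
    have h2 := tc_sub_one_ne_zero
    rw [show (tc ^ k * (tc - 1))⁻¹ * (tc - 1) * tc ^ k = 1 by field_simp, one_smul]
    rfl
  | succ i ih =>
    have hik : i < k := by omega
    rw [y, dif_pos hik, ih (by omega)]
    have h1 := h.T_Y_T k ⟨i, hik⟩
    have h2 : tc • (M.Tinv k ⟨i, hik⟩ * Y k ⟨i, by omega⟩ * M.Tinv k ⟨i, hik⟩) =
        M.Tinv k ⟨i, hik⟩ * (tc • Y k (Fin.castSucc ⟨i, hik⟩)) * M.Tinv k ⟨i, hik⟩ := by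
      rw [mul_smul_comm, smul_mul_assoc]; rfl
    rw [h2, ← h1]
    calc _ = (M.Tinv k ⟨i, hik⟩ * M.T k ⟨i, hik⟩) * Y k (Fin.succ ⟨i, hik⟩) *
          (M.T k ⟨i, hik⟩ * M.Tinv k ⟨i, hik⟩) := by simp only [mul_assoc]
      _ = _ := by rw [h.Tinv_mul_T, h.T_mul_Tinv, one_mul, mul_one]; rfl

lemma dPlus_T (k : ℕ) (i : Fin k) (v : M.V (k + 1)) :
    M.dPlus (k + 1) (M.T k i v) = M.T (k + 1) i.succ (M.dPlus (k + 1) v) := by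
  rw [h.dPlus_eq, h.dPlus_eq, h.δ_T, map_neg, ← Module.End.mul_apply, ← Module.End.mul_apply,
    braid_prod_mul _ (h.T_comm _) (h.T_braid _)]

lemma dPlus_Tinv (k : ℕ) (i : Fin k) (v : M.V (k + 1)) :
    M.dPlus (k + 1) (M.Tinv k i v) = M.Tinv (k + 1) i.succ (M.dPlus (k + 1) v) := by
  simp only [Tinv, LinearMap.smul_apply, LinearMap.add_apply, Module.End.one_apply, map_smul,
    map_add, h.dPlus_T]

lemma T_dPlus_sq (k : ℕ) (v : M.V k) :
    M.T (k + 1) 0 (M.dPlus (k + 1) (M.dPlus k v)) = M.dPlus (k + 1) (M.dPlus k v) := by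
  have h1 : M.dPlus (k + 1) (M.dPlus k v) =
      ((List.ofFn (M.T (k + 1))).prod * (List.ofFn fun i : Fin k => M.T (k + 1) i.castSucc).prod)
        (δ (k + 1) (δ k v)) := by
    rw [h.dPlus_eq, h.dPlus_eq, map_neg, map_neg, neg_neg, Module.End.mul_apply,
      map_ofFn_prod (δ (k + 1)) (h.δ_T k)]
  rw [h1, ← Module.End.mul_apply, ← mul_assoc,
    braid_zero_mul_prod_mul_prod _ (h.T_comm _) (h.T_braid _), Module.End.mul_apply, h.T_δ_δ]

lemma dMinus_comm (k : ℕ) (v : M.V (k + 2)) :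
    M.dMinus (k + 1) (M.comm (k + 1) (M.T (k + 1) (Fin.last k) v)) =
      tc • M.comm k (M.dMinus (k + 1) v) := by
  have h1 := LinearMap.congr_fun (h.T_Y_T (k + 1) (Fin.last k)) v
  rw [Fin.succ_last] at h1
  rw [h.comm_eq, h.comm_eq, prod_ofFn_castSucc (M.T (k + 1))]
  simp only [LinearMap.smul_apply, Module.End.mul_apply, map_smul] at h1 ⊢
  rw [h1, map_smul, map_smul, map_ofFn_prod (M.dMinus (k + 1)) (S' := M.T k)
    fun i v => (h.T_dMinus k i v).symm, ← h.Y_dMinus, smul_comm]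

/-- `T_1 ⋯ T_k y_{k+1} = t ^ k y_1 T_1⁻¹ ⋯ T_k⁻¹`. -/
lemma comm_eq' (k : ℕ) :
    M.comm k = ((tc - 1) * tc ^ k) • (Y k 0 * (List.ofFn (M.Tinv k)).prod) := by
  have h1 : (List.ofFn (M.T k)).reverse.prod * (List.ofFn (M.Tinv k)).prod = 1 :=
    prod_reverse_mul_prod_ofFn (h.T_mul_Tinv k)
  rw [h.comm_eq, mul_smul, ← smul_mul_assoc (tc ^ k), ← prod_ofFn_Y_prod_reverse _ _ _ (h.T_Y_T k),
    mul_assoc _ (List.reverse _).prod, h1, mul_one]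

lemma dPlus_Y (k : ℕ) (v : M.V (k + 1)) :
    M.dPlus (k + 1) (Y k 0 v) = M.T (k + 1) 0 (Y (k + 1) 0 (M.Tinv (k + 1) 0
      (M.dPlus (k + 1) v))) := by
  have h1 : ∀ w, M.Tinv (k + 1) 0 (M.T (k + 1) 0 w) = w := fun w =>
    LinearMap.congr_fun (h.Tinv_mul_T (k + 1) 0) w
  rw [h.dPlus_eq, h.dPlus_eq, ← h.Y_δ, List.ofFn_succ, List.prod_cons]
  simp only [map_neg, Module.End.mul_apply, h1]
  rw [map_ofFn_prod (Y (k + 1) 0) (S' := fun i : Fin k => M.T (k + 1) i.succ)]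
  intro i v
  exact h.Y_T (k + 1) i.succ (by simp) v

lemma comm_dPlus (k : ℕ) (v : M.V (k + 1)) :
    M.T (k + 1) 0 (M.comm (k + 1) (M.dPlus (k + 1) v)) =
      tc • M.dPlus (k + 1) (M.comm k v) := by
  rw [h.comm_eq', h.comm_eq', LinearMap.smul_apply, LinearMap.smul_apply, Module.End.mul_apply,
    Module.End.mul_apply, map_smul, map_smul, smul_smul, h.dPlus_Y,
    map_ofFn_prod (M.dPlus (k + 1)) (h.dPlus_Tinv k), List.ofFn_succ, List.prod_cons,
    Module.End.mul_apply]
  congr 1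
  ring

lemma dPlus_commStar (k : ℕ) (v : M.V (k + 1)) :
    M.dPlus (k + 1) (M.commStar k v) =
      M.T (k + 1) 0 (M.commStar (k + 1) (M.dPlus (k + 1) v)) := by
  have hc : ∀ (i : Fin k) v, M.commStar (k + 1) (M.T (k + 1) i.castSucc v) =
      M.T (k + 1) i.succ (M.commStar (k + 1) v) := by
    intro i v
    have e1 : M.dPlusStar (k + 2) (M.T (k + 1) i.castSucc v) =
        M.T (k + 2) i.succ.castSucc (M.dPlusStar (k + 2) v) := h.dPlusStar_T (k + 1) i.castSucc v
    simp only [commStar, LinearMap.sub_apply, LinearMap.comp_apply, map_sub]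
    rw [← h.T_dMinus, h.dPlusStar_T, e1, ← h.T_dMinus]
  have e : ∀ w, M.T (k + 1) 0 (M.commStar (k + 1)
      ((List.ofFn fun i : Fin k => M.T (k + 1) i.castSucc).prod w)) =
        (List.ofFn (M.T (k + 1))).prod (M.commStar (k + 1) w) := by
    intro w
    rw [map_ofFn_prod (M.commStar (k + 1)) (S' := fun i : Fin k => M.T (k + 1) i.succ) hc,
      List.ofFn_succ, List.prod_cons, Module.End.mul_apply]
  have e2 : (List.ofFn (M.T (k + 1))).prod (δ (k + 1) v) =
      (List.ofFn fun i : Fin k => M.T (k + 1) i.castSucc).prod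
        (M.T (k + 1) (Fin.last k) (δ (k + 1) v)) := by
    rw [prod_ofFn_castSucc (M.T (k + 1)), Module.End.mul_apply]
  rw [h.dPlus_eq, h.dPlus_eq, map_neg, map_neg, e2, e, h.δ_commStar]

lemma dPlus_z (k : ℕ) (i : ℕ) (hi : i < k) (v : M.V (k + 1)) :
    M.dPlus (k + 1) (M.z k i v) = M.z (k + 1) (i + 1) (M.dPlus (k + 1) v) := by
  induction i generalizing v with
  | zero =>
    have h1 : M.z (k + 1) 0 (M.T (k + 1) 0 (M.dPlus (k + 1) v)) =
        (tc ^ (k + 1 + 1) * (1 - tc)⁻¹) • M.commStar (k + 1)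
          (M.dPlus (k + 1) ((List.ofFn (M.Tinv k)).reverse.prod v)) := by
      have h2 : ∀ w, M.Tinv (k + 1) 0 (M.T (k + 1) 0 w) = w := fun w =>
        LinearMap.congr_fun (h.Tinv_mul_T (k + 1) 0) w
      rw [z, LinearMap.smul_apply, Module.End.mul_apply, List.ofFn_succ, List.reverse_cons,
        List.prod_append, List.prod_singleton, Module.End.mul_apply, h2,
        map_ofFn_reverse_prod (M.dPlus (k + 1)) (h.dPlus_Tinv k)]
    have h3 : M.z (k + 1) (0 + 1) =
        tc⁻¹ • (M.T (k + 1) 0 * M.z (k + 1) 0 * M.T (k + 1) 0) := by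
      exact dif_pos (Nat.succ_pos k)
    rw [h3, LinearMap.smul_apply, Module.End.mul_apply, Module.End.mul_apply, h1, z, LinearMap.smul_apply, Module.End.mul_apply, map_smul, map_smul, h.dPlus_commStar,
      smul_smul]
    congr 1
    have := tc_ne_zero
    rw [pow_succ tc (k + 1)]
    field_simp
  | succ i ih =>
    have hik : i < k := by omega
    rw [z, dif_pos hik, z, dif_pos (show i + 1 < k + 1 by omega)]
    simp only [LinearMap.smul_apply, Module.End.mul_apply, map_smul]
    rw [h.dPlus_T, ih hik, h.dPlus_T]
    rfl

lemma z_dPlus (k : ℕ) (v : M.V k) :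
    M.z k 0 (M.dPlus k v) = -(qc * tc ^ (k + 1)) • M.y k 0 (M.dPlusStar k v) := by
  have h1 : (List.ofFn (M.Tinv k)).reverse.prod * (List.ofFn (M.T k)).prod = 1 :=
    prod_reverse_mul_prod_ofFn (h.Tinv_mul_T k)
  have h2 : ∀ w, (List.ofFn (M.Tinv k)).reverse.prod ((List.ofFn (M.T k)).prod w) = w := fun w =>
    LinearMap.congr_fun h1 w
  rw [z, h.y_eq k 0 (Nat.succ_pos k), LinearMap.smul_apply, Module.End.mul_apply, h.dPlus_eq,
    map_neg, map_neg, h2, h.commStar_δ, smul_neg, smul_smul, neg_smul]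
  have : (1 - tc) ≠ 0 := by
    rw [← neg_sub]; exact neg_ne_zero.2 tc_sub_one_ne_zero
  congr 2
  field_simp

/-- The relations of `CoreRelations` imply those of the double Dyck path algebra. -/
theorem isDDPARep : M.IsDDPARep where
  T_comm := h.T_comm
  T_braid := h.T_braid
  T_quadratic := h.T_quadratic
  dMinus_sq_T k := LinearMap.ext (h.dMinus_sq_T k)
  T_dMinus k i := LinearMap.ext (h.T_dMinus k i)
  T_dPlus_sq k := LinearMap.ext (h.T_dPlus_sq k)
  dPlus_T k i := LinearMap.ext (h.dPlus_T k i)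
  dMinus_comm k := LinearMap.ext (h.dMinus_comm k)
  comm_dPlus k := LinearMap.ext (h.comm_dPlus k)
  T_dPlusStar_sq k := LinearMap.ext (h.T_dPlusStar_sq k)
  dPlusStar_T k i := LinearMap.ext (h.dPlusStar_T k i)
  dMinus_commStar k := LinearMap.ext (h.dMinus_commStar k)
  commStar_dPlusStar k := LinearMap.ext (h.commStar_dPlusStar k)
  dPlus_z k i hi := LinearMap.ext (h.dPlus_z k i hi)
  dPlusStar_y k i hi := LinearMap.ext fun v => by
    rw [h.y_eq k i (by omega), h.y_eq (k + 1) (i + 1) (by omega)]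
    exact h.dPlusStar_Y k ⟨i, by omega⟩ v
  z_dPlus k := LinearMap.ext (h.z_dPlus k)

end CoreRelations
end QuiverRep

/-! ### Constant terms in two variables -/

section PairPair

variable {R : Type*} [CommRing R]

/-- If `τ` is the image of `f` under the Demazure–Lusztig operator in the variables `u`, `v`, the
antisymmetric part of the kernel `(1 - u w) (1 - t u w)⁻¹`, with `w = v⁻¹`, is what `τ` and `f`
pair differently with. -/
lemma pair_T_eq (t : R) {τ f f' : R[X][X]} {S : PowerSeries R[X]}
    (h : (Polynomial.C Polynomial.X - Polynomial.X) * (τ - f) =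
      (Polynomial.X - Polynomial.C (Polynomial.C t * Polynomial.X)) * (f - f')) :
    pair τ ((1 - PowerSeries.C Polynomial.X * PowerSeries.X) * S) =
      pair f ((1 - PowerSeries.C Polynomial.X * PowerSeries.X) * S) -
        pair (f - f') ((1 - PowerSeries.C (Polynomial.C t * Polynomial.X) * PowerSeries.X) * S) := by
  have h' : (Polynomial.X - Polynomial.C Polynomial.X) * (τ - f) =
      -((Polynomial.X - Polynomial.C (Polynomial.C t * Polynomial.X)) * (f - f')) := by
    rw [← h]; ring
  have h1 := pair_X_sub_C_mul (Polynomial.X : R[X]) (τ - f) S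
  rw [h', pair_neg_left, pair_X_sub_C_mul, pair_sub_left τ f] at h1
  linear_combination -h1

/-- `τ` is the image of `f` under the Demazure–Lusztig operator in the variables `u`, `v`. -/
def IsBivariateT (t : R) (τ f : R[X][X]) : Prop :=
  (Polynomial.C Polynomial.X - Polynomial.X) * (τ - f) =
    (Polynomial.X - Polynomial.C (Polynomial.C t * Polynomial.X)) *
      (f - Polynomial.Bivariate.swap (R := R) f)

/-- A substitution into polynomials in `u`, `v` that turns the involution of a Demazure–Lusztig
operator into the exchange of `u` and `v`. -/
lemma HeckeOp.map_bivariate {A : Type*} [CommRing A] {t a b : A} {s : A →+* A} {T : A → A}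
    (hT : HeckeOp t a b s T) (φ : A →+* R[X][X]) {t' : R} (ha : φ a = Polynomial.C Polynomial.X)
    (hb : φ b = Polynomial.X) (ht : φ t = Polynomial.C (Polynomial.C t'))
    (hs : ∀ F, φ (s F) = Polynomial.Bivariate.swap (R := R) (φ F)) (F : A) :
    IsBivariateT t' (φ (T F)) (φ F) := by
  have h := congrArg φ (hT.spec F)
  rwa [map_mul, map_mul, map_sub, map_sub, map_sub, map_sub, map_mul, ha, hb, ht, hs,
    ← Polynomial.C_mul] at h

/-- The constant term that computes `d₋²` is unchanged by `T`: the difference pairs the antisymmetric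
polynomial `f - swap f` with a kernel that is symmetric in `u` and `v`. -/
lemma pair_pair_T_eq (t : R) {τ f : R[X][X]} {S : PowerSeries R} {S' : PowerSeries R[X]}
    (h : IsBivariateT t τ f)
    (hS : (1 - PowerSeries.C (Polynomial.C t * Polynomial.X) * PowerSeries.X) * S' =
      S.map Polynomial.C) :
    pair (pair τ ((1 - PowerSeries.C Polynomial.X * PowerSeries.X) * S')) S =
      pair (pair f ((1 - PowerSeries.C Polynomial.X * PowerSeries.X) * S')) S := by
  rw [pair_T_eq t h, hS, pair_sub_left, pair_sub_left f, pair_sub_left, pair_pair_swap]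
  ring

/-- The identity of constant terms behind `t d₋ [d₊*, d₋] = [d₊*, d₋] d₋ T`. -/
lemma pair_pair_T_eq_mul (t W : R) {τ f : R[X][X]} {S : PowerSeries R} {S' : PowerSeries R[X]}
    (h : IsBivariateT t τ f)
    (hS : (1 - PowerSeries.C (Polynomial.C t * Polynomial.X) * PowerSeries.X) * S' =
      S.map Polynomial.C) :
    t * pair (pair f (PowerSeries.X * (1 - PowerSeries.C Polynomial.X * PowerSeries.X) * S'))
        ((1 - PowerSeries.C W * PowerSeries.X) * S) =
      pair (pair τ ((1 - PowerSeries.C Polynomial.X * PowerSeries.X) *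
        ((1 - PowerSeries.C (Polynomial.C (t * W)) * PowerSeries.X) * S')))
          (PowerSeries.X * S) := by
  -- both sides are brought to the form `pair (pair f _) (w S)`
  have h1 : pair (pair (Polynomial.Bivariate.swap (R := R) f)
      (((1 - PowerSeries.C (t * W) * PowerSeries.X) * S).map Polynomial.C)) (PowerSeries.X * S) =
      pair (pair f (PowerSeries.C (Polynomial.X - Polynomial.C (t * W)) *
        (PowerSeries.X * S.map Polynomial.C))) (PowerSeries.X * S) := by
    have e0 : (PowerSeries.X * S).map Polynomial.C = PowerSeries.X * S.map Polynomial.C := by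
      rw [map_mul, PowerSeries.map_X]
    rw [pair_pair_swap, ← pair_X_sub_C_mul, pair_C_mul_right, e0]
  have e1 : (((1 - PowerSeries.C (t * W) * PowerSeries.X) * S).map Polynomial.C) =
      (1 - PowerSeries.C (Polynomial.C (t * W)) * PowerSeries.X) * S.map Polynomial.C := by
    simp
  have e2 : (1 - PowerSeries.C (Polynomial.C t * Polynomial.X) * PowerSeries.X) *
      ((1 - PowerSeries.C (Polynomial.C (t * W)) * PowerSeries.X) * S') =
      ((1 - PowerSeries.C (t * W) * PowerSeries.X) * S).map Polynomial.C := by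
    rw [e1, ← hS]; ring
  rw [pair_T_eq t h, e2, pair_sub_left, pair_sub_left f, pair_sub_left, h1, ← pair_X_sub_C_mul,
    ← pair_C_mul, ← pair_C_mul_right, ← pair_C_mul_right]
  rw [← sub_eq_zero]
  simp only [← pair_sub_left, ← pair_sub_right]
  convert pair_zero_left (PowerSeries.X * S) using 2
  convert pair_C_mul_right (0 : R[X]) f 0 using 1
  · congr 1
    rw [e1, ← hS, map_zero, zero_mul]
    simp only [map_mul, map_sub]
    ring
  · rw [zero_mul]

end PairPair

/-! ### The standard representation -/

/-- The power sum `p_n[X]` in `V_k`. -/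
def pv {k : ℕ} (n : ℕ) : VStd k := 1 ⊗ₜ psum n

lemma vstd_algHom_ext {k : ℕ} {A : Type*} [Semiring A] [Algebra Kqt A] {φ ψ : VStd k →ₐ[Kqt] A}
    (hy : ∀ i, φ (yv i) = ψ (yv i)) (hp : ∀ n, n ≠ 0 → φ (pv n) = ψ (pv n)) : φ = ψ := by
  apply Algebra.TensorProduct.ext
  · ext1 i
    exact hy i
  · exact symFun_algHom_ext hp

instance (k : ℕ) : IsDomain (VStd k) :=
  haveI : IsDomain PS := NoZeroDivisors.to_isDomain _
  (Subtype.val_injective.comp (mulMap_bijective k).1).isDomain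
    (((calP k).val.comp (mulMap k)).toRingHom)

instance (k : ℕ) : Nontrivial (VStd k) := IsDomain.toNontrivial

lemma addVar_yv (k : ℕ) (i : Fin k) : addVar k (yv i) = yv i.castSucc := by
  change addVar k (MvPolynomial.X i ⊗ₜ 1) = _
  rw [addVar, Algebra.TensorProduct.lift_tmul, map_one, mul_one, MvPolynomial.aeval_X]

lemma addVar_pv (k : ℕ) {n : ℕ} (hn : n ≠ 0) :
    addVar k (pv n) = pv n + (tc ^ n - 1) • yv (Fin.last k) ^ n := by
  change addVar k (1 ⊗ₜ psum n) = _
  rw [addVar, Algebra.TensorProduct.lift_tmul, map_one, one_mul, pleth_psum _ hn]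
  rfl

lemma zeta_yv_castSucc (k : ℕ) (i : Fin k) : zeta k (yv i.castSucc) = yv i.succ := by
  rw [zeta, yv, Algebra.TensorProduct.map_tmul, map_one, MvPolynomial.aeval_X, Fin.lastCases_castSucc]
  rfl

lemma zeta_yv_last (k : ℕ) : zeta k (yv (Fin.last k)) = qc • yv 0 := by
  rw [zeta, yv, Algebra.TensorProduct.map_tmul, map_one, MvPolynomial.aeval_X, Fin.lastCases_last]
  rfl

lemma zeta_pv (k : ℕ) (n : ℕ) : zeta k (pv n) = pv n := by
  rw [zeta, pv, Algebra.TensorProduct.map_tmul, map_one]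
  rfl

lemma subVar_yv_castSucc (k : ℕ) (i : Fin k) :
    subVar k (yv i.castSucc) = Polynomial.C (yv i) := by
  change subVar k (MvPolynomial.X i.castSucc ⊗ₜ 1) = _
  rw [subVar, Algebra.TensorProduct.lift_tmul, map_one, mul_one, MvPolynomial.aeval_X,
    Fin.lastCases_castSucc]

lemma subVar_yv_last (k : ℕ) : subVar k (yv (Fin.last k)) = Polynomial.X := by
  change subVar k (MvPolynomial.X (Fin.last k) ⊗ₜ 1) = _
  rw [subVar, Algebra.TensorProduct.lift_tmul, map_one, mul_one, MvPolynomial.aeval_X,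
    Fin.lastCases_last]

lemma subVar_pv (k : ℕ) {n : ℕ} (hn : n ≠ 0) :
    subVar k (pv n) = Polynomial.C (pv n) + (1 - tc ^ n) • Polynomial.X ^ n := by
  change subVar k (1 ⊗ₜ psum n) = _
  rw [subVar, Algebra.TensorProduct.lift_tmul, map_one, one_mul, pleth_psum _ hn]
  have (A : Type) [CommRing A] [Module Kqt A] (a b : A) :
      a - (tc ^ n - 1) • b = a + (1 - tc ^ n) • b := by
    rw [← neg_sub (1 : Kqt), neg_smul, sub_neg_eq_add]
  exact this (VStd k)[X] _ _

/-- The algebra morphism `F ↦ ζ_{k+1} F[X + (t - 1) y_{k+1}]` that underlies `d₊*`. -/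
def psi (k : ℕ) : VStd k →ₐ[Kqt] VStd (k + 1) := (zeta k).comp (addVar k)

lemma psi_yv (k : ℕ) (i : Fin k) : psi k (yv i) = yv i.succ := by
  rw [psi, AlgHom.comp_apply, addVar_yv, zeta_yv_castSucc]

lemma psi_pv (k : ℕ) {n : ℕ} (hn : n ≠ 0) :
    psi k (pv n) = pv n + (tc ^ n - 1) • (qc • yv 0) ^ n := by
  rw [psi, AlgHom.comp_apply, addVar_pv k hn, map_add, map_smul, map_pow, zeta_yv_last, zeta_pv]

/-- The substitution that exchanges `y_{i+1}` and `y_{i+2}`. -/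
def swapV (k : ℕ) (i : Fin k) : VStd (k + 1) →ₐ[Kqt] VStd (k + 1) :=
  Algebra.TensorProduct.map (MvPolynomial.rename (Equiv.swap i.castSucc i.succ))
    (AlgHom.id Kqt SymFun)

lemma swapV_yv (k : ℕ) (i : Fin k) (j : Fin (k + 1)) :
    swapV k i (yv j) = yv (Equiv.swap i.castSucc i.succ j) := by
  rw [swapV, yv, Algebra.TensorProduct.map_tmul, MvPolynomial.rename_X]
  rfl

lemma swapV_yv_of_ne (k : ℕ) (i : Fin k) (j : Fin (k + 1)) (h1 : j.val ≠ i.val)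
    (h2 : j.val ≠ i.val + 1) : swapV k i (yv j) = yv j := by
  rw [swapV_yv, Equiv.swap_apply_of_ne_of_ne]
  · exact fun h => h1 (congrArg Fin.val h)
  · exact fun h => h2 (congrArg Fin.val h)

lemma swapV_pv (k : ℕ) (i : Fin k) (n : ℕ) : swapV k i (pv n) = pv n := by
  rw [swapV, pv, Algebra.TensorProduct.map_tmul, map_one]
  rfl

lemma yv_injective {k : ℕ} {i j : Fin k} (h : (yv i : VStd k) = yv j) : i = j := by
  have h1 := congrArg (fun v => (mulMap k v : calP k).1) h
  simp only [yv, mulMap_tmul, map_one, mul_one, coe_polyIncl_X] at h1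
  exact Fin.ext (MvPowerSeries.X_inj.1 h1)

/-- The parameter `t` in a `ℚ(t,q)`-algebra. -/
abbrev tA (A : Type*) [CommRing A] [Algebra Kqt A] : A := algebraMap Kqt A tc

lemma stdT_hecke (k : ℕ) (i : Fin k) :
    HeckeOp (tA (VStd (k + 1))) (yv i.castSucc) (yv i.succ) (swapV k i).toRingHom (stdT k i) where
  spec F := by
    induction F using TensorProduct.induction_on with
    | zero => rw [map_zero, map_zero, sub_zero, mul_zero, mul_zero]
    | add F G hF hG =>
      rw [map_add, map_add]
      linear_combination hF + hG
    | tmul f P =>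
      have h := divDiffPoly_spec k i f
      have e : (yv i.succ : VStd (k + 1)) - tA (VStd (k + 1)) * yv i.castSucc =
          (MvPolynomial.X i.succ - MvPolynomial.C tc * MvPolynomial.X i.castSucc) ⊗ₜ 1 := by
        rw [TensorProduct.sub_tmul, ← MvPolynomial.smul_eq_C_mul, ← TensorProduct.smul_tmul',
          ← Algebra.smul_def]
        rfl
      have e2 : (yv i.castSucc : VStd (k + 1)) - yv i.succ =
          (MvPolynomial.X i.castSucc - MvPolynomial.X i.succ) ⊗ₜ 1 := by
        rw [TensorProduct.sub_tmul]
        rfl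
      have e3 : stdT k i (f ⊗ₜ P) = polyT k i f ⊗ₜ P := rfl
      have e4 : (swapV k i).toRingHom (f ⊗ₜ P) =
          MvPolynomial.rename (Equiv.swap i.castSucc i.succ) f ⊗ₜ P := rfl
      rw [e, e2, e3, e4, ← TensorProduct.sub_tmul, ← TensorProduct.sub_tmul,
        Algebra.TensorProduct.tmul_mul_tmul, Algebra.TensorProduct.tmul_mul_tmul, one_mul]
      congr 1
      simp only [polyT, LinearMap.add_apply, LinearMap.smul_apply, LinearMap.comp_apply,
        AlgHom.toLinearMap_apply, LinearMap.mulLeft_apply, MvPolynomial.smul_eq_C_mul, map_sub,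
        map_one]
      linear_combination (1 - MvPolynomial.C tc) * MvPolynomial.X i.castSucc * h
  map_a := (swapV_yv k i _).trans (by rw [Equiv.swap_apply_left])
  map_b := (swapV_yv k i _).trans (by rw [Equiv.swap_apply_right])
  map_t := (swapV k i).commutes tc
  map_map F := by
    have : (swapV k i).comp (swapV k i) = AlgHom.id _ _ := by
      apply vstd_algHom_ext
      · intro j
        rw [AlgHom.comp_apply, swapV_yv, swapV_yv, Equiv.swap_apply_self]; rfl
      · intro n _
        rw [AlgHom.comp_apply, swapV_pv, swapV_pv]; rfl
    exact DFunLike.congr_fun this F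
  ne h := (Fin.castSucc_lt_succ (i := i)).ne (yv_injective (sub_eq_zero.1 h))

/-! ### The series `Exp[-X w]` -/

section

variable {R : Type} [CommRing R] [Algebra Kqt R]

/-- `(1 - a w) Exp[-(X + (t - 1) a) w] = (1 - t a w) Exp[-X w]`. -/
lemma expSeries_shift (P Q : ℕ → R) (a : R) (h : ∀ n, n ≠ 0 → Q n = P n + (tc ^ n - 1) • a ^ n) :
    (1 - PowerSeries.C a * PowerSeries.X) * expSeries (fun n => -Q n) =
      (1 - PowerSeries.C (tA R * a) * PowerSeries.X) * expSeries (fun n => -P n) := by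
  rw [← expSeries_neg_pow, ← expSeries_neg_pow, ← expSeries_add, ← expSeries_add]
  apply expSeries_congr
  intro n hn
  rw [h n hn, sub_smul, one_smul, Algebra.smul_def, mul_pow, map_pow]
  ring

lemma one_sub_C_mul_X_ne_zero {R : Type*} [CommRing R] [Nontrivial R] (a : R) :
    (1 - PowerSeries.C a * PowerSeries.X : PowerSeries R) ≠ 0 := by
  intro h
  have := congrArg PowerSeries.constantCoeff h
  simp at this

end

/-- The series `Exp[-X w]` with coefficients in `V_k`. -/
def hSer (k : ℕ) : PowerSeries (VStd k) := expSeries fun n => -pv n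

lemma map_hSer {k : ℕ} {R : Type} [CommRing R] [Algebra Kqt R] (φ : VStd k →ₐ[Kqt] R) :
    (hSer k).map φ.toRingHom = expSeries fun n => -φ (pv n) := by
  rw [hSer, map_expSeries]
  simp only [map_neg]

lemma stdDMinus_eq (k : ℕ) (F : VStd (k + 1)) : stdDMinus k F = pair (subVar k F) (hSer k) := by
  rw [stdDMinus, LinearMap.comp_apply, Polynomial.lsum_apply, pair]
  congr 1
  funext n a
  rw [LinearMap.mulRight_apply]
  congr 1
  have h := map_expSeries (Algebra.TensorProduct.includeRight : SymFun →ₐ[Kqt] VStd k)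
    (fun n => -psum n)
  have h1 := congrArg (PowerSeries.coeff n) h
  rw [PowerSeries.coeff_map, expSeries, PowerSeries.coeff_mk] at h1
  simp only [map_neg] at h1
  exact h1

/-! ### Relations of the standard representation -/

lemma swapV_comm {k : ℕ} {i j : Fin k} (hij : i.val + 1 < j.val) (F : VStd (k + 1)) :
    swapV k i (swapV k j F) = swapV k j (swapV k i F) := by
  have : (swapV k i).comp (swapV k j) = (swapV k j).comp (swapV k i) := by
    apply vstd_algHom_ext
    · intro a
      simp only [AlgHom.comp_apply, swapV_yv]
      congr 1
      have h : Disjoint ({i.castSucc, i.succ} : Finset (Fin (k + 1))) {j.castSucc, j.succ} := by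
        rw [Finset.disjoint_left]
        simp only [Finset.mem_insert, Finset.mem_singleton, Fin.ext_iff, Fin.val_castSucc,
          Fin.val_succ]
        omega
      have h' : (Equiv.swap i.castSucc i.succ).Disjoint (Equiv.swap j.castSucc j.succ) := by
        intro x
        by_cases hx : x = i.castSucc ∨ x = i.succ
        · right
          have : x ∉ ({j.castSucc, j.succ} : Finset (Fin (k + 1))) :=
            Finset.disjoint_left.1 h (by simpa using hx)
          simp only [Finset.mem_insert, Finset.mem_singleton, not_or] at this
          exact Equiv.swap_apply_of_ne_of_ne this.1 this.2
        · left
          exact Equiv.swap_apply_of_ne_of_ne (fun e => hx (Or.inl e)) (fun e => hx (Or.inr e))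
      exact DFunLike.congr_fun h'.commute.eq a
    · intro n _
      simp only [AlgHom.comp_apply, swapV_pv]
  exact DFunLike.congr_fun this F

lemma swapV_braid {k : ℕ} {i j : Fin k} (hij : j.val = i.val + 1) (F : VStd (k + 1)) :
    swapV k i (swapV k j (swapV k i F)) = swapV k j (swapV k i (swapV k j F)) := by
  have : (swapV k i).comp ((swapV k j).comp (swapV k i)) =
      (swapV k j).comp ((swapV k i).comp (swapV k j)) := by
    apply vstd_algHom_ext
    · intro a
      simp only [AlgHom.comp_apply, swapV_yv]
      congr 1
      have e : i.succ = j.castSucc := Fin.ext hij.symm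
      rw [e]
      have h := Equiv.swap_mul_swap_mul_swap (x := j.succ) (y := j.castSucc) (z := i.castSucc)
        (by simp [Fin.ext_iff]) (by simp [Fin.ext_iff]; omega)
      have h' := Equiv.swap_mul_swap_mul_swap (x := i.castSucc) (y := j.castSucc) (z := j.succ)
        (by simp [Fin.ext_iff]; omega) (by simp [Fin.ext_iff]; omega)
      rw [Equiv.swap_comm j.castSucc, Equiv.swap_comm j.succ] at h
      rw [Equiv.swap_comm j.succ i.castSucc] at h'
      have := congrArg (fun σ : Equiv.Perm (Fin (k + 1)) => σ a) (h.trans h'.symm)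
      simpa only [Equiv.Perm.mul_apply] using this
    · intro n _
      simp only [AlgHom.comp_apply, swapV_pv]
  exact DFunLike.congr_fun this F

lemma stdT_comm (k : ℕ) (i j : Fin k) (hij : i.val + 1 < j.val) :
    stdT k i * stdT k j = stdT k j * stdT k i := by
  refine LinearMap.ext fun F => ?_
  refine (stdT_hecke k i).comm (stdT_hecke k j) ?_ ?_ ?_ ?_ (swapV_comm hij)
    (fun F G => map_sub _ F G) F
  all_goals
    apply swapV_yv_of_ne <;> simp <;> omega

lemma stdT_braid (k : ℕ) (i j : Fin k) (hij : j.val = i.val + 1) :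
    stdT k i * stdT k j * stdT k i = stdT k j * stdT k i * stdT k j := by
  refine LinearMap.ext fun F => ?_
  have e : i.succ = j.castSucc := Fin.ext hij.symm
  have h := stdT_hecke k i
  rw [e] at h
  refine h.braid (stdT_hecke k j) ?_ ?_ ?_ (swapV_braid hij) F
  · apply swapV_yv_of_ne <;> simp <;> omega
  · apply swapV_yv_of_ne <;> simp <;> omega
  · intro h0
    have := congrArg Fin.val (yv_injective (sub_eq_zero.1 h0))
    simp at this
    omega

lemma stdT_quadratic (k : ℕ) (i : Fin k) : (stdT k i - 1) * (stdT k i + tc • 1) = 0 := by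
  refine LinearMap.ext fun F => ?_
  have h := (stdT_hecke k i).quadratic F
  rw [← Algebra.smul_def] at h
  simp only [Module.End.mul_apply, LinearMap.sub_apply, LinearMap.add_apply, LinearMap.smul_apply,
    Module.End.one_apply, LinearMap.zero_apply]
  rw [h, sub_self]

lemma tA_mul {A : Type*} [CommRing A] [Algebra Kqt A] (x : A) : tA A * x = tc • x :=
  (Algebra.smul_def _ _).symm

lemma one_sub_tA_mul {A : Type*} [CommRing A] [Algebra Kqt A] (x : A) :
    (1 - tA A) * x = (1 - tc) • x := by
  rw [sub_mul, one_mul, tA_mul, sub_smul, one_smul]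

lemma map_tA {A B : Type*} [CommRing A] [Algebra Kqt A] [CommRing B] [Algebra Kqt B]
    (φ : A →ₐ[Kqt] B) : φ (tA A) = tA B := φ.commutes tc

lemma C_tA {A : Type*} [CommRing A] [Algebra Kqt A] : Polynomial.C (tA A) = tA A[X] :=
  (Polynomial.algebraMap_apply tc).symm

/-! #### The raising operators -/

lemma psi_swapV (k : ℕ) (i : Fin k) (F : VStd (k + 1)) :
    psi (k + 1) (swapV k i F) = swapV (k + 1) i.succ (psi (k + 1) F) := by
  have : (psi (k + 1)).comp (swapV k i) = (swapV (k + 1) i.succ).comp (psi (k + 1)) := by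
    apply vstd_algHom_ext
    · intro a
      simp only [AlgHom.comp_apply, swapV_yv, psi_yv]
      congr 1
      simp only [Equiv.swap_apply_def, ← Fin.succ_castSucc, Fin.succ_inj]
      split_ifs <;> rfl
    · intro n hn
      simp only [AlgHom.comp_apply, swapV_pv, psi_pv _ hn, map_add, map_smul, map_pow]
      rw [swapV_yv_of_ne _ _ 0 (by simp) (by simp)]
  exact DFunLike.congr_fun this F

lemma addVar_swapV (k : ℕ) (i : Fin k) (F : VStd (k + 1)) :
    addVar (k + 1) (swapV k i F) = swapV (k + 1) i.castSucc (addVar (k + 1) F) := by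
  have : (addVar (k + 1)).comp (swapV k i) = (swapV (k + 1) i.castSucc).comp (addVar (k + 1)) := by
    apply vstd_algHom_ext
    · intro a
      simp only [AlgHom.comp_apply, swapV_yv, addVar_yv]
      congr 1
      simp only [Equiv.swap_apply_def, Fin.succ_castSucc, Fin.castSucc_inj]
      split_ifs <;> rfl
    · intro n hn
      simp only [AlgHom.comp_apply, swapV_pv, addVar_pv _ hn, map_add, map_smul, map_pow]
      rw [swapV_yv_of_ne _ _ (Fin.last _) (by simp; omega) (by simp; omega)]
  exact DFunLike.congr_fun this F

lemma psi_stdT (k : ℕ) (i : Fin k) (F : VStd (k + 1)) :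
    psi (k + 1) (stdT k i F) = stdT (k + 1) i.succ (psi (k + 1) F) :=
  (stdT_hecke k i).map_T (stdT_hecke (k + 1) i.succ) (θ := (psi (k + 1)).toRingHom)
    (psi_yv _ _) (psi_yv _ _) (map_tA _) (psi_swapV k i) F

lemma addVar_stdT (k : ℕ) (i : Fin k) (F : VStd (k + 1)) :
    addVar (k + 1) (stdT k i F) = stdT (k + 1) i.castSucc (addVar (k + 1) F) :=
  (stdT_hecke k i).map_T (stdT_hecke (k + 1) i.castSucc) (θ := (addVar (k + 1)).toRingHom)
    (addVar_yv _ _) (addVar_yv _ _) (map_tA _) (addVar_swapV k i) F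

/-- `F ↦ y_{k+1} F[X + (t - 1) y_{k+1}]`, so that `d₊ = - T_1 ⋯ T_k δ`. -/
def stdDelta (k : ℕ) : VStd k →ₗ[Kqt] VStd (k + 1) :=
  LinearMap.mulLeft Kqt (yv (Fin.last k)) ∘ₗ (addVar k).toLinearMap

lemma stdDelta_apply (k : ℕ) (F : VStd k) : stdDelta k F = yv (Fin.last k) * addVar k F := rfl

lemma stdDelta_stdT (k : ℕ) (i : Fin k) (F : VStd (k + 1)) :
    stdDelta (k + 1) (stdT k i F) = stdT (k + 1) i.castSucc (stdDelta (k + 1) F) := by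
  rw [stdDelta_apply, stdDelta_apply, addVar_stdT, (stdT_hecke (k + 1) i.castSucc).mul_of_fixed]
  apply swapV_yv_of_ne <;> simp <;> omega

lemma stdT_stdDelta_stdDelta (k : ℕ) (F : VStd k) :
    stdT (k + 1) (Fin.last k) (stdDelta (k + 1) (stdDelta k F)) =
      stdDelta (k + 1) (stdDelta k F) := by
  apply (stdT_hecke (k + 1) (Fin.last k)).of_fixed
  change swapV (k + 1) (Fin.last k) _ = _
  have h : ((swapV (k + 1) (Fin.last k)).comp (addVar (k + 1))).comp (addVar k) =
      (addVar (k + 1)).comp (addVar k) := by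
    apply vstd_algHom_ext
    · intro i
      simp only [AlgHom.comp_apply, addVar_yv]
      apply swapV_yv_of_ne <;> simp <;> omega
    · intro n hn
      simp only [AlgHom.comp_apply, addVar_pv _ hn, map_add, map_smul, map_pow, addVar_yv, swapV_pv,
        swapV_yv, Equiv.swap_apply_left]
      rw [← Fin.succ_last, Equiv.swap_apply_right]
      abel
  have h' := DFunLike.congr_fun h F
  simp only [AlgHom.comp_apply] at h'
  simp only [stdDelta_apply, map_mul, h', addVar_yv, swapV_yv, Equiv.swap_apply_left]
  rw [← Fin.succ_last, Equiv.swap_apply_right]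
  ring

lemma swapV_psi_psi (k : ℕ) (F : VStd k) :
    swapV (k + 1) 0 (psi (k + 1) (psi k F)) = psi (k + 1) (psi k F) := by
  have h : ((swapV (k + 1) 0).comp (psi (k + 1))).comp (psi k) = (psi (k + 1)).comp (psi k) := by
    apply vstd_algHom_ext
    · intro i
      simp only [AlgHom.comp_apply, psi_yv]
      apply swapV_yv_of_ne <;> simp
    · intro n hn
      simp only [AlgHom.comp_apply, psi_pv _ hn, map_add, map_smul, map_pow, psi_yv, swapV_pv,
        swapV_yv]
      have e1 : Equiv.swap (Fin.castSucc (0 : Fin (k + 1))) (Fin.succ 0) (Fin.succ 0) = 0 :=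
        Equiv.swap_apply_right _ _
      have e2 : Equiv.swap (Fin.castSucc (0 : Fin (k + 1))) (Fin.succ 0) 0 = Fin.succ 0 :=
        Equiv.swap_apply_left _ _
      rw [e1, e2]
      abel
  exact DFunLike.congr_fun h F

lemma stdT_psi_psi (k : ℕ) (F : VStd k) :
    stdT (k + 1) 0 (psi (k + 1) (psi k F)) = psi (k + 1) (psi k F) :=
  (stdT_hecke (k + 1) 0).of_fixed (swapV_psi_psi k F)

/-! #### The lowering operator -/

lemma stdDMinus_yv_mul (k : ℕ) (i : Fin k) (F : VStd (k + 1)) :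
    stdDMinus k (yv i.castSucc * F) = yv i * stdDMinus k F := by
  rw [stdDMinus_eq, stdDMinus_eq, map_mul, subVar_yv_castSucc, pair_C_mul]

lemma map_swapV_hSer (k : ℕ) (i : Fin k) :
    (hSer (k + 1)).map (swapV k i).toRingHom = hSer (k + 1) := by
  rw [map_hSer]
  simp only [swapV_pv]
  rfl

lemma mapAlgHom_C {A B : Type*} [Semiring A] [Algebra Kqt A] [Semiring B] [Algebra Kqt B]
    (φ : A →ₐ[Kqt] B) (a : A) : Polynomial.mapAlgHom φ (Polynomial.C a) = Polynomial.C (φ a) :=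
  Polynomial.map_C _

lemma mapAlgHom_X {A B : Type*} [Semiring A] [Algebra Kqt A] [Semiring B] [Algebra Kqt B]
    (φ : A →ₐ[Kqt] B) : Polynomial.mapAlgHom φ (Polynomial.X : A[X]) = Polynomial.X :=
  Polynomial.map_X _

lemma map_swapV_subVar (k : ℕ) (i : Fin k) (F : VStd (k + 2)) :
    (subVar (k + 1) F).map (swapV k i).toRingHom =
      subVar (k + 1) (swapV (k + 1) i.castSucc F) := by
  have h : (Polynomial.mapAlgHom (swapV k i)).comp (subVar (k + 1)) =
      (subVar (k + 1)).comp (swapV (k + 1) i.castSucc) := by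
    apply vstd_algHom_ext
    · intro a
      rw [AlgHom.comp_apply, AlgHom.comp_apply, swapV_yv]
      refine Fin.lastCases ?_ (fun a => ?_) a
      · rw [Equiv.swap_apply_of_ne_of_ne, subVar_yv_last]
        · simp
        · simp [Fin.ext_iff]; omega
        · simp [Fin.ext_iff]; omega
      · have : Equiv.swap i.castSucc.castSucc i.castSucc.succ a.castSucc =
            (Equiv.swap i.castSucc i.succ a).castSucc := by
          simp only [Equiv.swap_apply_def, Fin.succ_castSucc, Fin.castSucc_inj]
          split_ifs <;> rfl
        rw [this, subVar_yv_castSucc, subVar_yv_castSucc]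
        simp [swapV_yv]
    · intro n hn
      rw [AlgHom.comp_apply, AlgHom.comp_apply, swapV_pv, subVar_pv _ hn, map_add, map_smul,
        map_pow, mapAlgHom_C, mapAlgHom_X, swapV_pv]
  exact DFunLike.congr_fun h F

lemma swapV_stdDMinus (k : ℕ) (i : Fin k) (F : VStd (k + 2)) :
    swapV k i (stdDMinus (k + 1) F) = stdDMinus (k + 1) (swapV (k + 1) i.castSucc F) := by
  rw [stdDMinus_eq, stdDMinus_eq]
  have h1 := map_pair (swapV k i).toRingHom (subVar (k + 1) F) (hSer (k + 1))
  rw [map_swapV_hSer] at h1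
  exact h1.trans (by rw [map_swapV_subVar])

lemma stdT_stdDMinus (k : ℕ) (i : Fin k) (F : VStd (k + 2)) :
    stdT k i (stdDMinus (k + 1) F) = stdDMinus (k + 1) (stdT (k + 1) i.castSucc F) := by
  apply (stdT_hecke k i).eq_of
  change _ = _ * (_ - swapV k i _)
  have h0 : (swapV (k + 1) i.castSucc).toRingHom F = swapV (k + 1) i.castSucc F := rfl
  have h := congrArg (stdDMinus (k + 1)) ((stdT_hecke (k + 1) i.castSucc).spec F)
  rw [h0] at h
  rw [swapV_stdDMinus, ← map_sub, ← map_sub]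
  simp only [sub_mul, smul_mul_assoc, tA_mul, map_sub, map_smul, Fin.succ_castSucc, stdDMinus_yv_mul] at h ⊢
  exact h

/-- The shifts `X ↦ X + (t - 1) y_{k+1}` and `X ↦ X - (t - 1) u` cancel at `y_{k+1} = u`. -/
lemma subVar_addVar (k : ℕ) (F : VStd k) : subVar k (addVar k F) = Polynomial.C F := by
  have h : (subVar k).comp (addVar k) = (Polynomial.CAlgHom : VStd k →ₐ[Kqt] (VStd k)[X]) := by
    apply vstd_algHom_ext
    · intro i
      rw [AlgHom.comp_apply, addVar_yv, subVar_yv_castSucc]; rfl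
    · intro n hn
      rw [AlgHom.comp_apply, addVar_pv _ hn, map_add, map_smul, map_pow, subVar_yv_last,
        subVar_pv _ hn, add_assoc, ← add_smul, sub_add_sub_cancel, sub_self, zero_smul, add_zero]; rfl
  exact DFunLike.congr_fun h F

/-- The factor `(1 - a w)⁻¹` of the series `Exp[-X w]`. -/
lemma exists_hSer_factor {k : ℕ} {R : Type} [CommRing R] [IsDomain R] [Algebra Kqt R]
    (φ : VStd k →ₐ[Kqt] R) (P : ℕ → R) (a : R)
    (h : ∀ n, n ≠ 0 → φ (pv n) = P n + (tc ^ n - 1) • a ^ n) :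
    ∃ S, (1 - PowerSeries.C a * PowerSeries.X) * S = expSeries (fun n => -P n) ∧
      (hSer k).map φ.toRingHom = (1 - PowerSeries.C (tA R * a) * PowerSeries.X) * S := by
  obtain ⟨S, hS⟩ := exists_one_sub_mul_eq a (expSeries fun n => -P n)
  refine ⟨S, hS, mul_left_cancel₀ (one_sub_C_mul_X_ne_zero a) ?_⟩
  rw [map_hSer, expSeries_shift P _ a h, ← hS]
  ring

/-- Both `[d₊, d₋]` and `[d₊*, d₋] d₊` lead to the following expression: `σ` is a substitution into
polynomials in `u` that sends `y_k`, `y_{k+1}` to `A`, `u`. -/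
lemma map_stdT_stdDelta {k : ℕ} {R : Type} [CommRing R] [IsDomain R] [Algebra Kqt R]
    (σ : VStd (k + 2) →ₐ[Kqt] R[X]) (A b : R) (F : VStd (k + 1))
    (hA : σ (yv (Fin.last k).castSucc) = Polynomial.C A)
    (hu : σ (yv (Fin.last (k + 1))) = Polynomial.X)
    (hb : σ (addVar (k + 1) F) = Polynomial.C b) :
    (Polynomial.X - Polynomial.C A) * σ (stdT (k + 1) (Fin.last k) (stdDelta (k + 1) F)) =
      Polynomial.C A * ((Polynomial.X - Polynomial.C (tA R * A)) *
        σ (swapV (k + 1) (Fin.last k) (addVar (k + 1) F))) -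
        Polynomial.C ((1 - tA R) * A * b) * Polynomial.X := by
  have h := congrArg σ ((stdT_hecke (k + 1) (Fin.last k)).spec (stdDelta (k + 1) F))
  have e : (swapV (k + 1) (Fin.last k)).toRingHom (stdDelta (k + 1) F) =
      yv (Fin.last k).castSucc * swapV (k + 1) (Fin.last k) (addVar (k + 1) F) := by
    change swapV (k + 1) (Fin.last k) _ = _
    rw [stdDelta_apply, map_mul, swapV_yv, ← Fin.succ_last, Equiv.swap_apply_right]
  rw [e, map_mul, map_mul, map_sub, map_sub, map_sub, map_sub, map_mul, map_mul, map_tA,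
    Fin.succ_last, hA, hu] at h
  rw [stdDelta_apply, map_mul σ (yv _), hu, hb, ← C_tA, ← stdDelta_apply] at h
  simp only [map_mul, map_sub, map_one]
  linear_combination -h

lemma subVar_swapV_addVar (k : ℕ) (F : VStd (k + 1)) :
    subVar (k + 1) (swapV (k + 1) (Fin.last k) (addVar (k + 1) F)) =
      (subVar k F).map (addVar k).toRingHom := by
  have : ((subVar (k + 1)).comp (swapV (k + 1) (Fin.last k))).comp (addVar (k + 1)) =
      (Polynomial.mapAlgHom (addVar k)).comp (subVar k) := by
    apply vstd_algHom_ext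
    · intro j
      rw [AlgHom.comp_apply, AlgHom.comp_apply, AlgHom.comp_apply, addVar_yv]
      refine Fin.lastCases ?_ (fun j => ?_) j
      · rw [swapV_yv, Equiv.swap_apply_left, Fin.succ_last, subVar_yv_last, subVar_yv_last]
        simp
      · rw [swapV_yv_of_ne, subVar_yv_castSucc, subVar_yv_castSucc]
        · simp [addVar_yv]
        · simp; omega
        · simp; omega
    · intro n hn
      rw [AlgHom.comp_apply, AlgHom.comp_apply, AlgHom.comp_apply, addVar_pv _ hn, map_add,
        map_smul, map_pow, swapV_pv, swapV_yv, ← Fin.succ_last, Equiv.swap_apply_right, map_add,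
        map_smul, map_pow, subVar_pv _ hn, subVar_yv_castSucc, subVar_pv _ hn]
      rw [map_add (Polynomial.mapAlgHom _), map_smul, map_pow, mapAlgHom_C, mapAlgHom_X,
        addVar_pv _ hn, map_add, ← Polynomial.smul_C, map_pow]
      exact add_right_comm _ _ _
  exact DFunLike.congr_fun this F

lemma stdDelta_stdDMinus_sub (k : ℕ) (F : VStd (k + 1)) :
    stdDelta k (stdDMinus k F) -
      stdDMinus (k + 1) (stdT (k + 1) (Fin.last k) (stdDelta (k + 1) F)) =
        (1 - tc) • (yv (Fin.last k) * F) := by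
  obtain ⟨S, hS, hS'⟩ := exists_hSer_factor (addVar k) _ (yv (Fin.last k)) fun n hn => addVar_pv k hn
  change _ = hSer (k + 1) at hS
  have h := map_stdT_stdDelta (subVar (k + 1)) (yv (Fin.last k)) F F
    (subVar_yv_castSucc _ _) (subVar_yv_last _) (subVar_addVar _ _)
  rw [subVar_swapV_addVar] at h
  have h1 := pair_eq_of_mul_eq _ _ _ _ _ S h
  have h2 := map_pair (addVar k).toRingHom (subVar k F) (hSer k)
  rw [hS'] at h2
  have h3 : PowerSeries.constantCoeff S = 1 := by
    have := congrArg PowerSeries.constantCoeff hS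
    rw [hSer, constantCoeff_expSeries] at this
    simpa using this
  have h4 : stdDelta k (stdDMinus k F) =
      yv (Fin.last k) * (addVar k).toRingHom (pair (subVar k F) (hSer k)) := by
    rw [stdDelta_apply, stdDMinus_eq]; rfl
  rw [h4, h2, stdDMinus_eq, ← hS, h1, h3, mul_one, sub_sub_cancel, mul_assoc]
  exact one_sub_tA_mul _

/-! #### The commutator `[d₊*, d₋]` -/

/-- The element `q y_1`. -/
def qy (k : ℕ) : VStd (k + 1) := qc • yv 0

lemma psi_qy (k : ℕ) : psi (k + 1) (qy k) = qc • yv 1 := by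
  rw [qy, map_smul, psi_yv]; rfl

lemma addVar_qy (k : ℕ) : addVar (k + 1) (qy k) = qy (k + 1) := by
  rw [qy, map_smul, addVar_yv]; rfl

lemma subVar_qy (k : ℕ) : subVar (k + 1) (qy (k + 1)) = Polynomial.C (qy k) := by
  have : (yv 0 : VStd (k + 2)) = yv (Fin.castSucc 0) := rfl
  rw [qy, map_smul, this, subVar_yv_castSucc, Polynomial.smul_C]; rfl

lemma subVar_psi (k : ℕ) (F : VStd (k + 1)) :
    subVar (k + 1) (psi (k + 1) F) = (subVar k F).map (psi k).toRingHom := by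
  have : (subVar (k + 1)).comp (psi (k + 1)) = (Polynomial.mapAlgHom (psi k)).comp (subVar k) := by
    apply vstd_algHom_ext
    · intro i
      rw [AlgHom.comp_apply, AlgHom.comp_apply, psi_yv]
      refine Fin.lastCases ?_ (fun i => ?_) i
      · rw [Fin.succ_last, subVar_yv_last, subVar_yv_last, mapAlgHom_X]
      · rw [Fin.succ_castSucc, subVar_yv_castSucc, subVar_yv_castSucc, mapAlgHom_C, psi_yv]
    · intro n hn
      rw [AlgHom.comp_apply, AlgHom.comp_apply, psi_pv _ hn, subVar_pv _ hn, map_add, map_smul,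
        map_pow, ← qy, subVar_qy, subVar_pv _ hn, map_add (Polynomial.mapAlgHom _), map_smul, map_pow, mapAlgHom_C,
        mapAlgHom_X, psi_pv _ hn, map_add, ← Polynomial.smul_C, Polynomial.C_pow]
      exact add_right_comm _ _ _
  exact DFunLike.congr_fun this F

/-- The substitution by which `[d₊*, d₋]` is expressed. -/
def sig (k : ℕ) : VStd (k + 1) →ₐ[Kqt] (VStd (k + 1))[X] := (subVar (k + 1)).comp (psi (k + 1))

lemma sig_apply (k : ℕ) (F : VStd (k + 1)) : sig k F = subVar (k + 1) (psi (k + 1) F) := rfl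

lemma psi_addVar (k : ℕ) (F : VStd k) :
    psi (k + 1) (addVar k F) = addVar (k + 1) (psi k F) := by
  have : (psi (k + 1)).comp (addVar k) = (addVar (k + 1)).comp (psi k) := by
    apply vstd_algHom_ext
    · intro i
      rw [AlgHom.comp_apply, AlgHom.comp_apply, addVar_yv, psi_yv, psi_yv, addVar_yv]; rfl
    · intro n hn
      rw [AlgHom.comp_apply, AlgHom.comp_apply, addVar_pv _ hn, psi_pv _ hn, map_add, map_add,
        map_smul, map_smul, map_pow, map_pow, psi_pv _ hn, addVar_pv _ hn, psi_yv, map_smul,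
        addVar_yv]
      exact add_right_comm _ _ _
  exact DFunLike.congr_fun this F

lemma sig_addVar (k : ℕ) (F : VStd k) : sig k (addVar k F) = Polynomial.C (psi k F) := by
  rw [sig_apply, psi_addVar, subVar_addVar]

lemma sig_psi (k : ℕ) (F : VStd (k + 1)) :
    sig (k + 1) (psi (k + 1) F) = (sig k F).map (psi (k + 1)).toRingHom := by
  rw [sig_apply, subVar_psi, sig_apply]

lemma sig_swapV_addVar (k : ℕ) (F : VStd (k + 1)) :
    sig (k + 1) (swapV (k + 1) (Fin.last k) (addVar (k + 1) F)) =
      (sig k F).map (addVar (k + 1)).toRingHom := by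
  rw [sig_apply, psi_swapV, psi_addVar, Fin.succ_last, subVar_swapV_addVar, sig_apply]

lemma pair_commutator {R : Type*} [CommRing R] (t W : R) (g : R[X]) (S : PowerSeries R) :
    pair g ((1 - PowerSeries.C (t * W) * PowerSeries.X) * S) -
      pair g ((1 - PowerSeries.C W * PowerSeries.X) * S) =
        (1 - t) * W * pair g (PowerSeries.X * S) := by
  rw [← pair_sub_right, ← pair_C_mul_right]
  congr 1
  simp only [map_mul, map_sub, map_one]
  ring

lemma map_psi_hSer (k : ℕ) {S : PowerSeries (VStd (k + 1))}
    (hS : (1 - PowerSeries.C (qy k) * PowerSeries.X) * S = hSer (k + 1)) :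
    (hSer k).map (psi k).toRingHom =
      (1 - PowerSeries.C (tA (VStd (k + 1)) * qy k) * PowerSeries.X) * S := by
  obtain ⟨S', h1, h2⟩ := exists_hSer_factor (psi k) _ (qy k) fun n hn => psi_pv k hn
  have : S' = S := mul_left_cancel₀ (one_sub_C_mul_X_ne_zero (qy k)) (h1.trans hS.symm)
  rw [h2, this]

lemma map_addVar_hSer (k : ℕ) {S : PowerSeries (VStd (k + 1))}
    (hS : (1 - PowerSeries.C (yv (Fin.last k)) * PowerSeries.X) * S = hSer (k + 1)) :
    (hSer k).map (addVar k).toRingHom =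
      (1 - PowerSeries.C (tA (VStd (k + 1)) * yv (Fin.last k)) * PowerSeries.X) * S := by
  obtain ⟨S', h1, h2⟩ := exists_hSer_factor (addVar k) _ (yv (Fin.last k)) fun n hn => addVar_pv k hn
  have : S' = S := mul_left_cancel₀ (one_sub_C_mul_X_ne_zero _) (h1.trans hS.symm)
  rw [h2, this]

lemma mul_left_cancel_one_sub_C_mul_X {R : Type*} [CommRing R] [IsDomain R] (a : R)
    {S S' : PowerSeries R} (h : (1 - PowerSeries.C a * PowerSeries.X) * S =
      (1 - PowerSeries.C a * PowerSeries.X) * S') : S = S' :=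
  mul_left_cancel₀ (one_sub_C_mul_X_ne_zero a) h

lemma map_one_sub_C_mul_X_mul {R R' : Type*} [CommRing R] [CommRing R'] (φ : R →+* R') (a : R)
    (S : PowerSeries R) : ((1 - PowerSeries.C a * PowerSeries.X) * S).map φ =
      (1 - PowerSeries.C (φ a) * PowerSeries.X) * S.map φ := by
  rw [map_mul, map_sub, map_one, map_mul, PowerSeries.map_C, PowerSeries.map_X]

/-- `Exp[-(X - (t - 1) u) w] = (1 - u w) (1 - t u w)⁻¹ Exp[-X w]`. -/
lemma map_subVar_hSer (k : ℕ) {S : PowerSeries (VStd k)[X]}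
    (hS : (1 - PowerSeries.C (Polynomial.C (tA (VStd k)) * Polynomial.X) * PowerSeries.X) * S =
      (hSer k).map Polynomial.C) :
    (hSer (k + 1)).map (subVar k).toRingHom =
      (1 - PowerSeries.C Polynomial.X * PowerSeries.X) * S := by
  have h1 := map_hSer (R := (VStd k)[X]) (Polynomial.CAlgHom : VStd k →ₐ[Kqt] (VStd k)[X])
  have h2 := expSeries_shift (fun n => subVar k (pv n)) (fun n => Polynomial.C (pv n : VStd k))
    (Polynomial.X : (VStd k)[X]) fun n hn => by
      rw [subVar_pv _ hn, add_assoc, ← add_smul, sub_add_sub_cancel, sub_self, zero_smul, add_zero]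
  have h3 : (hSer k).map Polynomial.C = expSeries fun n => -Polynomial.C (pv n : VStd k) := h1
  rw [← h3, ← hS, ← C_tA] at h2
  have h4 : (hSer (k + 1)).map (subVar k).toRingHom = expSeries fun n => -subVar k (pv n) :=
    map_hSer (R := (VStd k)[X]) (subVar k)
  rw [h4]
  apply mul_left_cancel_one_sub_C_mul_X (Polynomial.C (tA (VStd k)) * Polynomial.X : (VStd k)[X])
  refine h2.symm.trans ?_
  ring

/-- `[d₊*, d₋] F` as a single constant term: the two products differ in whether the shift
`X ↦ X + (t - 1) q y_1` is applied to `Exp[-X w]`. -/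
lemma stdCommStar_eq (k : ℕ) (F : VStd (k + 1)) {S : PowerSeries (VStd (k + 1))}
    (hS : (1 - PowerSeries.C (qy k) * PowerSeries.X) * S = hSer (k + 1)) :
    stdRep.commStar k F =
      (1 - tA (VStd (k + 1))) * qy k * pair (sig k F) (PowerSeries.X * S) := by
  have h1 : stdRep.commStar k F =
      (psi k).toRingHom (stdDMinus k F) - stdDMinus (k + 1) (psi (k + 1) F) := rfl
  rw [h1, stdDMinus_eq, stdDMinus_eq, map_pair, map_psi_hSer k hS, ← subVar_psi, ← hS, ← sig_apply]
  exact pair_commutator _ _ _ _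

lemma stdCommStar_stdDelta (k : ℕ) (v : VStd k) :
    stdRep.commStar k (stdDelta k v) = ((1 - tc) * qc) • (yv 0 * psi k v) := by
  obtain ⟨S, hS⟩ := exists_one_sub_mul_eq (qy k) (hSer (k + 1))
  have h3 : PowerSeries.constantCoeff S = 1 := by
    have := congrArg PowerSeries.constantCoeff hS
    rw [hSer, constantCoeff_expSeries] at this
    simpa using this
  have h4 : sig k (yv (Fin.last k)) = Polynomial.X := by
    rw [sig_apply, psi_yv, Fin.succ_last, subVar_yv_last]
  have h5 : sig k (stdDelta k v) = Polynomial.X * Polynomial.C (psi k v) := by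
    rw [stdDelta_apply, map_mul, h4, sig_addVar]
  rw [stdCommStar_eq k _ hS, h5, pair_X_mul_X_mul, pair_C, h3, mul_one, mul_assoc]
  refine (one_sub_tA_mul _).trans ?_
  rw [qy, smul_mul_assoc, smul_smul]

/-- Multiplication by a new variable exchanges with `[d₊*, d₋]`; this is what `d₊ z_i = z_{i+1} d₊`
amounts to. -/
lemma stdDelta_stdCommStar (k : ℕ) (v : VStd (k + 1)) :
    stdDelta (k + 1) (stdRep.commStar k v) =
      stdRep.commStar (k + 1) (stdT (k + 1) (Fin.last k) (stdDelta (k + 1) v)) := by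
  obtain ⟨S, hS⟩ := exists_one_sub_mul_eq (qy k) (hSer (k + 1))
  obtain ⟨S', hS'⟩ := exists_one_sub_mul_eq (qy (k + 1)) (hSer (k + 2))
  obtain ⟨S₀, hS₀⟩ := exists_one_sub_mul_eq (yv (Fin.last (k + 1))) S'
  have hSmap : S.map (addVar (k + 1)).toRingHom =
      (1 - PowerSeries.C (tA (VStd (k + 2)) * yv (Fin.last (k + 1))) * PowerSeries.X) * S₀ := by
    apply mul_left_cancel₀ (one_sub_C_mul_X_ne_zero (qy (k + 1)))
    have h1 := congrArg (PowerSeries.map (addVar (k + 1)).toRingHom) hS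
    have h2 : (1 - PowerSeries.C (yv (Fin.last (k + 1))) * PowerSeries.X) *
        ((1 - PowerSeries.C (qy (k + 1)) * PowerSeries.X) * S₀) = hSer (k + 2) := by
      rw [← hS', ← hS₀]; exact mul_left_comm _ _ _
    rw [map_addVar_hSer (k + 1) h2, map_mul, map_sub, map_one, map_mul, PowerSeries.map_C,
      PowerSeries.map_X] at h1
    have h3 : (addVar (k + 1)).toRingHom (qy k) = qy (k + 1) := addVar_qy k
    rw [h3] at h1
    refine h1.trans ?_
    exact mul_left_comm _ _ _
  have h := map_stdT_stdDelta (sig (k + 1)) (yv (Fin.last (k + 1))) (psi (k + 1) v) v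
    (by rw [sig_apply, psi_yv, Fin.succ_castSucc, subVar_yv_castSucc, Fin.succ_last])
    (by rw [sig_apply, psi_yv, Fin.succ_last, subVar_yv_last]) (sig_addVar _ _)
  rw [sig_swapV_addVar] at h
  have h1 := pair_eq_of_mul_eq _ _ _ _ _ (PowerSeries.X * S₀) h
  have e : PowerSeries.constantCoeff (PowerSeries.X * S₀) = 0 := by simp
  rw [e, mul_zero, sub_zero, mul_left_comm, hS₀] at h1
  rw [stdCommStar_eq (k + 1) _ hS', h1, stdCommStar_eq k _ hS, stdDelta_apply, map_mul, map_mul,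
    map_sub, map_one, map_tA, addVar_qy]
  have h2 : addVar (k + 1) (pair (sig k v) (PowerSeries.X * S)) =
      pair ((sig k v).map (addVar (k + 1)).toRingHom)
        ((1 - PowerSeries.C (tA (VStd (k + 2)) * yv (Fin.last (k + 1))) * PowerSeries.X) *
          (PowerSeries.X * S₀)) := by
    refine (map_pair (addVar (k + 1)).toRingHom _ _).trans ?_
    rw [map_mul, PowerSeries.map_X, hSmap, mul_left_comm]
  rw [h2]
  exact mul_left_comm _ _ _

/-- The relation `t [d₊*, d₋] d₊* = T_1 d₊* [d₊*, d₋]`. Both sides are combinations of the constant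
terms `P`, `Q` below, which are invariant under the exchange of `y_1` and `y_2`. -/
lemma stdCommStar_psi (k : ℕ) (v : VStd (k + 1)) :
    tc • stdRep.commStar (k + 1) (psi (k + 1) v) =
      stdT (k + 1) 0 (psi (k + 1) (stdRep.commStar k v)) := by
  obtain ⟨S, hS⟩ := exists_one_sub_mul_eq (qy k) (hSer (k + 1))
  obtain ⟨S', hS'⟩ := exists_one_sub_mul_eq (qy (k + 1)) (hSer (k + 2))
  have hT := stdT_hecke (k + 1) 0
  have hW1 : swapV (k + 1) 0 (qy (k + 1)) = qc • yv 1 := by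
    rw [qy, map_smul]
    exact congrArg (qc • ·) hT.map_a
  have hW2 : swapV (k + 1) 0 (qc • yv 1) = qy (k + 1) := by
    rw [qy, map_smul]
    exact congrArg (qc • ·) hT.map_b
  set W : VStd (k + 2) := qc • yv 1 with hW
  obtain ⟨S₀, hS₀⟩ := exists_one_sub_mul_eq W S'
  have hSmap : S.map (psi (k + 1)).toRingHom =
      (1 - PowerSeries.C (tA (VStd (k + 2)) * qy (k + 1)) * PowerSeries.X) * S₀ := by
    apply mul_left_cancel₀ (one_sub_C_mul_X_ne_zero W)
    have h1 := congrArg (PowerSeries.map (psi (k + 1)).toRingHom) hS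
    have h2 : (psi (k + 1)).toRingHom (qy k) = W := psi_qy k
    rw [map_psi_hSer (k + 1) hS', map_mul, map_sub, map_one, map_mul, PowerSeries.map_C,
      PowerSeries.map_X, h2] at h1
    rw [h1, ← hS₀]
    exact mul_left_comm _ _ _
  -- `S₀` is `Exp[-X w]` divided by the factors of `q y_1` and `q y_2`, hence symmetric in them
  have hinv : S₀.map (swapV (k + 1) 0).toRingHom = S₀ := by
    have h1 := congrArg (PowerSeries.map (swapV (k + 1) 0).toRingHom) hS'
    have e1 : (swapV (k + 1) 0).toRingHom (qy (k + 1)) = W := hW1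
    have e2 : (swapV (k + 1) 0).toRingHom W = qy (k + 1) := hW2
    rw [map_swapV_hSer, ← hS', ← hS₀] at h1
    simp only [map_mul, map_sub, map_one, PowerSeries.map_C, PowerSeries.map_X, e1, e2] at h1
    apply mul_left_cancel₀ (one_sub_C_mul_X_ne_zero W)
    apply mul_left_cancel₀ (one_sub_C_mul_X_ne_zero (qy (k + 1)))
    refine Eq.trans ?_ h1
    exact mul_left_comm _ _ _
  set g := sig (k + 1) (psi (k + 1) v) with hg
  have hginv : g.map (swapV (k + 1) 0).toRingHom = g := by
    rw [hg, sig_apply]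
    refine (map_swapV_subVar (k + 1) 0 _).trans ?_
    congr 1
    exact swapV_psi_psi (k + 1) _
  have hP : ∀ U : PowerSeries (VStd (k + 2)), U.map (swapV (k + 1) 0).toRingHom = U →
      swapV (k + 1) 0 (pair g U) = pair g U := by
    intro U hU
    refine (map_pair (swapV (k + 1) 0).toRingHom _ _).trans ?_
    rw [hginv, hU]
  have hP1 := hP (PowerSeries.X * S₀) (by rw [map_mul, PowerSeries.map_X, hinv])
  have hP2 := hP (PowerSeries.X * (PowerSeries.X * S₀))
    (by rw [map_mul, map_mul, PowerSeries.map_X, hinv])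
  have e1 : ∀ a : VStd (k + 2), pair g (PowerSeries.X * ((1 - PowerSeries.C a * PowerSeries.X) * S₀)) =
      pair g (PowerSeries.X * S₀) - a * pair g (PowerSeries.X * (PowerSeries.X * S₀)) := by
    intro a
    rw [← pair_C_mul_right, ← pair_sub_right]
    congr 1
    ring
  set P := pair g (PowerSeries.X * S₀)
  set Q := pair g (PowerSeries.X * (PowerSeries.X * S₀))
  have hR : psi (k + 1) (stdRep.commStar k v) =
      (1 - tA (VStd (k + 2))) * W * (P - tA (VStd (k + 2)) * qy (k + 1) * Q) := by
    rw [stdCommStar_eq k _ hS, map_mul, map_mul, map_sub, map_one, map_tA, psi_qy, ← e1, ← hSmap]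
    congr 1
    refine (map_pair (psi (k + 1)).toRingHom _ _).trans ?_
    rw [map_mul, PowerSeries.map_X, hg, sig_psi]
  have hL : tc • stdRep.commStar (k + 1) (psi (k + 1) v) =
      tA (VStd (k + 2)) * ((1 - tA (VStd (k + 2))) * qy (k + 1) * (P - W * Q)) := by
    rw [stdCommStar_eq (k + 1) _ hS', ← hS₀, e1, tA_mul]
  rw [hL, hR]
  symm
  apply hT.eq_of
  have e2 : ∀ x, (swapV (k + 1) 0).toRingHom x = swapV (k + 1) 0 x := fun _ => rfl
  rw [e2, map_mul, map_mul, map_sub, map_sub, map_one, map_mul, map_mul, map_tA, hP1, hP2, hW1, hW2]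
  have e3 : qy (k + 1) = algebraMap Kqt (VStd (k + 2)) qc * yv (Fin.castSucc 0) :=
    Algebra.smul_def qc (yv 0 : VStd (k + 2))
  have e4 : W = algebraMap Kqt (VStd (k + 2)) qc * yv (Fin.succ 0) :=
    Algebra.smul_def qc (yv 1 : VStd (k + 2))
  rw [e3, e4]
  ring

/-! #### Two lowering operators -/

/-- The two-variable version of `subVar`: the last variable becomes the outer one, the one before it
the inner one. -/
def subVar₂ (k : ℕ) : VStd (k + 2) →ₐ[Kqt] (VStd k)[X][X] :=
  (Polynomial.mapAlgHom (subVar k)).comp (subVar (k + 1))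

lemma subVar₂_apply (k : ℕ) (F : VStd (k + 2)) :
    subVar₂ k F = (subVar (k + 1) F).map (subVar k).toRingHom := rfl

lemma subVar₂_yv_castSucc (k : ℕ) (i : Fin (k + 1)) :
    subVar₂ k (yv i.castSucc) = Polynomial.C (subVar k (yv i)) := by
  rw [subVar₂, AlgHom.comp_apply, subVar_yv_castSucc, mapAlgHom_C]

lemma subVar₂_yv_last (k : ℕ) : subVar₂ k (yv (Fin.last (k + 1))) = Polynomial.X := by
  rw [subVar₂, AlgHom.comp_apply, subVar_yv_last, mapAlgHom_X]

lemma subVar₂_pv (k : ℕ) {n : ℕ} (hn : n ≠ 0) :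
    subVar₂ k (pv n) = Polynomial.C (Polynomial.C (pv n)) +
      (1 - tc ^ n) • Polynomial.C Polynomial.X ^ n + (1 - tc ^ n) • Polynomial.X ^ n := by
  rw [subVar₂, AlgHom.comp_apply, subVar_pv _ hn, map_add (Polynomial.mapAlgHom _), mapAlgHom_C,
    map_smul, map_pow, mapAlgHom_X, subVar_pv _ hn, Polynomial.C_add, ← Polynomial.smul_C,
    Polynomial.C_pow]

lemma bivariate_swap_psum {R : Type*} [CommRing R] [Algebra Kqt R] (a : R) (c : Kqt) (n : ℕ) :
    Polynomial.Bivariate.swap (R := R) (Polynomial.C (Polynomial.C a) +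
      c • Polynomial.C Polynomial.X ^ n + c • Polynomial.X ^ n) =
    Polynomial.C (Polynomial.C a) +
      c • Polynomial.C Polynomial.X ^ n + c • Polynomial.X ^ n := by
  have h (x : R[X][X]) : Polynomial.Bivariate.swap (R := R) (c • x) =
      c • Polynomial.Bivariate.swap (R := R) x :=
    map_smul ((Polynomial.Bivariate.swap (R := R)).restrictScalars Kqt) c x
  rw [map_add, map_add, h, h, map_pow, map_pow, Polynomial.Bivariate.swap_C_C,
    Polynomial.Bivariate.swap_X, Polynomial.Bivariate.swap_Y, add_right_comm]

lemma subVar₂_swapV (k : ℕ) (F : VStd (k + 2)) :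
    subVar₂ k (swapV (k + 1) (Fin.last k) F) =
      Polynomial.Bivariate.swap (R := VStd k) (subVar₂ k F) := by
  have : (subVar₂ k).comp (swapV (k + 1) (Fin.last k)) =
      (((Polynomial.Bivariate.swap (R := VStd k)).toAlgHom).restrictScalars Kqt).comp (subVar₂ k) := by
    apply vstd_algHom_ext
    · intro i
      rw [AlgHom.comp_apply, AlgHom.comp_apply]
      change _ = Polynomial.Bivariate.swap (R := VStd k) _
      refine Fin.lastCases ?_ (fun i => ?_) i
      · rw [← Fin.succ_last, swapV_yv, Equiv.swap_apply_right, subVar₂_yv_castSucc, subVar_yv_last,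
          Fin.succ_last, subVar₂_yv_last]
        exact (Polynomial.Bivariate.swap_Y).symm
      · refine Fin.lastCases ?_ (fun i => ?_) i
        · rw [swapV_yv, Equiv.swap_apply_left, Fin.succ_last, subVar₂_yv_last, subVar₂_yv_castSucc,
            subVar_yv_last]
          exact (Polynomial.Bivariate.swap_X).symm
        · rw [swapV_yv_of_ne, subVar₂_yv_castSucc, subVar_yv_castSucc]
          · exact (Polynomial.Bivariate.swap_C_C _).symm
          · simp; omega
          · simp; omega
    · intro n hn
      rw [AlgHom.comp_apply, AlgHom.comp_apply, swapV_pv, subVar₂_pv _ hn]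
      change _ = Polynomial.Bivariate.swap (R := VStd k) _
      exact (bivariate_swap_psum _ _ _).symm
  exact DFunLike.congr_fun this F

lemma stdDMinus_stdDMinus (k : ℕ) (F : VStd (k + 2)) {S : PowerSeries (VStd k)[X]}
    (hS : (1 - PowerSeries.C (Polynomial.C (tA (VStd k)) * Polynomial.X) * PowerSeries.X) * S =
      (hSer k).map Polynomial.C) :
    stdDMinus k (stdDMinus (k + 1) F) =
      pair (pair (subVar₂ k F) ((1 - PowerSeries.C Polynomial.X * PowerSeries.X) * S)) (hSer k) := by
  rw [stdDMinus_eq, stdDMinus_eq, ← map_subVar_hSer k hS, subVar₂_apply]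
  congr 1
  exact map_pair (R' := (VStd k)[X]) (subVar k).toRingHom _ _

lemma subVar₂_stdT (k : ℕ) (F : VStd (k + 2)) :
    IsBivariateT (tA (VStd k)) (subVar₂ k (stdT (k + 1) (Fin.last k) F)) (subVar₂ k F) :=
  (stdT_hecke (k + 1) (Fin.last k)).map_bivariate (R := VStd k) (subVar₂ k).toRingHom
    (t' := tA (VStd k)) ((subVar₂_yv_castSucc k _).trans (by rw [subVar_yv_last]))
    ((congrArg (fun i => subVar₂ k (yv i)) (Fin.succ_last _)).trans (subVar₂_yv_last k))
    ((subVar₂ k).commutes tc) (subVar₂_swapV k) F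

lemma stdDMinus_stdDMinus_stdT (k : ℕ) (F : VStd (k + 2)) :
    stdDMinus k (stdDMinus (k + 1) (stdT (k + 1) (Fin.last k) F)) =
      stdDMinus k (stdDMinus (k + 1) F) := by
  obtain ⟨S, hS⟩ := exists_one_sub_mul_eq (Polynomial.C (tA (VStd k)) * Polynomial.X)
    ((hSer k).map Polynomial.C)
  rw [stdDMinus_stdDMinus k _ hS, stdDMinus_stdDMinus k _ hS]
  exact pair_pair_T_eq (tA (VStd k)) (subVar₂_stdT k F) hS

/-- The relation `t d₋ [d₊*, d₋] = [d₊*, d₋] d₋ T`. -/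
lemma stdDMinus_stdCommStar (k : ℕ) (F : VStd (k + 2)) :
    tc • stdDMinus (k + 1) (stdRep.commStar (k + 1) F) =
      stdRep.commStar k (stdDMinus (k + 1) (stdT (k + 1) (Fin.last k) F)) := by
  obtain ⟨S, hS⟩ := exists_one_sub_mul_eq (qy k) (hSer (k + 1))
  obtain ⟨S', hS'⟩ := exists_one_sub_mul_eq (qy (k + 1)) (hSer (k + 2))
  obtain ⟨S₀, hS₀⟩ := exists_one_sub_mul_eq (Polynomial.C (tA (VStd (k + 1))) * Polynomial.X)
    (S.map Polynomial.C)
  -- `Exp[-X w]` and its quotients after the substitution `subVar`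
  have hH : (1 - PowerSeries.C (Polynomial.C (tA (VStd (k + 1))) * Polynomial.X) * PowerSeries.X) *
      ((1 - PowerSeries.C (Polynomial.C (qy k)) * PowerSeries.X) * S₀) =
        (hSer (k + 1)).map Polynomial.C := by
    rw [← hS]
    refine Eq.trans ?_ (map_one_sub_C_mul_X_mul (R' := (VStd (k + 1))[X]) Polynomial.C _ _).symm
    refine Eq.trans ?_ (congrArg _ hS₀)
    ring
  have hH' := map_subVar_hSer (k + 1) hH
  have hS'map : S'.map (subVar (k + 1)).toRingHom =
      (1 - PowerSeries.C Polynomial.X * PowerSeries.X) * S₀ := by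
    have h1 := congrArg (PowerSeries.map (subVar (k + 1)).toRingHom) hS'
    rw [hH'] at h1
    have h2 := (map_one_sub_C_mul_X_mul (R' := (VStd (k + 1))[X]) (subVar (k + 1)).toRingHom
      (qy (k + 1)) S').symm.trans h1
    have h3 : (subVar (k + 1)).toRingHom (qy (k + 1)) = Polynomial.C (qy k) := subVar_qy k
    rw [h3] at h2
    apply mul_left_cancel_one_sub_C_mul_X (Polynomial.C (qy k))
    refine h2.trans ?_
    ring
  have hpsi : (hSer (k + 1)).map (sig k).toRingHom =
      (1 - PowerSeries.C Polynomial.X * PowerSeries.X) *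
        ((1 - PowerSeries.C (Polynomial.C (tA (VStd (k + 1)) * qy k)) * PowerSeries.X) * S₀) := by
    have h1 : (hSer (k + 1)).map (sig k).toRingHom =
        ((hSer (k + 1)).map (psi (k + 1)).toRingHom).map (subVar (k + 1)).toRingHom := rfl
    rw [h1, map_psi_hSer (k + 1) hS']
    refine (map_one_sub_C_mul_X_mul (R' := (VStd (k + 1))[X]) (subVar (k + 1)).toRingHom _ _).trans
      ?_
    have h3 : (subVar (k + 1)).toRingHom (tA (VStd (k + 2)) * qy (k + 1)) =
        Polynomial.C (tA (VStd (k + 1)) * qy k) := by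
      change subVar (k + 1) _ = _
      rw [map_mul, subVar_qy, (subVar (k + 1)).commutes, Polynomial.C_mul]
      rfl
    rw [h3, hS'map]
    ring
  have hL : stdDMinus (k + 1) (stdRep.commStar (k + 1) F) =
      (1 - tA (VStd (k + 1))) * qy k * pair (pair (subVar₂ (k + 1) (psi (k + 2) F))
        (PowerSeries.X * (1 - PowerSeries.C Polynomial.X * PowerSeries.X) * S₀)) (hSer (k + 1)) := by
    have h3 : subVar (k + 1) ((1 - tA (VStd (k + 2))) * qy (k + 1)) =
        Polynomial.C ((1 - tA (VStd (k + 1))) * qy k) := by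
      rw [one_sub_tA_mul, one_sub_tA_mul, map_smul, subVar_qy, Polynomial.smul_C]
    rw [stdCommStar_eq (k + 1) F hS', stdDMinus_eq, map_mul, h3, pair_C_mul, subVar₂_apply, ← sig_apply]
    congr 2
    refine (map_pair (R' := (VStd (k + 1))[X]) (subVar (k + 1)).toRingHom _ _).trans ?_
    congr 1
    refine (map_mul _ _ _).trans ?_
    rw [hS'map, PowerSeries.map_X]
    ring
  have hR (G : VStd (k + 2)) : stdRep.commStar k (stdDMinus (k + 1) G) =
      (1 - tA (VStd (k + 1))) * qy k * pair (pair (subVar₂ (k + 1) (psi (k + 2) G))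
        ((1 - PowerSeries.C Polynomial.X * PowerSeries.X) *
          ((1 - PowerSeries.C (Polynomial.C (tA (VStd (k + 1)) * qy k)) * PowerSeries.X) * S₀)))
            (PowerSeries.X * S) := by
    rw [stdCommStar_eq k _ hS, stdDMinus_eq, ← hpsi, subVar₂_apply, subVar_psi, Polynomial.map_map]
    congr 2
    exact map_pair (R' := (VStd (k + 1))[X]) (sig k).toRingHom _ _
  have h := pair_pair_T_eq_mul (tA (VStd (k + 1))) (qy k)
    (subVar₂_stdT (k + 1) (psi (k + 2) F)) hS₀
  rw [hS] at h
  rw [hL, hR, psi_stdT, Fin.succ_last, ← h]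
  refine (tA_mul (A := VStd (k + 1)) _).symm.trans ?_
  exact mul_left_comm _ _ _

/-- The standard representation is a representation of the double Dyck path algebra. -/
theorem stdRep_isDDPARep : stdRep.IsDDPARep := by
  refine QuiverRep.CoreRelations.isDDPARep (M := stdRep)
    (Y := fun k i => LinearMap.mulLeft Kqt (yv i)) (δ := stdDelta) ?_
  exact
  { T_comm := stdT_comm
    T_braid := stdT_braid
    T_quadratic := stdT_quadratic
    dMinus_sq_T := stdDMinus_stdDMinus_stdT
    T_dMinus := stdT_stdDMinus
    dPlus_eq := fun k v => rfl
    δ_T := stdDelta_stdT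
    T_δ_δ := stdT_stdDelta_stdDelta
    T_dPlusStar_sq := stdT_psi_psi
    dPlusStar_T := psi_stdT
    dMinus_commStar := stdDMinus_stdCommStar
    commStar_dPlusStar := stdCommStar_psi
    T_Y_T := fun k i => LinearMap.ext fun v =>
      ((stdT_hecke k i).T_mul_T v).trans ((mul_assoc _ _ _).trans (tA_mul _))
    Y_T := fun k i hi v => by
      symm
      apply (stdT_hecke k i).mul_of_fixed
      apply swapV_yv_of_ne
      · simpa using hi.symm
      · simp
    comm_δ := stdDelta_stdDMinus_sub
    Y_dMinus := fun k i v => (stdDMinus_yv_mul (k + 1) i v).symm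
    Y_δ := fun k v => by
      change yv 0 * stdDelta (k + 1) v = stdDelta (k + 1) (yv 0 * v)
      rw [stdDelta_apply, stdDelta_apply, map_mul, addVar_yv]
      exact mul_left_comm _ _ _
    dPlusStar_Y := fun k i v => by
      change psi (k + 1) (yv i * v) = yv i.succ * psi (k + 1) v
      rw [map_mul, psi_yv]
    δ_commStar := stdDelta_stdCommStar
    commStar_δ := stdCommStar_stdDelta }

/-! ### Partial fractions -/

section PartialFractions

universe u

variable {ι : Type*} [DecidableEq ι] {L : Type u} [Field L]

/-- The residues of `∏ (1 - t x_i w) / (1 - x_i w)`. -/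
def pfCoeff (t : L) (x : ι → L) (s : Finset ι) (i : ι) : L :=
  (1 - t) * ∏ j ∈ s.erase i, (x i - t * x j) / (x i - x j)

/-- The partial fraction expansion of `∏ (1 - t x_i w) / (1 - x_i w)`, where `(1 - x_i w)⁻¹` is
replaced by any elements `g i` of an algebra that multiply in the same way. -/
lemma prod_partialFractions (t : L) (x : ι → L) (hx : Function.Injective x) (s : Finset ι)
    {A : Type u} [CommRing A] [Algebra L A] (g : ι → A)
    (hg : ∀ i ∈ s, ∀ j ∈ s, i ≠ j →
      g i * g j = (x i / (x i - x j)) • g i - (x j / (x i - x j)) • g j) :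
    ∏ i ∈ s, (t • 1 + (1 - t) • g i) = t ^ s.card • 1 + ∑ i ∈ s, pfCoeff t x s i • g i := by
  induction s using Finset.induction_on generalizing A with
  | empty => simp
  | insert a s ha ih =>
    have hne : ∀ i ∈ s, x a - x i ≠ 0 := fun i hi h => ha (hx (sub_eq_zero.1 h) ▸ hi)
    -- the case of the values at `w = x_a⁻¹`
    have h1 := ih (A := L) (fun i => x a / (x a - x i)) fun i hi j hj hij => by
      have h2 := hne i hi
      have h3 := hne j hj
      have h4 : x i - x j ≠ 0 := fun h => hij (hx (sub_eq_zero.1 h))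
      simp only [smul_eq_mul]
      field_simp
      ring
    have h2 : ∏ i ∈ s, (t • 1 + (1 - t) • (x a / (x a - x i))) =
        ∏ j ∈ s, (x a - t * x j) / (x a - x j) := by
      refine Finset.prod_congr rfl fun i hi => ?_
      have := hne i hi
      simp only [smul_eq_mul]
      field_simp
      ring
    have h3 : pfCoeff t x (insert a s) a =
        (1 - t) * (t ^ s.card + ∑ i ∈ s, pfCoeff t x s i * (x a / (x a - x i))) := by
      rw [pfCoeff, Finset.erase_insert ha, ← h2, h1]
      simp only [smul_eq_mul, mul_one]
    have h4 : ∀ i ∈ s, pfCoeff t x (insert a s) i =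
        pfCoeff t x s i * ((x i - t * x a) / (x i - x a)) := by
      intro i hi
      have hia : i ≠ a := fun h => ha (h ▸ hi)
      rw [pfCoeff, Finset.erase_insert_of_ne hia.symm, Finset.prod_insert
        (fun h => ha (Finset.mem_of_mem_erase h)), pfCoeff]
      ring
    rw [Finset.prod_insert ha, Finset.sum_insert ha, Finset.card_insert_of_notMem ha,
      ih g fun i hi j hj => hg i (Finset.mem_insert_of_mem hi) j (Finset.mem_insert_of_mem hj), h3,
      mul_add, Finset.mul_sum]
    have h5 : ∀ i ∈ s, (t • 1 + (1 - t) • g a) * pfCoeff t x s i • g i =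
        ((1 - t) * (pfCoeff t x s i * (x a / (x a - x i)))) • g a +
          pfCoeff t x (insert a s) i • g i := by
      intro i hi
      have h6 := hne i hi
      have h7 : x i - x a ≠ 0 := by rw [← neg_sub]; exact neg_ne_zero.2 h6
      have h8 := hg a (Finset.mem_insert_self _ _) i (Finset.mem_insert_of_mem hi)
        fun h => ha (h ▸ hi)
      have h9 : (t • 1 + (1 - t) • g a) * pfCoeff t x s i • g i =
          (t * pfCoeff t x s i) • g i + ((1 - t) * pfCoeff t x s i) • (g a * g i) := by
        rw [add_mul, smul_mul_smul_comm, smul_mul_smul_comm, one_mul]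
      rw [h9, h8, h4 i hi]
      have e : t - (1 - t) * (x i / (x a - x i)) = (x i - t * x a) / (x i - x a) := by
        rw [← neg_sub (x a) (x i), div_neg]
        field_simp
        ring
      rw [← e]
      module
    rw [Finset.sum_congr rfl h5, Finset.sum_add_distrib, ← Finset.sum_smul, ← Finset.mul_sum,
      ← add_assoc, ← add_assoc]
    congr 1
    rw [add_mul, smul_mul_smul_comm, smul_mul_smul_comm, one_mul, mul_one, pow_succ]
    module

end PartialFractions

/-! ### The vertex operator -/

/-- `F[X - u]`, as a polynomial in `u`. -/
def symSub : SymFun →ₐ[Kqt] SymFun[X] :=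
  pleth (R := SymFun[X]) fun m => Polynomial.C (psum m) - Polynomial.X ^ m

/-- The series `Exp[(1 - t) X w]`. -/
def hlSer : PowerSeries SymFun := expSeries fun m => (1 - tc ^ m) • psum m

/-- The coefficients of the vertex operator of Hall–Littlewood functions:
`F ↦ ct_u (u^n F[X - u] Exp[(1 - t) X u⁻¹])`. -/
def vertexOp (n : ℕ) (F : SymFun) : SymFun := pair (Polynomial.X ^ n * symSub F) hlSer

lemma symSub_psum {m : ℕ} (hm : m ≠ 0) :
    symSub (psum m) = Polynomial.C (psum m) - Polynomial.X ^ m :=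
  pleth_psum (R := SymFun[X]) _ hm

lemma symSub_psum_add {m : ℕ} (hm : m ≠ 0) :
    symSub (psum m) = Polynomial.C (psum m) + (-1 : Kqt) • Polynomial.X ^ m := by
  rw [symSub_psum hm]
  have (A : Type) [CommRing A] [Module Kqt A] (a b : A) : a - b = a + (-1 : Kqt) • b := by
    rw [neg_smul, one_smul, sub_eq_add_neg]
  exact this SymFun[X] _ _

/-- The recursion that defines the operators `ℬ_n` from `ℬ_0`. -/
lemma vertexOp_succ (n : ℕ) (F : SymFun) :
    vertexOp (n + 1) F = psum 1 * vertexOp n F - vertexOp n (psum 1 * F) := by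
  rw [vertexOp, vertexOp, vertexOp, ← pair_C_mul, ← pair_sub_left, map_mul,
    symSub_psum one_ne_zero]
  congr 1
  ring

/-- The geometric series `(1 - a w)⁻¹`. -/
def geomSeries {R : Type*} [CommRing R] (a : R) : PowerSeries R := PowerSeries.mk fun n => a ^ n

lemma one_sub_mul_geomSeries {R : Type*} [CommRing R] (a : R) :
    (1 - PowerSeries.C a * PowerSeries.X) * geomSeries a = 1 := by
  ext n
  cases n with
  | zero => simp [geomSeries]
  | succ n =>
    rw [sub_mul, one_mul, mul_assoc, map_sub, PowerSeries.coeff_C_mul, PowerSeries.coeff_succ_X_mul,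
      geomSeries, PowerSeries.coeff_mk, PowerSeries.coeff_mk, PowerSeries.coeff_one,
      if_neg (Nat.succ_ne_zero n), pow_succ']
    ring

lemma pair_geomSeries {R : Type*} [CommRing R] (a : R) (g : R[X]) :
    pair g (geomSeries a) = g.eval a := by
  rw [Polynomial.eval_eq_sum, pair]
  simp only [geomSeries, PowerSeries.coeff_mk]

lemma pair_one {R : Type*} [CommRing R] (g : R[X]) : pair g 1 = g.eval 0 := by
  rw [← pair_geomSeries]
  congr 1
  have := one_sub_mul_geomSeries (0 : R)
  rw [map_zero, zero_mul, sub_zero, one_mul] at this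
  exact this.symm

lemma pair_sum_right {R ι : Type*} [CommRing R] (g : R[X]) (s : Finset ι) (S : ι → PowerSeries R) :
    pair g (∑ i ∈ s, S i) = ∑ i ∈ s, pair g (S i) := by
  classical
  induction s using Finset.induction_on with
  | empty =>
    rw [Finset.sum_empty, Finset.sum_empty]
    simpa using pair_C_mul_right 0 g 0
  | insert a s ha ih => rw [Finset.sum_insert ha, Finset.sum_insert ha, pair_add_right, ih]

lemma expSeries_sum {R : Type} [CommRing R] [Algebra Kqt R] {ι : Type*} (s : Finset ι)
    (a : ι → ℕ → R) : expSeries (fun m => ∑ i ∈ s, a i m) = ∏ i ∈ s, expSeries (a i) := by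
  classical
  induction s using Finset.induction_on with
  | empty =>
    simp only [Finset.sum_empty, Finset.prod_empty]
    symm
    apply eq_expSeries
    · simp
    · have : PowerSeries.mk (fun _ => (0 : R)) = 0 := by ext; simp
      rw [this, zero_mul]
      exact (PowerSeries.derivative R).map_one_eq_zero
  | insert i s hi ih =>
    simp only [Finset.sum_insert hi]
    rw [Finset.prod_insert hi, expSeries_add, ih]

lemma expSeries_sub_pow {R : Type} [CommRing R] [IsDomain R] [Algebra Kqt R] (a : R) :
    expSeries (fun m => (1 - tc ^ m) • a ^ m) =
      (1 - PowerSeries.C (tA R * a) * PowerSeries.X) * geomSeries a := by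
  have h : (1 - PowerSeries.C a * PowerSeries.X) * expSeries (fun m => (1 - tc ^ m) • a ^ m) =
      1 - PowerSeries.C (tA R * a) * PowerSeries.X := by
    rw [← expSeries_neg_pow, ← expSeries_neg_pow, ← expSeries_add]
    apply expSeries_congr
    intro n _
    rw [sub_smul, one_smul, mul_pow, Algebra.smul_def, map_pow]
    ring
  rw [← h, mul_right_comm, one_sub_mul_geomSeries, one_mul]

section Restriction

variable {n : ℕ} {L : Type} [Field L] [Algebra Kqt L]

/-- In `n + 1` variables, `F[X - x_i]` is `F` in the variables other than `x_i`. -/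
lemma eval_map_symSub (n : ℕ) (F : SymFun) (i : Fin (n + 1)) :
    ((symSub F).map (res (n + 1)).toRingHom).eval (MvPolynomial.X i) =
      MvPolynomial.rename i.succAbove (res n F) := by
  have : ((Polynomial.aeval (R := MvPolynomial (Fin (n + 1)) Kqt)
      (MvPolynomial.X i : MvPolynomial (Fin (n + 1)) Kqt)).restrictScalars Kqt).comp
        ((Polynomial.mapAlgHom (res (n + 1))).comp symSub) =
      (MvPolynomial.rename i.succAbove).comp (res n) := by
    apply symFun_algHom_ext
    intro m hm
    simp only [AlgHom.comp_apply, AlgHom.restrictScalars_apply]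
    rw [symSub_psum_add hm, res_psum _ hm, map_add (Polynomial.mapAlgHom _), map_smul, map_pow,
      mapAlgHom_C, mapAlgHom_X, neg_smul, one_smul, map_add, map_neg, map_pow,
      Polynomial.aeval_X, Polynomial.aeval_C, res_psum _ hm, MvPolynomial.psum, MvPolynomial.psum,
      Fin.sum_univ_succAbove _ i, map_sum]
    simp
  exact DFunLike.congr_fun this F

lemma eval_zero_map_symSub (n : ℕ) (F : SymFun) :
    ((symSub F).map (res n).toRingHom).eval 0 = res n F := by
  have : ((Polynomial.aeval (R := MvPolynomial (Fin n) Kqt)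
      (0 : MvPolynomial (Fin n) Kqt)).restrictScalars Kqt).comp
        ((Polynomial.mapAlgHom (res n)).comp symSub) = res n := by
    apply symFun_algHom_ext
    intro m hm
    simp only [AlgHom.comp_apply, AlgHom.restrictScalars_apply]
    rw [symSub_psum_add hm, map_add (Polynomial.mapAlgHom _), map_smul, map_pow, mapAlgHom_C,
      mapAlgHom_X, neg_smul, one_smul, map_add, map_neg, map_pow, Polynomial.aeval_X,
      Polynomial.aeval_C, zero_pow hm, neg_zero, add_zero]
    rfl
  exact DFunLike.congr_fun this F

lemma map_hlSer (n : ℕ) (φ : MvPolynomial (Fin n) Kqt →ₐ[Kqt] L) :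
    hlSer.map (φ.comp (res n)).toRingHom =
      ∏ i : Fin n, ((1 - PowerSeries.C (tA L * φ (MvPolynomial.X i)) * PowerSeries.X) *
        geomSeries (φ (MvPolynomial.X i))) := by
  rw [hlSer, map_expSeries]
  simp only [← expSeries_sub_pow]
  rw [← expSeries_sum]
  apply expSeries_congr
  intro m hm
  rw [map_smul, AlgHom.comp_apply, res_psum _ hm, MvPolynomial.psum, map_sum, Finset.smul_sum]
  simp only [map_pow]

/-- The vertex operator in finitely many variables. -/
lemma algHom_res_vertexOp (n : ℕ) (φ : MvPolynomial (Fin (n + 1)) Kqt →ₐ[Kqt] L)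
    (hφ : Function.Injective fun i => φ (MvPolynomial.X i)) (F : SymFun) :
    φ (res (n + 1) (vertexOp 0 F)) = tA L ^ (n + 1) * φ (res (n + 1) F) +
      ∑ i, pfCoeff (tA L) (fun i => φ (MvPolynomial.X i)) Finset.univ i *
        φ (MvPolynomial.rename i.succAbove (res n F)) := by
  set x : Fin (n + 1) → L := fun i => φ (MvPolynomial.X i) with hx
  have h1 : φ (res (n + 1) (vertexOp 0 F)) =
      pair (((symSub F).map (res (n + 1)).toRingHom).map φ.toRingHom)
        (hlSer.map (φ.comp (res (n + 1))).toRingHom) := by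
    rw [vertexOp, pow_zero, one_mul, Polynomial.map_map]
    exact map_pair (φ.comp (res (n + 1))).toRingHom _ _
  have h2 : ∀ i, (1 - PowerSeries.C (tA L * x i) * PowerSeries.X) * geomSeries (x i) =
      tA L • 1 + (1 - tA L) • geomSeries (x i) := by
    intro i
    have := one_sub_mul_geomSeries (x i)
    rw [PowerSeries.smul_eq_C_mul, PowerSeries.smul_eq_C_mul, map_mul, map_sub, map_one]
    linear_combination PowerSeries.C (tA L) * this
  have h3 : hlSer.map (φ.comp (res (n + 1))).toRingHom =
      tA L ^ (n + 1) • 1 + ∑ i, pfCoeff (tA L) x Finset.univ i • geomSeries (x i) := by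
    rw [map_hlSer, Finset.prod_congr rfl fun i _ => h2 i,
      prod_partialFractions (tA L) x hφ Finset.univ, Finset.card_univ, Fintype.card_fin]
    intro i _ j _ hij
    have hne : x i - x j ≠ 0 := fun h => hij (hφ (sub_eq_zero.1 h))
    have e1 := one_sub_mul_geomSeries (x i)
    have e2 := one_sub_mul_geomSeries (x j)
    have e3 : (x i - x j) • (geomSeries (x i) * geomSeries (x j)) =
        x i • geomSeries (x i) - x j • geomSeries (x j) := by
      simp only [PowerSeries.smul_eq_C_mul, map_sub]
      linear_combination PowerSeries.C (x i) * geomSeries (x i) * e2 -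
        PowerSeries.C (x j) * geomSeries (x j) * e1
    rw [← inv_smul_smul₀ hne (geomSeries (x i) * geomSeries (x j)), e3, smul_sub, smul_smul,
      smul_smul, div_eq_inv_mul, div_eq_inv_mul]
  have h4 : ∀ (c : L) (g : L[X]) (S : PowerSeries L), pair g (c • S) = c * pair g S := fun c g S => by
    rw [PowerSeries.smul_eq_C_mul, pair_C_mul_right]
  have h5 : ∀ i, (((symSub F).map (res (n + 1)).toRingHom).map φ.toRingHom).eval (x i) =
      φ (MvPolynomial.rename i.succAbove (res n F)) := by
    intro i
    rw [← eval_map_symSub]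
    exact Polynomial.eval_map_apply _ _
  have h6 : (((symSub F).map (res (n + 1)).toRingHom).map φ.toRingHom).eval 0 =
      φ (res (n + 1) F) := by
    rw [← eval_zero_map_symSub, ← map_zero φ.toRingHom]
    exact Polynomial.eval_map_apply _ _
  rw [h1, h3, pair_add_right, pair_sum_right, h4, pair_one, h6]
  simp only [h4, pair_geomSeries, h5]

lemma res_zero_vertexOp (F : SymFun) : res 0 (vertexOp 0 F) = res 0 F := by
  have h1 : hlSer.map (res 0).toRingHom = 1 := by
    rw [hlSer, map_expSeries]
    have := expSeries_sum (R := MvPolynomial (Fin 0) Kqt) (∅ : Finset (Fin 0)) (fun _ _ => 0)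
    simp only [Finset.sum_empty, Finset.prod_empty] at this
    rw [← this]
    apply expSeries_congr
    intro m hm
    rw [map_smul, res_psum _ hm, MvPolynomial.psum, Finset.univ_eq_empty, Finset.sum_empty,
      smul_zero]
  rw [vertexOp, pow_zero, one_mul]
  refine (map_pair (res 0).toRingHom _ _).trans ?_
  rw [h1, pair_one, eval_zero_map_symSub]

end Restriction

/-! ### Antisymmetrized products -/

section Vandermonde

variable {R : Type*} [CommRing R]

/-- `∏_{i < j} (v_i - v_j)`. -/
def vdm {n : ℕ} (v : Fin n → R) : R := ∏ i, ∏ j ∈ Finset.Ioi i, (v i - v j)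

lemma vdm_comp_perm {n : ℕ} (v : Fin n → R) (σ : Equiv.Perm (Fin n)) :
    vdm (v ∘ σ) = ((Equiv.Perm.sign σ : ℤ) : R) * vdm v := by
  have h (w : Fin n → R) : vdm w = (Matrix.vandermonde fun i => -w i).det := by
    rw [Matrix.det_vandermonde, vdm]
    refine Finset.prod_congr rfl fun i _ => Finset.prod_congr rfl fun j _ => ?_
    ring
  rw [h, h]
  exact Matrix.det_permute σ (Matrix.vandermonde fun i => -v i)

lemma vdm_succ {n : ℕ} (v : Fin (n + 1) → R) :
    vdm v = (∏ j : Fin n, (v 0 - v j.succ)) * vdm fun i : Fin n => v i.succ := by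
  rw [vdm, Fin.prod_univ_succ, Fin.prod_Ioi_zero]
  simp only [Fin.prod_Ioi_succ]
  rfl

lemma vdm_succAbove {n : ℕ} (v : Fin (n + 1) → R) (i : Fin (n + 1)) :
    (-1) ^ i.val * vdm v =
      (∏ j : Fin n, (v i - v (i.succAbove j))) * vdm fun j : Fin n => v (i.succAbove j) := by
  have h := vdm_comp_perm v i.cycleRange.symm
  rw [vdm_succ] at h
  simp only [Function.comp_apply, Fin.cycleRange_symm_zero, Fin.cycleRange_symm_succ,
    Equiv.Perm.sign_symm, Fin.sign_cycleRange] at h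
  rw [h]
  push_cast
  rfl

lemma map_vdm {S : Type*} [CommRing S] {n : ℕ} (φ : R →+* S) (v : Fin n → R) :
    φ (vdm v) = vdm fun i => φ (v i) := by
  simp only [vdm, map_prod, map_sub]

end Vandermonde

/-- `∏_{i < j} (x_i - x_j)` in `n` variables. -/
abbrev vdmX (n : ℕ) : MvPolynomial (Fin n) Kqt := vdm MvPolynomial.X

lemma vdmX_ne_zero (n : ℕ) : vdmX n ≠ 0 := by
  refine Finset.prod_ne_zero_iff.2 fun i _ => Finset.prod_ne_zero_iff.2 fun j hj => ?_
  exact fun h => (Finset.mem_Ioi.1 hj).ne (MvPolynomial.X_injective (sub_eq_zero.1 h))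

lemma vdmX_succAbove {n : ℕ} (i : Fin (n + 1)) :
    (-1) ^ i.val * vdmX (n + 1) =
      (∏ j : Fin n, (MvPolynomial.X i - MvPolynomial.X (i.succAbove j))) *
        MvPolynomial.rename i.succAbove (vdmX n) := by
  rw [vdmX, vdm_succAbove]
  congr 1
  have := map_vdm (MvPolynomial.rename (R := Kqt) i.succAbove : MvPolynomial (Fin n) Kqt →ₐ[Kqt] _).toRingHom
    MvPolynomial.X
  refine Eq.trans ?_ this.symm
  simp

/-- The vertex operator in `n + 1` variables, without denominators. -/
lemma vdmX_mul_res_vertexOp (n : ℕ) (F : SymFun) :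
    vdmX (n + 1) * res (n + 1) (vertexOp 0 F) =
      MvPolynomial.C (tc ^ (n + 1)) * (vdmX (n + 1) * res (n + 1) F) +
      ∑ i : Fin (n + 1), MvPolynomial.C ((1 - tc) * (-1) ^ i.val) *
        ((∏ j : Fin n, (MvPolynomial.X i - MvPolynomial.C tc * MvPolynomial.X (i.succAbove j))) *
          MvPolynomial.rename i.succAbove (vdmX n * res n F)) := by
  let L := FractionRing (MvPolynomial (Fin (n + 1)) Kqt)
  let φ : MvPolynomial (Fin (n + 1)) Kqt →ₐ[Kqt] L := Algebra.algHom Kqt _ L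
  have hinj : Function.Injective φ := IsFractionRing.injective (MvPolynomial (Fin (n + 1)) Kqt) L
  have h := algHom_res_vertexOp n φ (hinj.comp MvPolynomial.X_injective) F
  apply hinj
  have hC : ∀ c, φ (MvPolynomial.C c) = algebraMap Kqt L c := fun c => φ.commutes c
  rw [map_mul, h, mul_add, map_add, Finset.mul_sum, map_sum]
  congr 1
  · rw [map_mul, hC, map_pow, map_mul]; ring
  · refine Finset.sum_congr rfl fun i _ => ?_
    have h1 := congrArg φ (vdmX_succAbove i)
    have h2 : pfCoeff (tA L) (fun i => φ (MvPolynomial.X i)) Finset.univ i *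
        φ (∏ j : Fin n, (MvPolynomial.X i - MvPolynomial.X (i.succAbove j))) =
        (1 - tA L) * φ (∏ j : Fin n,
          (MvPolynomial.X i - MvPolynomial.C tc * MvPolynomial.X (i.succAbove j))) := by
      have : (Finset.univ.erase i) = Finset.univ.map i.succAboveEmb := by
        ext j
        simp [Fin.exists_succAbove_eq_iff]
      rw [pfCoeff, this, Finset.prod_map, Finset.prod_div_distrib, map_prod, map_prod, mul_assoc,
        div_mul_eq_mul_div]
      congr 1
      simp only [map_sub, map_mul, hC]
      apply mul_div_cancel_right₀
      refine Finset.prod_ne_zero_iff.2 fun j _ hj => ?_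
      exact Fin.succAbove_ne i j (MvPolynomial.X_injective (hinj (sub_eq_zero.1 hj))).symm
    simp only [map_mul, map_pow, map_neg, map_one, hC, map_sub] at h1 h2 ⊢
    have h3 : ((-1 : L) ^ i.val) * (-1) ^ i.val = 1 := by
      rw [← mul_pow, neg_mul_neg, one_mul, one_pow]
    linear_combination
      (pfCoeff (tA L) (fun i => φ (MvPolynomial.X i)) Finset.univ i *
        φ (MvPolynomial.rename i.succAbove (res n F))) * ((-1) ^ i.val * h1 - φ (vdmX (n + 1)) * h3) +
      (-1) ^ i.val * φ (MvPolynomial.rename i.succAbove (vdmX n)) *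
        φ (MvPolynomial.rename i.succAbove (res n F)) * h2

/-! ### Hall–Littlewood numerators -/

/-- The permutation of `0, …, n` with `n ↦ i` that is `a ↦ i.succAbove (σ a)` on `0, …, n - 1`. -/
def permOfLast {n : ℕ} (i : Fin (n + 1)) (σ : Equiv.Perm (Fin n)) : Equiv.Perm (Fin (n + 1)) :=
  i.cycleRange.symm * finRotate (n + 1) * finSuccEquivLast.symm.permCongr σ.optionCongr

lemma permOfLast_last {n : ℕ} (i : Fin (n + 1)) (σ : Equiv.Perm (Fin n)) :
    permOfLast i σ (Fin.last n) = i := by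
  simp [permOfLast, Equiv.permCongr_apply, Fin.cycleRange_symm_zero]

lemma permOfLast_castSucc {n : ℕ} (i : Fin (n + 1)) (σ : Equiv.Perm (Fin n)) (a : Fin n) :
    permOfLast i σ a.castSucc = i.succAbove (σ a) := by
  simp [permOfLast, Equiv.permCongr_apply, Fin.cycleRange_symm_succ]

lemma sign_permOfLast {n : ℕ} (i : Fin (n + 1)) (σ : Equiv.Perm (Fin n)) :
    ((Equiv.Perm.sign (permOfLast i σ) : ℤˣ) : ℤ) =
      (-1) ^ (n + i.val) * (Equiv.Perm.sign σ : ℤ) := by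
  simp [permOfLast, Fin.sign_cycleRange, sign_finRotate, pow_add]
  ring

lemma permOfLast_bijective (n : ℕ) :
    Function.Bijective fun p : Fin (n + 1) × Equiv.Perm (Fin n) => permOfLast p.1 p.2 := by
  rw [Fintype.bijective_iff_injective_and_card]
  constructor
  · rintro ⟨i, σ⟩ ⟨j, τ⟩ h
    have h1 : i = j := by
      have := DFunLike.congr_fun h (Fin.last n)
      simpa only [permOfLast_last] using this
    subst h1
    have h2 : σ = τ := by
      ext1 a
      have := DFunLike.congr_fun h a.castSucc
      simp only [permOfLast_castSucc] at this
      exact Fin.succAbove_right_injective this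
    rw [h2]
  · rw [Fintype.card_prod, Fintype.card_perm, Fintype.card_perm, Fintype.card_fin,
      Fintype.card_fin, Nat.factorial_succ]

lemma prod_Ioi_castSucc {M : Type*} [CommMonoid M] {n : ℕ} (f : Fin (n + 1) → Fin (n + 1) → M) :
    ∏ i, ∏ j ∈ Finset.Ioi i, f i j =
      (∏ i : Fin n, ∏ j ∈ Finset.Ioi i, f i.castSucc j.castSucc) *
        ∏ i : Fin n, f i.castSucc (Fin.last n) := by
  have h (m : ℕ) (g : Fin m → Fin m → M) (i : Fin m) :
      ∏ j ∈ Finset.Ioi i, g i j = ∏ j, if i < j then g i j else 1 := by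
    rw [← Finset.prod_filter]
    congr 1
    ext j
    simp
  have h' : ∏ i : Fin n, ∏ j ∈ Finset.Ioi i, f i.castSucc j.castSucc =
      ∏ i : Fin n, ∏ j, if i < j then f i.castSucc j.castSucc else 1 :=
    Finset.prod_congr rfl fun i _ => h n (fun i j => f i.castSucc j.castSucc) i
  rw [h', Finset.prod_congr rfl fun i _ => h (n + 1) f i, Fin.prod_univ_castSucc]
  simp only [Fin.prod_univ_castSucc, Fin.castSucc_lt_castSucc_iff, Fin.castSucc_lt_last, if_true]
  rw [Finset.prod_mul_distrib]
  simp [(Fin.castSucc_lt_last _).not_gt]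

/-- The terms of the antisymmetrization are sorted by the value of the permutation at the last
variable, on which `x^μ` does not depend. -/
lemma hlNumerator_succ (s : Kqt) (μ : YoungDiagram) (n : ℕ) (hμ : μ.rowLen n = 0) :
    hlNumerator s μ (n + 1) = ∑ i : Fin (n + 1), MvPolynomial.C ((-1) ^ (n + i.val)) *
      ((∏ a : Fin n, (MvPolynomial.X (i.succAbove a) - MvPolynomial.C s * MvPolynomial.X i)) *
        MvPolynomial.rename i.succAbove (hlNumerator s μ n)) := by
  rw [hlNumerator, ← (permOfLast_bijective n).sum_comp, Fintype.sum_prod_type]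
  refine Finset.sum_congr rfl fun i _ => ?_
  rw [hlNumerator, map_sum, Finset.mul_sum, Finset.mul_sum]
  refine Finset.sum_congr rfl fun σ _ => ?_
  have h1 : ∀ a : Fin n, permOfLast i σ a.castSucc = i.succAbove (σ a) := permOfLast_castSucc i σ
  rw [prod_Ioi_castSucc]
  simp only [sign_permOfLast, Fin.prod_univ_castSucc, map_mul, map_prod, map_pow, map_sub,
    MvPolynomial.rename_X, MvPolynomial.rename_C, h1, permOfLast_last, Fin.val_castSucc,
    Fin.val_last, hμ, pow_zero, mul_one, map_zsmul]
  rw [← Equiv.prod_comp σ fun a => (MvPolynomial.X (i.succAbove a) -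
    MvPolynomial.C s * MvPolynomial.X i : MvPolynomial (Fin (n + 1)) Kqt)]
  simp only [zsmul_eq_mul, Int.cast_mul, Int.cast_pow, Int.cast_neg, Int.cast_one, map_neg, map_one]
  ring

/-! ### Normalization and columns of Young diagrams -/

lemma rowLen_eq_zero_iff (μ : YoungDiagram) (i : ℕ) : μ.rowLen i = 0 ↔ μ.colLen 0 ≤ i := by
  have h1 := μ.mem_iff_lt_rowLen (i := i) (j := 0)
  have h2 := μ.mem_iff_lt_colLen (i := i) (j := 0)
  rw [← not_iff_not, not_le, ← h2, h1]
  omega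

lemma card_rowLen_eq_succ (μ : YoungDiagram) (n r : ℕ) :
    (Finset.univ.filter fun i : Fin (n + 1) => μ.rowLen i = r).card =
      (Finset.univ.filter fun i : Fin n => μ.rowLen i = r).card +
        if μ.rowLen n = r then 1 else 0 := by
  rw [Finset.card_filter, Finset.card_filter, Fin.sum_univ_castSucc]
  rfl

lemma card_rowLen_eq_zero (μ : YoungDiagram) {n : ℕ} (hn : μ.colLen 0 ≤ n) :
    (Finset.univ.filter fun i : Fin n => μ.rowLen i = 0).card = n - μ.colLen 0 := by
  induction n, hn using Nat.le_induction with
  | base =>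
    rw [Nat.sub_self, Finset.card_eq_zero, Finset.filter_eq_empty_iff]
    intro i _
    rw [rowLen_eq_zero_iff]
    omega
  | succ n hn ih =>
    rw [card_rowLen_eq_succ, ih, if_pos ((rowLen_eq_zero_iff μ n).2 hn)]
    omega

lemma hlNorm_succ (s : Kqt) (μ : YoungDiagram) {n : ℕ} (hn : μ.colLen 0 ≤ n) :
    hlNorm s μ (n + 1) = hlNorm s μ n * ((1 - s ^ (n + 1 - μ.colLen 0)) / (1 - s)) := by
  rw [hlNorm, hlNorm, Finset.prod_range_succ', Finset.prod_range_succ', mul_assoc]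
  have h0 := (rowLen_eq_zero_iff μ n).2 hn
  congr 1
  · refine Finset.prod_congr rfl fun r _ => ?_
    rw [card_rowLen_eq_succ, h0, if_neg (Nat.succ_ne_zero r).symm, add_zero]
  · rw [card_rowLen_eq_zero μ hn, card_rowLen_eq_zero μ (by omega : μ.colLen 0 ≤ n + 1),
      show n + 1 - μ.colLen 0 = n - μ.colLen 0 + 1 by omega, Finset.prod_Icc_succ_top (by omega)]

lemma one_sub_tc_inv_pow_ne_zero {n : ℕ} (hn : n ≠ 0) : 1 - tc⁻¹ ^ n ≠ 0 := by
  intro h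
  apply tc_pow_sub_one_ne_zero hn
  rw [inv_pow] at h
  have := tc_ne_zero
  field_simp at h
  rw [h, mul_zero]

lemma one_sub_tc_inv_ne_zero : 1 - tc⁻¹ ≠ 0 := by
  simpa using one_sub_tc_inv_pow_ne_zero one_ne_zero

lemma hlNorm_ne_zero (μ : YoungDiagram) (n : ℕ) : hlNorm tc⁻¹ μ n ≠ 0 := by
  refine Finset.prod_ne_zero_iff.2 fun r _ => Finset.prod_ne_zero_iff.2 fun a ha => ?_
  exact div_ne_zero (one_sub_tc_inv_pow_ne_zero (by rw [Finset.mem_Icc] at ha; omega))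
    one_sub_tc_inv_ne_zero

/-- The Young diagram whose first `l` rows are one box longer than those of `ν`, and which has no
further rows. -/
def addColumn (ν : YoungDiagram) (l : ℕ) : YoungDiagram where
  cells := (Finset.range l ×ˢ Finset.range (ν.rowLen 0 + 1)).filter fun c => c.2 ≤ ν.rowLen c.1
  isLowerSet := by
    rintro ⟨i, j⟩ ⟨i', j'⟩ ⟨hi, hj⟩ h
    simp only [Finset.coe_filter, Finset.mem_product, Finset.mem_range, Set.mem_ofPred_eq] at h ⊢
    simp only at hi hj
    have := ν.rowLen_anti i' i hi
    omega

lemma mem_addColumn {ν : YoungDiagram} {l i j : ℕ} :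
    (i, j) ∈ addColumn ν l ↔ i < l ∧ j ≤ ν.rowLen i := by
  rw [← YoungDiagram.mem_cells]
  simp only [addColumn, Finset.mem_filter, Finset.mem_product, Finset.mem_range]
  have := ν.rowLen_anti 0 i (Nat.zero_le i)
  omega

lemma rowLen_addColumn {ν : YoungDiagram} {l i : ℕ} (hi : i < l) :
    (addColumn ν l).rowLen i = ν.rowLen i + 1 := by
  apply eq_of_forall_lt_iff
  intro j
  rw [← YoungDiagram.mem_iff_lt_rowLen, mem_addColumn]
  omega

lemma colLen_addColumn (ν : YoungDiagram) (l : ℕ) : (addColumn ν l).colLen 0 = l := by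
  apply eq_of_forall_lt_iff
  intro i
  rw [← YoungDiagram.mem_iff_lt_colLen, mem_addColumn]
  omega

lemma hlNorm_addColumn (s : Kqt) (ν : YoungDiagram) (l : ℕ) :
    hlNorm s (addColumn ν l) l = hlNorm s ν l := by
  cases l with
  | zero => simp [hlNorm]
  | succ l =>
    rw [hlNorm, hlNorm, rowLen_addColumn (Nat.succ_pos l), Finset.prod_range_succ']
    have h : ∀ r, (Finset.univ.filter fun i : Fin (l + 1) =>
        (addColumn ν (l + 1)).rowLen i = r) =
          Finset.univ.filter fun i : Fin (l + 1) => ν.rowLen i + 1 = r := by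
      intro r
      refine Finset.filter_congr fun i _ => ?_
      rw [rowLen_addColumn i.isLt]
    simp [h]

lemma hlNumerator_addColumn (s : Kqt) (ν : YoungDiagram) (l : ℕ) :
    hlNumerator s (addColumn ν l) l = (∏ i : Fin l, MvPolynomial.X i) * hlNumerator s ν l := by
  rw [hlNumerator, hlNumerator, Finset.mul_sum]
  refine Finset.sum_congr rfl fun w _ => ?_
  have h : (∏ i : Fin l, (MvPolynomial.X i : MvPolynomial (Fin l) Kqt) ^ (addColumn ν l).rowLen i) =
      (∏ i : Fin l, MvPolynomial.X i) * ∏ i : Fin l, MvPolynomial.X i ^ ν.rowLen i := by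
    rw [← Finset.prod_mul_distrib]
    refine Finset.prod_congr rfl fun i _ => ?_
    rw [rowLen_addColumn i.isLt, pow_succ']
  have h' : MvPolynomial.rename w (∏ i : Fin l, (MvPolynomial.X i : MvPolynomial (Fin l) Kqt)) =
      ∏ i : Fin l, MvPolynomial.X i := by
    rw [map_prod]
    simp only [MvPolynomial.rename_X]
    exact Equiv.prod_comp w fun i => (MvPolynomial.X i : MvPolynomial (Fin l) Kqt)
  rw [h, mul_assoc, map_mul, h', mul_smul_comm]

/-! ### Hall–Littlewood functions are eigenvectors -/

/-- The condition on the restriction to `n` variables in the definition of `P_μ(X, t⁻¹)`. -/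
def HLEq (μ : YoungDiagram) (n : ℕ) (F : SymFun) : Prop :=
  MvPolynomial.C (hlNorm tc⁻¹ μ n) * (vdmX n * res n F) = hlNumerator tc⁻¹ μ n

lemma isHallLittlewood_iff {μ : YoungDiagram} {F : SymFun} :
    IsHallLittlewood tc⁻¹ μ F ↔ ∀ n, μ.colLen 0 ≤ n → HLEq μ n F := by
  refine forall₂_congr fun n _ => ?_
  rw [HLEq, ← MvPolynomial.coe_inj, ← mul_assoc, MvPolynomial.coe_mul _ (res n F), coe_res]
  rfl

/-- The vertex operator raises the number of variables in which the defining equation of a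
Hall–Littlewood function holds. -/
lemma HLEq.vertexOp {μ : YoungDiagram} {n : ℕ} (hn : μ.colLen 0 ≤ n) {F : SymFun}
    (hF : HLEq μ n F) :
    MvPolynomial.C (hlNorm tc⁻¹ μ (n + 1)) * (vdmX (n + 1) * res (n + 1) (vertexOp 0 F)) =
      MvPolynomial.C (tc ^ (n + 1)) *
        (MvPolynomial.C (hlNorm tc⁻¹ μ (n + 1)) * (vdmX (n + 1) * res (n + 1) F)) +
      MvPolynomial.C (tc ^ μ.colLen 0 - tc ^ (n + 1)) * hlNumerator tc⁻¹ μ (n + 1) := by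
  rw [vdmX_mul_res_vertexOp, mul_add, hlNumerator_succ _ _ _ ((rowLen_eq_zero_iff μ n).2 hn),
    Finset.mul_sum, Finset.mul_sum]
  refine congrArg₂ _ (mul_left_comm _ _ _) ?_
  refine Finset.sum_congr rfl fun i _ => ?_
  have h1 := congrArg (MvPolynomial.rename (R := Kqt) i.succAbove) hF
  rw [map_mul, MvPolynomial.rename_C] at h1
  have ht := tc_ne_zero
  have ht1 : tc - 1 ≠ 0 := tc_sub_one_ne_zero
  have h2 : ∏ j : Fin n, (MvPolynomial.X i - MvPolynomial.C tc * MvPolynomial.X (i.succAbove j) :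
      MvPolynomial (Fin (n + 1)) Kqt) = MvPolynomial.C ((-tc) ^ n) *
        ∏ j : Fin n, (MvPolynomial.X (i.succAbove j) - MvPolynomial.C tc⁻¹ * MvPolynomial.X i) := by
    have : (MvPolynomial.C ((-tc) ^ n) : MvPolynomial (Fin (n + 1)) Kqt) =
        ∏ _j : Fin n, MvPolynomial.C (-tc) := by
      rw [Finset.prod_const, Finset.card_univ, Fintype.card_fin, map_pow]
    rw [this, ← Finset.prod_mul_distrib]
    refine Finset.prod_congr rfl fun j _ => ?_
    have h3 : (MvPolynomial.C tc * MvPolynomial.C tc⁻¹ : MvPolynomial (Fin (n + 1)) Kqt) = 1 := by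
      rw [← MvPolynomial.C_mul, mul_inv_cancel₀ ht, MvPolynomial.C_1]
    rw [map_neg]
    linear_combination -MvPolynomial.X i * h3
  have h3 : hlNorm tc⁻¹ μ (n + 1) * ((1 - tc) * (-1) ^ i.val) * (-tc) ^ n =
      hlNorm tc⁻¹ μ n * ((tc ^ μ.colLen 0 - tc ^ (n + 1)) * (-1) ^ (n + i.val)) := by
    rw [hlNorm_succ _ _ hn]
    obtain ⟨m, hm⟩ := Nat.exists_eq_add_of_le (Nat.le_succ_of_le hn)
    have e : n + 1 - μ.colLen 0 = m := by omega
    rw [e, neg_pow tc, pow_add (-1 : Kqt) n]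
    have e2 : (1 - tc) * tc ^ n * ((1 - tc⁻¹ ^ m) / (1 - tc⁻¹)) =
        tc ^ μ.colLen 0 - tc ^ (n + 1) := by
      have e3 : 1 - tc⁻¹ = (tc - 1) / tc := by field_simp
      have e4 : tc ^ (n + 1) = tc ^ μ.colLen 0 * tc ^ m := by rw [← pow_add, ← hm]
      have e5 : tc ^ (n + 1) * tc⁻¹ ^ m = tc ^ μ.colLen 0 := by
        rw [e4, mul_assoc, ← mul_pow, mul_inv_cancel₀ ht, one_pow, mul_one]
      rw [e3, ← e5, pow_succ]
      field_simp
      ring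
    rw [← e2]
    ring
  have h4 := congrArg (MvPolynomial.C (σ := Fin (n + 1))) h3
  rw [h2, ← h1]
  generalize MvPolynomial.rename i.succAbove (vdmX n * res n F) = Q
  generalize ∏ j : Fin n,
    (MvPolynomial.X (i.succAbove j) - MvPolynomial.C tc⁻¹ * MvPolynomial.X i) = P
  simp only [MvPolynomial.C_mul] at h4 ⊢
  linear_combination P * Q * h4

lemma vertexOp_of_isHallLittlewood {μ : YoungDiagram} {F : SymFun}
    (hF : IsHallLittlewood tc⁻¹ μ F) : vertexOp 0 F = tc ^ μ.colLen 0 • F := by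
  rw [isHallLittlewood_iff] at hF
  refine symFun_eq_of_res_eq (μ.colLen 0 + 1) fun n hn => ?_
  obtain ⟨n, rfl⟩ := Nat.exists_eq_add_of_le' (show 1 ≤ n by omega)
  have h := (hF n (by omega)).vertexOp (by omega)
  have h1 := hF (n + 1) (by omega)
  rw [HLEq] at h1
  rw [h1, ← add_mul, ← MvPolynomial.C_add, add_sub_cancel, ← h1] at h
  have hC : (MvPolynomial.C (hlNorm tc⁻¹ μ (n + 1)) : MvPolynomial (Fin (n + 1)) Kqt) ≠ 0 := by
    rw [Ne, MvPolynomial.C_eq_zero]; exact hlNorm_ne_zero μ _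
  apply mul_left_cancel₀ (vdmX_ne_zero (n + 1))
  apply mul_left_cancel₀ hC
  rw [h, map_smul, MvPolynomial.smul_eq_C_mul]
  ring

lemma tc_pow_sub_tc_pow_ne_zero {a b : ℕ} (h : a < b) : tc ^ a - tc ^ b ≠ 0 := by
  obtain ⟨c, rfl⟩ := Nat.exists_eq_add_of_lt h
  have : tc ^ a - tc ^ (a + c + 1) = -(tc ^ a * (tc ^ (c + 1) - 1)) := by ring
  rw [this]
  exact neg_ne_zero.2 (mul_ne_zero (pow_ne_zero _ tc_ne_zero)
    (tc_pow_sub_one_ne_zero (Nat.succ_ne_zero c)))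

/-- An eigenvector of the vertex operator that satisfies the defining equation of a
Hall–Littlewood function in the least number of variables is a Hall–Littlewood function. -/
lemma isHallLittlewood_of_vertexOp {μ : YoungDiagram} {F : SymFun}
    (hF : vertexOp 0 F = tc ^ μ.colLen 0 • F) (h : HLEq μ (μ.colLen 0) F) :
    IsHallLittlewood tc⁻¹ μ F := by
  rw [isHallLittlewood_iff]
  intro n hn
  induction n, hn using Nat.le_induction with
  | base => exact h
  | succ n hn ih =>
    have h1 := ih.vertexOp hn
    rw [hF, map_smul, MvPolynomial.smul_eq_C_mul] at h1
    have hC : (MvPolynomial.C (tc ^ μ.colLen 0 - tc ^ (n + 1)) :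
        MvPolynomial (Fin (n + 1)) Kqt) ≠ 0 := by
      rw [Ne, MvPolynomial.C_eq_zero]
      exact tc_pow_sub_tc_pow_ne_zero (by omega)
    apply mul_left_cancel₀ hC
    rw [map_sub] at h1 ⊢
    linear_combination h1

/-! ### Diagonalization of the vertex operator -/

lemma pair_smul {R : Type*} [CommRing R] [Algebra Kqt R] (c : Kqt) (g : R[X])
    (S : PowerSeries R) : pair (c • g) S = c • pair g S := by
  rw [Algebra.smul_def, Polynomial.algebraMap_apply, pair_C_mul, ← Algebra.smul_def]

/-- The vertex operator as a linear map. -/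
def vertexLin (n : ℕ) : SymFun →ₗ[Kqt] SymFun where
  toFun := vertexOp n
  map_add' F G := by
    simp only [vertexOp]
    rw [map_add, mul_add, pair_add_left]
  map_smul' c F := by
    simp only [vertexOp, RingHom.id_apply]
    rw [map_smul, mul_smul_comm]
    exact pair_smul c _ _

/-- Symmetric functions that vanish in fewer than `n` variables. -/
def vanish (n : ℕ) : Submodule Kqt SymFun := ⨅ m : Fin n, LinearMap.ker (res m).toLinearMap

lemma mem_vanish {n : ℕ} {F : SymFun} : F ∈ vanish n ↔ ∀ m < n, res m F = 0 := by
  simp [vanish, Fin.forall_iff]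

/-- Symmetric functions of degree at most `d`. -/
def degLE (d : ℕ) : Submodule Kqt SymFun where
  carrier := {F | ∀ m : ℕ →₀ ℕ, d < m.degree → MvPowerSeries.coeff m (F : PS) = 0}
  zero_mem' m _ := map_zero _
  add_mem' {F G} hF hG m hm := by
    change MvPowerSeries.coeff m ((F : PS) + (G : PS)) = 0
    rw [map_add, hF m hm, hG m hm, add_zero]
  smul_mem' c F hF m hm := by
    change MvPowerSeries.coeff m (c • (F : PS)) = 0
    rw [map_smul, hF m hm, smul_zero]

lemma vertexOp_sub_mem_vanish {n : ℕ} {F : SymFun} (hF : F ∈ vanish n) :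
    vertexLin 0 F - tc ^ n • F ∈ vanish (n + 1) := by
  rw [mem_vanish] at hF ⊢
  intro m hm
  cases m with
  | zero =>
    cases n with
    | zero =>
      rw [map_sub, map_smul, pow_zero, one_smul, sub_eq_zero]
      exact res_zero_vertexOp F
    | succ n =>
      rw [map_sub, map_smul, hF 0 (Nat.succ_pos n), smul_zero, sub_zero]
      exact (res_zero_vertexOp F).trans (hF 0 (Nat.succ_pos n))
  | succ m =>
    have h := vdmX_mul_res_vertexOp m F
    simp only [hF m (by omega), mul_zero, map_zero, Finset.sum_const_zero, add_zero] at h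
    rw [mul_left_comm] at h
    have h1 := mul_left_cancel₀ (vdmX_ne_zero (m + 1)) h
    change res (m + 1) (vertexOp 0 F - _) = 0
    rw [map_sub, h1, map_smul, MvPolynomial.smul_eq_C_mul]
    rcases (Nat.lt_succ_iff.1 hm).lt_or_eq with h2 | h2
    · rw [hF _ h2, mul_zero, mul_zero, sub_zero]
    · rw [h2, sub_self]

lemma eq_zero_of_mem_vanish {d : ℕ} {F : SymFun} (h : F ∈ vanish (d + 1)) (h' : F ∈ degLE d) :
    F = 0 := by
  rw [mem_vanish] at h
  apply Subtype.ext
  ext m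
  by_cases hm : d < m.degree
  · exact h' m hm
  · obtain ⟨x, -, hx⟩ := exists_coeff_eq_coeff_res (d := d) m
      ((card_support_le_degree m).trans (not_lt.1 hm))
    rw [hx, h d (Nat.lt_succ_self d), MvPolynomial.coeff_zero]
    rfl

lemma totalDegree_res_le {d : ℕ} {F : SymFun} (hF : F ∈ degLE d) (n : ℕ) :
    (res n F).totalDegree ≤ d := by
  refine Finset.sup_le fun x hx => ?_
  by_contra h
  rw [MvPolynomial.mem_support_iff, coeff_res] at hx
  refine hx (hF _ ?_)
  rw [Finsupp.embDomain_eq_mapDomain, Finsupp.degree_mapDomain]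
  exact not_le.1 h

lemma mem_degLE_of_totalDegree {d : ℕ} {F : SymFun}
    (h : ∀ n, (res (n + 1) F).totalDegree ≤ d) : F ∈ degLE d := by
  intro m hm
  obtain ⟨x, hx, hx'⟩ := exists_coeff_eq_coeff_res (d := m.degree + 1) m
    ((card_support_le_degree m).trans (Nat.le_succ _))
  rw [hx']
  apply MvPolynomial.coeff_eq_zero_of_totalDegree_lt
  refine lt_of_le_of_lt (h _) ?_
  rw [← hx] at hm
  exact hm

lemma vdmX_isHomogeneous (n : ℕ) : (vdmX n).IsHomogeneous (n.choose 2) := by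
  induction n with
  | zero => simpa [vdmX, vdm] using MvPolynomial.isHomogeneous_one (Fin 0) Kqt
  | succ n ih =>
    have h : vdmX (n + 1) = (∏ j : Fin n, (MvPolynomial.X 0 - MvPolynomial.X j.succ)) *
        MvPolynomial.rename Fin.succ (vdmX n) := by
      have := vdmX_succAbove (0 : Fin (n + 1))
      simpa using this
    rw [h, Nat.choose_succ_succ' n 1, Nat.choose_one_right]
    refine MvPolynomial.IsHomogeneous.mul ?_ ih.rename_isHomogeneous
    have := MvPolynomial.IsHomogeneous.prod (Finset.univ : Finset (Fin n))
      (fun j => (MvPolynomial.X 0 - MvPolynomial.X j.succ : MvPolynomial (Fin (n + 1)) Kqt))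
      (fun _ => 1) fun j _ =>
        (MvPolynomial.isHomogeneous_X _ _).sub (MvPolynomial.isHomogeneous_X _ _)
    simpa using this

lemma vertexOp_mem_degLE {d : ℕ} {F : SymFun} (hF : F ∈ degLE d) : vertexLin 0 F ∈ degLE d := by
  apply mem_degLE_of_totalDegree
  intro n
  change (res (n + 1) (vertexOp 0 F)).totalDegree ≤ d
  by_cases h0 : res (n + 1) (vertexOp 0 F) = 0
  · rw [h0, MvPolynomial.totalDegree_zero]; exact Nat.zero_le d
  have hC : ∀ (c : Kqt) (p : MvPolynomial (Fin (n + 1)) Kqt),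
      (MvPolynomial.C c * p).totalDegree ≤ p.totalDegree := fun c p => by
    rw [← MvPolynomial.smul_eq_C_mul]; exact MvPolynomial.totalDegree_smul_le c p
  have h1 := congrArg MvPolynomial.totalDegree (vdmX_mul_res_vertexOp n F)
  rw [MvPolynomial.totalDegree_mul_of_isDomain (vdmX_ne_zero _) h0,
    (vdmX_isHomogeneous (n + 1)).totalDegree (vdmX_ne_zero _)] at h1
  have h2 : (MvPolynomial.C (tc ^ (n + 1)) * (vdmX (n + 1) * res (n + 1) F)).totalDegree ≤
      (n + 1).choose 2 + d := by
    refine (hC _ _).trans ((MvPolynomial.totalDegree_mul _ _).trans ?_)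
    exact add_le_add (vdmX_isHomogeneous (n + 1)).totalDegree_le (totalDegree_res_le hF _)
  have h3 : ∀ i : Fin (n + 1), (MvPolynomial.C ((1 - tc) * (-1) ^ i.val) *
        ((∏ j : Fin n, (MvPolynomial.X i - MvPolynomial.C tc * MvPolynomial.X (i.succAbove j))) *
          MvPolynomial.rename i.succAbove (vdmX n * res n F))).totalDegree ≤
      (n + 1).choose 2 + d := by
    intro i
    refine (hC _ _).trans ((MvPolynomial.totalDegree_mul _ _).trans ?_)
    have e1 : (∏ j : Fin n, (MvPolynomial.X i - MvPolynomial.C tc * MvPolynomial.X (i.succAbove j) :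
        MvPolynomial (Fin (n + 1)) Kqt)).totalDegree ≤ n := by
      have := MvPolynomial.IsHomogeneous.prod (Finset.univ : Finset (Fin n))
        (fun j => (MvPolynomial.X i - MvPolynomial.C tc * MvPolynomial.X (i.succAbove j) :
          MvPolynomial (Fin (n + 1)) Kqt)) (fun _ => 1) fun j _ =>
          (MvPolynomial.isHomogeneous_X _ _).sub (MvPolynomial.isHomogeneous_C_mul_X _ _)
      simpa using this.totalDegree_le
    have e2 := (MvPolynomial.totalDegree_rename_le i.succAbove (vdmX n * res n F)).trans
      ((MvPolynomial.totalDegree_mul _ _).trans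
        (add_le_add (vdmX_isHomogeneous n).totalDegree_le (totalDegree_res_le hF n)))
    have e3 : (n + 1).choose 2 = n + n.choose 2 := by
      rw [Nat.choose_succ_succ' n 1, Nat.choose_one_right]
    rw [e3]
    omega
  have h4 := (MvPolynomial.totalDegree_add _ _).trans (max_le h2
    (MvPolynomial.totalDegree_finsetSum_le fun i (_ : i ∈ Finset.univ) => h3 i))
  rw [← h1] at h4
  omega

/-! ### Hall–Littlewood functions span the symmetric functions -/

lemma vanish_anti {n m : ℕ} (h : n ≤ m) : vanish m ≤ vanish n := fun _ hF =>
  mem_vanish.2 fun k hk => mem_vanish.1 hF k (hk.trans_le h)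

lemma mem_vanish_succ {n : ℕ} {F : SymFun} (h : F ∈ vanish n) (h' : res n F = 0) :
    F ∈ vanish (n + 1) :=
  mem_vanish.2 fun m hm => by
    rcases (Nat.lt_succ_iff.1 hm).lt_or_eq with h1 | rfl
    · exact mem_vanish.1 h m h1
    · exact h'

lemma vanish_zero (F : SymFun) : F ∈ vanish 0 :=
  mem_vanish.2 fun _ hm => absurd hm (Nat.not_lt_zero _)

lemma exists_mem_degLE (F : SymFun) : ∃ d, F ∈ degLE d := F.2.1

/-- An eigenvector with eigenvalue `t ^ k` vanishes in fewer than `k` variables, since modulo functions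
vanishing in one more variable the vertex operator acts by a different eigenvalue. -/
lemma mem_vanish_of_eigenvector {k n : ℕ} {F : SymFun} (hF : vertexLin 0 F = tc ^ k • F)
    (hn : n ≤ k) : F ∈ vanish n := by
  induction n with
  | zero => exact vanish_zero F
  | succ n ih =>
    have h := vertexOp_sub_mem_vanish (ih (by omega))
    rw [hF, ← sub_smul] at h
    exact (Submodule.smul_mem_iff _ (by
      rw [← neg_sub]; exact neg_ne_zero.2 (tc_pow_sub_tc_pow_ne_zero (by omega)))).1 h

/-- An eigenvector with eigenvalue `t ^ k` is determined by its restriction to `k` variables. -/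
lemma eigenvector_eq_zero {k : ℕ} {F : SymFun} (hF : vertexLin 0 F = tc ^ k • F)
    (h : res k F = 0) : F = 0 := by
  have hn : ∀ n, F ∈ vanish (k + 1 + n) := by
    intro n
    induction n with
    | zero => exact mem_vanish_succ (mem_vanish_of_eigenvector hF le_rfl) h
    | succ n ih =>
      have h := vertexOp_sub_mem_vanish ih
      rw [hF, ← sub_smul] at h
      exact (Submodule.smul_mem_iff _ (tc_pow_sub_tc_pow_ne_zero (by omega))).1 h
  obtain ⟨d, hd⟩ := exists_mem_degLE F
  exact eq_zero_of_mem_vanish (vanish_anti (by omega) (hn d)) hd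

/-- The vertex operator acts by `t^n` on the functions that vanish in fewer than `n` variables,
modulo those that vanish in `n` variables; the eigenvalues `t^n` are distinct, so eigenvectors can
be lifted. -/
lemma exists_eigenvector {n d : ℕ} {F : SymFun} (hF : F ∈ vanish n) (hd : F ∈ degLE d) :
    ∃ F' ∈ degLE d, vertexLin 0 F' = tc ^ n • F' ∧ F' - F ∈ vanish (n + 1) := by
  have key : ∀ m, n ≤ m → ∃ G ∈ degLE d, vertexLin 0 G - tc ^ n • G ∈ vanish (m + 1) ∧
      G - F ∈ vanish (n + 1) := by
    intro m hm
    induction m, hm using Nat.le_induction with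
    | base => exact ⟨F, hd, vertexOp_sub_mem_vanish hF, by rw [sub_self]; exact zero_mem _⟩
    | succ m hm ih =>
      obtain ⟨G, hG, h1, h2⟩ := ih
      set H := vertexLin 0 G - tc ^ n • G with hH
      have hc : tc ^ (m + 1) - tc ^ n ≠ 0 := by
        rw [← neg_sub]; exact neg_ne_zero.2 (tc_pow_sub_tc_pow_ne_zero (by omega))
      have hHd : H ∈ degLE d := sub_mem (vertexOp_mem_degLE hG) (Submodule.smul_mem _ _ hG)
      refine ⟨G - (tc ^ (m + 1) - tc ^ n)⁻¹ • H, sub_mem hG (Submodule.smul_mem _ _ hHd), ?_, ?_⟩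
      · have h3 := vertexOp_sub_mem_vanish h1
        have h4 : vertexLin 0 (G - (tc ^ (m + 1) - tc ^ n)⁻¹ • H) -
            tc ^ n • (G - (tc ^ (m + 1) - tc ^ n)⁻¹ • H) =
              -((tc ^ (m + 1) - tc ^ n)⁻¹ • (vertexLin 0 H - tc ^ (m + 1) • H)) := by
          rw [map_sub, map_smul]
          have h5 : vertexLin 0 G = H + tc ^ n • G := by rw [hH, sub_add_cancel]
          have h6 : H = (tc ^ (m + 1) - tc ^ n)⁻¹ • (tc ^ (m + 1) - tc ^ n) • H := by
            rw [inv_smul_smul₀ hc]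
          rw [h5]
          generalize vertexLin 0 H = BH at *
          rw [smul_sub, smul_sub]
          nth_rewrite 1 [h6]
          module
        rw [h4]
        exact neg_mem (Submodule.smul_mem _ _ h3)
      · rw [sub_right_comm]
        exact sub_mem h2 (Submodule.smul_mem _ _ (vanish_anti (by omega) h1))
  obtain ⟨G, hG, h1, h2⟩ := key (max n d) (le_max_left _ _)
  refine ⟨G, hG, ?_, h2⟩
  rw [← sub_eq_zero]
  exact eq_zero_of_mem_vanish (vanish_anti (by omega) h1)
    (sub_mem (vertexOp_mem_degLE hG) (Submodule.smul_mem _ _ hG))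

/-- Symmetric polynomials lift to symmetric functions of the same degree. -/
lemma exists_res_eq {l d : ℕ} {p : MvPolynomial (Fin l) Kqt} (hp : p.IsSymmetric)
    (hd : p.totalDegree ≤ d) : ∃ G ∈ degLE d, res l G = p := by
  obtain ⟨P, hP⟩ := exists_aeval_psum_eq hp
  obtain ⟨Q, hQ⟩ := exists_powerSumHom_trunc (MvPolynomial.rename Fin.val P) d
  refine ⟨powerSumHom Q, fun m hm => by rw [hQ, if_neg (not_le.2 hm)], ?_⟩
  rw [← res_comp_powerSumHom] at hP
  ext x
  rw [coeff_res, hQ]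
  split_ifs with h
  · rw [← coeff_res, hP]
  · rw [MvPolynomial.coeff_eq_zero_of_totalDegree_lt]
    rw [Finsupp.embDomain_eq_mapDomain, Finsupp.degree_mapDomain, not_le] at h
    exact hd.trans_lt h

/-- The product of all variables. -/
def prodX (l : ℕ) : MvPolynomial (Fin l) Kqt := ∏ i, MvPolynomial.X i

lemma prodX_eq_monomial (l : ℕ) : prodX l = MvPolynomial.monomial (∑ i, Finsupp.single i 1) 1 :=
  (MvPolynomial.monomial_sum_one _ _).symm

lemma prodX_ne_zero (l : ℕ) : prodX l ≠ 0 :=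
  Finset.prod_ne_zero_iff.2 fun i _ => MvPolynomial.X_ne_zero i

lemma prodX_isSymmetric (l : ℕ) : (prodX l).IsSymmetric := by
  intro w
  rw [prodX, map_prod]
  simp only [MvPolynomial.rename_X]
  exact Equiv.prod_comp w fun i => (MvPolynomial.X i : MvPolynomial (Fin l) Kqt)

lemma coeff_prodX_mul {l : ℕ} (g : MvPolynomial (Fin l) Kqt) {y : Fin l →₀ ℕ} {i : Fin l}
    (hy : y i = 0) : (prodX l * g).coeff y = 0 := by
  obtain ⟨p, hp⟩ := Finset.dvd_prod_of_mem (fun i => (MvPolynomial.X i : MvPolynomial (Fin l) Kqt))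
    (Finset.mem_univ i)
  rw [prodX, hp, mul_assoc, MvPolynomial.coeff_X_mul', if_neg (by simpa using hy)]

/-- A symmetric function that vanishes in fewer than `l` variables has no monomial in fewer than `l`
variables. -/
lemma prodX_dvd_res {l : ℕ} {F : SymFun} (hF : F ∈ vanish l) : prodX l ∣ res l F := by
  rw [prodX_eq_monomial, MvPolynomial.monomial_one_dvd_iff_modMonomial_eq_zero]
  ext x
  by_cases hx : (∑ i, Finsupp.single i 1) ≤ x
  · rw [MvPolynomial.coeff_modMonomial_of_le _ hx]; rfl
  · rw [MvPolynomial.coeff_modMonomial_of_not_le _ hx, coeff_res]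
    obtain ⟨i, hi⟩ : ∃ i, x i = 0 := by
      by_contra! h
      refine hx fun i => ?_
      rw [Finsupp.finsetSum_apply]
      simpa [Finsupp.single_apply, Nat.one_le_iff_ne_zero] using h i
    obtain ⟨z, -, hz⟩ := exists_coeff_eq_coeff_res (d := l - 1) (x.embDomain Fin.valEmbedding) (by
      rw [Finsupp.support_embDomain, Finset.card_map]
      have : x.support ⊆ Finset.univ.erase i := fun j hj => by
        rw [Finset.mem_erase]
        exact ⟨fun h => by subst h; exact Finsupp.mem_support_iff.1 hj hi, Finset.mem_univ j⟩
      have := Finset.card_le_card this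
      rwa [Finset.card_erase_of_mem (Finset.mem_univ i), Finset.card_univ, Fintype.card_fin] at this)
    rw [hz, mem_vanish.1 hF (l - 1) (by have := i.isLt; omega)]
    rfl

lemma mem_vanish_of_prodX_dvd {l : ℕ} {F : SymFun} (h : prodX l ∣ res l F) : F ∈ vanish l := by
  obtain ⟨g, hg⟩ := h
  refine mem_vanish.2 fun m hm => ?_
  ext x
  have h1 : x.embDomain Fin.valEmbedding =
      (x.embDomain (Fin.castLEEmb hm.le)).embDomain Fin.valEmbedding := by
    rw [← Finsupp.embDomain_trans_apply]
    rfl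
  rw [coeff_res, h1, ← coeff_res, hg, coeff_prodX_mul (i := ⟨m, hm⟩)]
  · rfl
  · apply Finsupp.embDomain_of_notMem_range
    rintro ⟨a, ha⟩
    have := congrArg Fin.val ha
    simp at this
    exact a.isLt.ne this

/-- The span of the Hall–Littlewood functions `P_μ(X, t⁻¹)`. -/
def hlSpan : Submodule Kqt SymFun :=
  Submodule.span Kqt {F | ∃ μ, IsHallLittlewood tc⁻¹ μ F}

/-- The span is stable under `G ↦ x_1 ⋯ x_l G` in `l` variables: for a Hall–Littlewood function `P_ν`
of length at most `l`, the result is `P_μ` for `μ` the diagram `ν` with a column of length `l`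
added. -/
lemma exists_eigenvector_prodX_mul (l : ℕ) {G : SymFun} (hG : G ∈ hlSpan) :
    ∃ H ∈ hlSpan, vertexLin 0 H = tc ^ l • H ∧ res l H = prodX l * res l G := by
  induction hG using Submodule.span_induction with
  | zero => exact ⟨0, zero_mem _, by rw [map_zero, smul_zero], by rw [map_zero, mul_zero]⟩
  | add G G' _ _ h h' =>
    obtain ⟨H, h1, h2, h3⟩ := h
    obtain ⟨H', h1', h2', h3'⟩ := h'
    exact ⟨H + H', add_mem h1 h1', by rw [map_add, h2, h2', smul_add],
      by rw [map_add, h3, h3', map_add, mul_add]⟩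
  | smul c G _ h =>
    obtain ⟨H, h1, h2, h3⟩ := h
    exact ⟨c • H, Submodule.smul_mem _ _ h1, by rw [map_smul, h2, smul_comm],
      by rw [map_smul, h3, map_smul, mul_smul_comm]⟩
  | mem G hG =>
    obtain ⟨ν, hν⟩ := hG
    by_cases hl : ν.colLen 0 ≤ l
    · obtain ⟨H₀, hd, hH₀⟩ := exists_res_eq ((prodX_isSymmetric l).mul (res_isSymmetric l G)) le_rfl
      obtain ⟨H, -, h1, h2⟩ :=
        exists_eigenvector (mem_vanish_of_prodX_dvd (Dvd.intro _ hH₀.symm)) hd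
      have h3 : res l H = prodX l * res l G := by
        have := mem_vanish.1 h2 l (Nat.lt_succ_self l)
        rwa [map_sub, sub_eq_zero, hH₀] at this
      refine ⟨H, Submodule.subset_span ⟨addColumn ν l, ?_⟩, h1, h3⟩
      have hc := colLen_addColumn ν l
      apply isHallLittlewood_of_vertexOp
      · rw [hc]; exact h1
      · have h4 := isHallLittlewood_iff.1 hν l hl
        rw [HLEq] at h4
        rw [hc, HLEq, h3, hlNorm_addColumn, hlNumerator_addColumn, ← h4, ← prodX]
        ring
    · refine ⟨0, zero_mem _, by rw [map_zero, smul_zero], ?_⟩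
      have h1 := mem_vanish_of_eigenvector (vertexOp_of_isHallLittlewood hν) le_rfl
      rw [mem_vanish.1 h1 l (not_le.1 hl), map_zero, mul_zero]

lemma one_isHallLittlewood : IsHallLittlewood tc⁻¹ ⊥ 1 := by
  have h : (⊥ : YoungDiagram).colLen 0 = 0 := by
    apply eq_of_forall_lt_iff
    intro i
    rw [← YoungDiagram.mem_iff_lt_colLen]
    simp
  apply isHallLittlewood_of_vertexOp
  · rw [h, pow_zero, one_smul, vertexOp, map_one, pow_zero, one_mul, ← Polynomial.C_1, pair_C, hlSer,
      constantCoeff_expSeries, one_mul]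
  · rw [h, HLEq]
    simp [hlNorm, hlNumerator, vdmX, vdm]

/-- By induction on the degree. An eigenvector with eigenvalue `t ^ l` is `x_1 ⋯ x_l g` in `l` variables,
with `g` of smaller degree if `0 < l`; every function is a sum of eigenvectors. -/
lemma degLE_le_hlSpan (d : ℕ) : degLE d ≤ hlSpan := by
  induction d using Nat.strong_induction_on with
  | _ d ih =>
    have hE : ∀ l, ∀ F ∈ degLE d, vertexLin 0 F = tc ^ l • F → F ∈ hlSpan := by
      intro l F hF hl
      have hv := mem_vanish_of_eigenvector hl le_rfl
      obtain ⟨g, hg⟩ := prodX_dvd_res hv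
      by_cases hg0 : g = 0
      · rw [eigenvector_eq_zero hl (by rw [hg, hg0, mul_zero])]
        exact zero_mem _
      have hg' : g.IsSymmetric := by
        intro w
        have := res_isSymmetric l F w
        rw [hg, map_mul, prodX_isSymmetric l w] at this
        exact mul_left_cancel₀ (prodX_ne_zero l) this
      suffices h : ∃ G ∈ hlSpan, res l G = g by
        obtain ⟨G, hG, rfl⟩ := h
        obtain ⟨H, h1, h2, h3⟩ := exists_eigenvector_prodX_mul l hG
        have h4 : F - H = 0 := by
          apply eigenvector_eq_zero (k := l)
          · rw [map_sub, hl, h2, smul_sub]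
          · rw [map_sub, hg, h3, sub_self]
        rw [sub_eq_zero.1 h4]
        exact h1
      rcases Nat.eq_zero_or_pos l with rfl | hl0
      · refine ⟨g.coeff 0 • 1, Submodule.smul_mem _ _
          (Submodule.subset_span ⟨_, one_isHallLittlewood⟩), ?_⟩
        rw [map_smul, map_one, MvPolynomial.smul_eq_C_mul, mul_one]
        exact (MvPolynomial.eq_C_of_isEmpty g).symm
      · have h1 := totalDegree_res_le hF l
        have h2 : (prodX l).totalDegree = l := by
          have := MvPolynomial.IsHomogeneous.prod (Finset.univ : Finset (Fin l))
            (fun j => (MvPolynomial.X j : MvPolynomial (Fin l) Kqt)) (fun _ => 1)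
            fun j _ => MvPolynomial.isHomogeneous_X _ _
          simpa [prodX] using this.totalDegree (prodX_ne_zero l)
        rw [hg, MvPolynomial.totalDegree_mul_of_isDomain (prodX_ne_zero l) hg0, h2] at h1
        obtain ⟨G, hG, hG'⟩ := exists_res_eq hg' (d := d - 1) (by omega)
        exact ⟨G, ih (d - 1) (by omega) hG, hG'⟩
    have key : ∀ j n, n + j = d + 1 → ∀ F ∈ degLE d, F ∈ vanish n → F ∈ hlSpan := by
      intro j
      induction j with
      | zero =>
        intro n hn F hF hv
        rw [add_zero] at hn
        subst hn
        rw [eq_zero_of_mem_vanish hv hF]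
        exact zero_mem _
      | succ j ihj =>
        intro n hn F hF hv
        obtain ⟨F', h1, h2, h3⟩ := exists_eigenvector hv hF
        have h4 := ihj (n + 1) (by omega) _ (sub_mem h1 hF) h3
        have h5 := sub_mem (hE n F' h1 h2) h4
        rwa [sub_sub_cancel] at h5
    exact fun F hF => key (d + 1) 0 (by omega) F hF (vanish_zero F)

lemma hlSpan_eq_top : hlSpan = ⊤ := by
  refine eq_top_iff.2 fun F _ => ?_
  obtain ⟨d, hd⟩ := exists_mem_degLE F
  exact degLE_le_hlSpan d hd

lemma opBZero_eq : opBZero = vertexLin 0 := by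
  have h : ∃ B : SymFun →ₗ[Kqt] SymFun, ∀ (μ : YoungDiagram) (F : SymFun),
      IsHallLittlewood tc⁻¹ μ F → B F = tc ^ μ.colLen 0 • F :=
    ⟨vertexLin 0, fun _ _ hF => vertexOp_of_isHallLittlewood hF⟩
  rw [opBZero, dif_pos h]
  apply LinearMap.ext_on hlSpan_eq_top
  rintro F ⟨μ, hF⟩
  rw [h.choose_spec μ F hF]
  exact (vertexOp_of_isHallLittlewood hF).symm

/-- The operators `ℬ_n` are the coefficients of the vertex operator. -/
lemma opB_apply (n : ℕ) (F : SymFun) : opB n F = vertexOp n F := by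
  induction n generalizing F with
  | zero => exact DFunLike.congr_fun opBZero_eq F
  | succ n ih =>
    rw [vertexOp_succ, ← ih, ← ih]
    rfl

/-! ### The isomorphism between `𝒫_•` and `V_•` -/

lemma coeff_shiftPS_psumPS (k n : ℕ) (m : ℕ →₀ ℕ) :
    MvPowerSeries.coeff m (shiftPS k (psumPS n)) =
      open Classical in if ∃ i, k ≤ i ∧ m = Finsupp.single i n then 1 else 0 := by
  classical
  by_cases hm : ∃ m', m = Finsupp.embDomain (addRightEmbedding k) m'
  · obtain ⟨m', rfl⟩ := hm
    refine (MvPowerSeries.coeff_embDomain_rename _ _ _).trans ?_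
    rw [coeff_psumPS]
    congr 1
    refine propext ⟨?_, ?_⟩
    · rintro ⟨i, rfl⟩
      exact ⟨i + k, Nat.le_add_left _ _, Finsupp.embDomain_single _ _ _⟩
    · rintro ⟨i, hi, h⟩
      obtain ⟨j, rfl⟩ := Nat.exists_eq_add_of_le' hi
      refine ⟨j, Finsupp.embDomain_injective (addRightEmbedding k) ?_⟩
      rw [h, Finsupp.embDomain_single]
      rfl
  · rw [if_neg]
    · apply MvPowerSeries.coeff_rename_eq_zero (addRightEmbedding k)
      rintro ⟨m', h⟩
      exact hm ⟨m', by rw [← h, Finsupp.embDomain_eq_mapDomain]⟩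
    · rintro ⟨i, hi, rfl⟩
      obtain ⟨j, rfl⟩ := Nat.exists_eq_add_of_le' hi
      refine hm ⟨Finsupp.single j n, ?_⟩
      rw [Finsupp.embDomain_single]
      rfl

/-- `p_n[𝐗_k] = x_{k+1}^n + p_n[𝐗_{k+1}]`. -/
lemma calIncl_symShift_psum (k : ℕ) {n : ℕ} (hn : n ≠ 0) :
    calIncl k (symShift k (psum n)) = xLast k ^ n + symShift (k + 1) (psum n) := by
  classical
  apply Subtype.ext
  change shiftPS k (psumPS n) = MvPowerSeries.X k ^ n + shiftPS (k + 1) (psumPS n)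
  ext m
  rw [map_add, coeff_shiftPS_psumPS, coeff_shiftPS_psumPS,
    MvPowerSeries.coeff_X_pow]
  by_cases h1 : m = Finsupp.single k n
  · rw [if_pos ⟨k, le_rfl, h1⟩, if_pos h1, if_neg, add_zero]
    rintro ⟨i, hi, h2⟩
    rw [h1, Finsupp.single_left_inj hn] at h2
    omega
  · rw [if_neg h1, zero_add]
    congr 1
    refine propext ⟨fun ⟨i, hi, h2⟩ => ⟨i, ?_, h2⟩, fun ⟨i, hi, h2⟩ => ⟨i, by omega, h2⟩⟩
    rcases Nat.lt_or_eq_of_le hi with h3 | h3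
    · exact h3
    · exact absurd (h3 ▸ h2) h1

/-- The automorphism `F ↦ F[X / (t - 1)]` of the ring of symmetric functions. -/
def scaleEquiv : SymFun ≃ₐ[Kqt] SymFun :=
  AlgEquiv.ofAlgHom (pleth fun n => (tc ^ n - 1)⁻¹ • psum n) (pleth fun n => (tc ^ n - 1) • psum n)
    (symFun_algHom_ext fun n hn => by
      rw [AlgHom.comp_apply, pleth_psum _ hn, map_smul, pleth_psum _ hn, smul_smul,
        mul_inv_cancel₀ (tc_pow_sub_one_ne_zero hn), one_smul]; rfl)
    (symFun_algHom_ext fun n hn => by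
      rw [AlgHom.comp_apply, pleth_psum _ hn, map_smul, pleth_psum _ hn, smul_smul,
        inv_mul_cancel₀ (tc_pow_sub_one_ne_zero hn), one_smul]; rfl)

/-- The isomorphism `f(y_1, …, y_k) F[X] ↦ f(x_1, …, x_k) F[(t - 1) 𝐗_k]` from `V_k` to
`𝒫(k)⁺`. -/
def calOfV (k : ℕ) : VStd k ≃ₐ[Kqt] calP k :=
  (Algebra.TensorProduct.congr AlgEquiv.refl scaleEquiv.symm).trans
    (AlgEquiv.ofBijective (mulMap k) (mulMap_bijective k))

lemma calOfV_symm_mulMap (k : ℕ) (f : MvPolynomial (Fin k) Kqt) (F : SymFun) :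
    (calOfV k).symm (mulMap k (f ⊗ₜ[Kqt] F)) =
      f ⊗ₜ[Kqt] pleth (fun n => (tc ^ n - 1)⁻¹ • psum n) F := by
  rw [AlgEquiv.symm_apply_eq]
  change _ = mulMap k (f ⊗ₜ scaleEquiv.symm (scaleEquiv F))
  rw [AlgEquiv.symm_apply_apply]

lemma calOfV_tmul_one (k : ℕ) (f : MvPolynomial (Fin k) Kqt) :
    calOfV k (f ⊗ₜ 1) = polyIncl k f := by
  change mulMap k (f ⊗ₜ scaleEquiv.symm 1) = _
  rw [map_one, mulMap_tmul, map_one, mul_one]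

lemma coe_calOfV_yv (k : ℕ) (i : Fin k) : (calOfV k (yv i) : PS) = MvPowerSeries.X i.val := by
  rw [yv, calOfV_tmul_one, coe_polyIncl_X]

lemma calOfV_pv (k : ℕ) {n : ℕ} (hn : n ≠ 0) :
    calOfV k (pv n) = (tc ^ n - 1) • symShift k (psum n) := by
  change mulMap k (1 ⊗ₜ pleth (fun n => (tc ^ n - 1) • psum n) (psum n)) = _
  rw [mulMap_tmul, map_one, one_mul, pleth_psum _ hn, map_smul]

lemma calOfV_yv_last (k : ℕ) : calOfV (k + 1) (yv (Fin.last k)) = xLast k :=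
  Subtype.ext (coe_calOfV_yv _ _)

lemma calOfV_addVar (k : ℕ) (F : VStd k) : calOfV (k + 1) (addVar k F) = calIncl k (calOfV k F) := by
  have h : (calOfV (k + 1)).toAlgHom.comp (addVar k) = (calIncl k).comp (calOfV k).toAlgHom := by
    apply vstd_algHom_ext
    · intro i
      apply Subtype.ext
      change (calOfV (k + 1) (addVar k (yv i)) : PS) = (calOfV k (yv i) : PS)
      rw [addVar_yv, coe_calOfV_yv, coe_calOfV_yv]
      rfl
    · intro n hn
      change calOfV (k + 1) (addVar k (pv n)) = calIncl k (calOfV k (pv n))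
      rw [addVar_pv k hn, map_add, map_smul, map_pow, calOfV_yv_last, calOfV_pv _ hn,
        calOfV_pv _ hn, map_smul, calIncl_symShift_psum k hn, smul_add]
      exact add_comm _ _
  exact DFunLike.congr_fun h F

/-! ### Compatibility with `T_i` and `d₊` -/

lemma hecke_TPS (i : ℕ) : HeckeOp (tA PS) (MvPowerSeries.X i) (MvPowerSeries.X (i + 1))
    (swapPS i).toRingHom (TPS i) where
  spec F := by rw [X_sub_mul_TPS, tA_mul]; rfl
  map_a := (swapPS_X i i).trans (by rw [Equiv.swap_apply_left])
  map_b := (swapPS_X i (i + 1)).trans (by rw [Equiv.swap_apply_right])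
  map_t := (swapPS i).commutes tc
  map_map F := by
    change MvPowerSeries.rename _ (MvPowerSeries.rename _ F) = F
    rw [MvPowerSeries.rename_rename]
    have : (Equiv.swap i (i + 1) ∘ Equiv.swap i (i + 1) : ℕ → ℕ) = id := by
      funext a; exact Equiv.swap_apply_self _ _ _
    simp only [this, MvPowerSeries.rename_id_apply]
  ne := X_sub_X_ne_zero i

lemma swapPS_shiftPS {i k : ℕ} (h : i + 1 < k) (F : PS) : swapPS i (shiftPS k F) = shiftPS k F := by
  change MvPowerSeries.rename (Equiv.swap i (i + 1))
    (MvPowerSeries.rename (addRightEmbedding k) F) = _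
  rw [MvPowerSeries.rename_rename]
  have : (Equiv.swap i (i + 1) ∘ addRightEmbedding k : ℕ → ℕ) = addRightEmbedding k := by
    funext a
    simp only [Function.comp_apply, addRightEmbedding_apply]
    exact Equiv.swap_apply_of_ne_of_ne (by omega) (by omega)
  simp only [this]
  rfl

instance : IsDomain PS := NoZeroDivisors.to_isDomain PS

lemma coe_calOfV_swapV (k : ℕ) (i : Fin k) (F : VStd (k + 1)) :
    (calOfV (k + 1) (swapV k i F) : PS) = swapPS i (calOfV (k + 1) F : PS) := by
  have h : ((calP (k + 1)).val.comp (calOfV (k + 1)).toAlgHom).comp (swapV k i) =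
      (swapPS i).comp ((calP (k + 1)).val.comp (calOfV (k + 1)).toAlgHom) := by
    apply vstd_algHom_ext
    · intro j
      change (calOfV (k + 1) (swapV k i (yv j)) : PS) = swapPS i (calOfV (k + 1) (yv j) : PS)
      rw [swapV_yv, coe_calOfV_yv, coe_calOfV_yv, swapPS_X]
      congr 1
      simp only [Equiv.swap_apply_def, Fin.ext_iff, Fin.val_castSucc, Fin.val_succ]
      split_ifs <;> simp
    · intro n hn
      change (calOfV (k + 1) (swapV k i (pv n)) : PS) = swapPS i (calOfV (k + 1) (pv n) : PS)
      rw [swapV_pv, calOfV_pv _ hn]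
      change (tc ^ n - 1) • shiftPS (k + 1) (psum n) =
        swapPS i ((tc ^ n - 1) • shiftPS (k + 1) (psum n))
      rw [map_smul, swapPS_shiftPS (by have := i.isLt; omega)]
  exact DFunLike.congr_fun h F

lemma calOfV_stdT (k : ℕ) (i : Fin k) (F : VStd (k + 1)) :
    calOfV (k + 1) (stdT k i F) = calT k i (calOfV (k + 1) F) :=
  Subtype.ext ((stdT_hecke k i).map_T (hecke_TPS i)
    (θ := ((calP (k + 1)).val.comp (calOfV (k + 1)).toAlgHom).toRingHom)
    (coe_calOfV_yv _ _) (coe_calOfV_yv _ _) (map_tA _) (coe_calOfV_swapV k i) F)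

lemma calOfV_stdDPlus (k : ℕ) (F : VStd k) :
    calOfV (k + 1) (stdDPlus k F) = calDPlus k (calOfV k F) := by
  change (calOfV (k + 1)) (-((List.ofFn (stdT k)).prod (yv (Fin.last k) * addVar k F))) =
    -((List.ofFn (calT k)).prod (xLast k * calIncl k (calOfV k F)))
  rw [map_neg, ← calOfV_addVar, ← calOfV_yv_last, ← map_mul]
  congr 1
  exact QuiverRep.map_ofFn_prod (calOfV (k + 1)).toLinearMap (calOfV_stdT k) _

/-! ### Compatibility with `d₊*` -/

/-- `ω_{k+1}⁻¹` as a morphism of algebras. -/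
def omegaInvHom (k : ℕ) : PS →ₐ[Kqt] PS :=
  AlgHom.ofLinearMap (omegaInvPS k)
    (by change MvPowerSeries.rescale _ (MvPowerSeries.rename _ _) = _; rw [map_one, map_one])
    fun F G => by
      change MvPowerSeries.rescale _ (MvPowerSeries.rename _ _) = _
      rw [map_mul, map_mul]; rfl

lemma rescale_eq_self {c : Kqt} {F : PS}
    (h : ∀ m : ℕ →₀ ℕ, m 0 ≠ 0 → MvPowerSeries.coeff m F = 0) :
    MvPowerSeries.rescale (Function.update 1 0 c) F = F := by
  ext m
  rw [MvPowerSeries.coeff_rescale]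
  by_cases hm : m 0 = 0
  · rw [Finsupp.prod, Finset.prod_eq_one, one_mul]
    intro s hs
    rw [Function.update_of_ne, Pi.one_apply, one_pow]
    rintro rfl
    exact Finsupp.mem_support_iff.1 hs hm
  · rw [h m hm, mul_zero]

lemma omegaInvPS_X (k : ℕ) {i : ℕ} (hi : i < k) :
    omegaInvPS k (MvPowerSeries.X i) = MvPowerSeries.X (i + 1) := by
  change MvPowerSeries.rescale _ (MvPowerSeries.rename (cyc k) _) = _
  have h : cyc k i = i + 1 := if_pos hi
  rw [MvPowerSeries.rename_X, h, rescale_eq_self]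
  intro m hm
  rw [MvPowerSeries.coeff_X, if_neg]
  rintro rfl
  simp at hm

lemma omegaInvPS_X_self (k : ℕ) :
    omegaInvPS k (MvPowerSeries.X k) = qc • MvPowerSeries.X 0 := by
  change MvPowerSeries.rescale _ (MvPowerSeries.rename (cyc k) _) = _
  have h : cyc k k = 0 := by simp [cyc]
  rw [MvPowerSeries.rename_X, h]
  ext m
  rw [MvPowerSeries.coeff_rescale, map_smul, MvPowerSeries.coeff_X, smul_eq_mul]
  split_ifs with hm
  · subst hm
    simp
  · rw [mul_zero, mul_zero]

lemma omegaInvPS_shiftPS (k : ℕ) (F : PS) :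
    omegaInvPS k (shiftPS (k + 1) F) = shiftPS (k + 1) F := by
  change MvPowerSeries.rescale _ (MvPowerSeries.rename (cyc k)
    (MvPowerSeries.rename (addRightEmbedding (k + 1)) F)) = _
  rw [MvPowerSeries.rename_rename]
  have : (cyc k ∘ addRightEmbedding (k + 1) : ℕ → ℕ) = addRightEmbedding (k + 1) := by
    funext a
    simp only [Function.comp_apply, addRightEmbedding_apply, cyc, Equiv.coe_fn_mk]
    grind
  simp only [this]
  apply rescale_eq_self
  intro m hm
  apply MvPowerSeries.coeff_rename_eq_zero (addRightEmbedding (k + 1))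
  rintro ⟨m', rfl⟩
  apply hm
  rw [← Finsupp.embDomain_eq_mapDomain, Finsupp.embDomain_of_notMem_range]
  rintro ⟨a, ha⟩
  simp at ha

lemma calOfV_stdDPlusStar (k : ℕ) (F : VStd k) :
    calOfV (k + 1) (stdDPlusStar k F) = calDPlusStar k (calOfV k F) := by
  apply Subtype.ext
  have h : ((calP (k + 1)).val.comp (calOfV (k + 1)).toAlgHom).comp (psi k) =
      (omegaInvHom k).comp ((calP k).val.comp (calOfV k).toAlgHom) := by
    apply vstd_algHom_ext
    · intro i
      change (calOfV (k + 1) (psi k (yv i)) : PS) = omegaInvPS k (calOfV k (yv i) : PS)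
      rw [psi_yv, coe_calOfV_yv, coe_calOfV_yv, omegaInvPS_X k i.isLt]
      rfl
    · intro n hn
      change (calOfV (k + 1) (psi k (pv n)) : PS) = omegaInvPS k (calIncl k (calOfV k (pv n)) : PS)
      have h0 : (calOfV (k + 1) (yv 0) : PS) = MvPowerSeries.X 0 := coe_calOfV_yv _ _
      have h1 : (calIncl k (calOfV k (pv n)) : PS) =
          (tc ^ n - 1) • (MvPowerSeries.X k ^ n + shiftPS (k + 1) (psum n)) := by
        rw [calOfV_pv _ hn, map_smul, calIncl_symShift_psum k hn]; rfl
      have h2 : omegaInvPS k (MvPowerSeries.X k ^ n) = (qc • MvPowerSeries.X 0) ^ n := by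
        rw [← omegaInvPS_X_self k]
        exact map_pow (omegaInvHom k) _ _
      rw [h1, map_smul, map_add, omegaInvPS_shiftPS, h2, psi_pv k hn, map_add, map_smul,
        map_pow, map_smul, calOfV_pv _ hn, smul_add]
      change _ + (tc ^ n - 1) • (qc • (calOfV (k + 1) (yv 0) : PS)) ^ n = _
      rw [h0]
      exact add_comm _ _
  exact DFunLike.congr_fun h F

/-! ### Compatibility with `d₋` -/

/-- `∂⁻_{k+1}` transported from `V_•`. -/
def calOfVDMinus (k : ℕ) : calP (k + 1) →ₗ[Kqt] calP k :=
  (calOfV k).toLinearMap ∘ₗ stdDMinus k ∘ₗ (calOfV (k + 1)).symm.toLinearMap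

lemma calOfVDMinus_polyIncl_mul (k : ℕ) (f : MvPolynomial (Fin k) Kqt) (G : calP (k + 1)) :
    calOfVDMinus k (calIncl k (polyIncl k f) * G) = polyIncl k f * calOfVDMinus k G := by
  obtain ⟨G, rfl⟩ := (calOfV (k + 1)).surjective G
  change calOfV k (stdDMinus k ((calOfV (k + 1)).symm _)) =
    _ * calOfV k (stdDMinus k ((calOfV (k + 1)).symm _))
  rw [← calOfV_tmul_one, ← calOfV_addVar, ← map_mul, AlgEquiv.symm_apply_apply,
    AlgEquiv.symm_apply_apply, stdDMinus_eq, stdDMinus_eq, map_mul (subVar k), subVar_addVar,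
    pair_C_mul, map_mul]

/-- Under `F ↦ F[X / (t - 1)]` the shift `X ↦ X - (t - 1) u` becomes `X ↦ X - u`. -/
lemma map_calOfV_subVar (k : ℕ) (F : SymFun) :
    (subVar k (1 ⊗ₜ scaleEquiv F)).map (calOfV k).toAlgHom.toRingHom =
      (symSub F).map (symShift k).toRingHom := by
  have h : ((Polynomial.mapAlgHom (calOfV k).toAlgHom).comp (subVar k)).comp
      (Algebra.TensorProduct.includeRight.comp scaleEquiv.toAlgHom) =
      (Polynomial.mapAlgHom (symShift k)).comp symSub := by
    apply symFun_algHom_ext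
    intro n hn
    have h1 : scaleEquiv (psum n) = (tc ^ n - 1)⁻¹ • psum n := pleth_psum _ hn
    have h2 : (1 ⊗ₜ scaleEquiv (psum n) : VStd (k + 1)) = (tc ^ n - 1)⁻¹ • pv n := by
      rw [h1, TensorProduct.tmul_smul]; rfl
    change Polynomial.mapAlgHom (calOfV k).toAlgHom (subVar k (1 ⊗ₜ scaleEquiv (psum n))) =
      Polynomial.mapAlgHom (symShift k) (symSub (psum n))
    rw [h2, map_smul, subVar_pv k hn, symSub_psum_add hn, map_smul,
      map_add (Polynomial.mapAlgHom _), map_add (Polynomial.mapAlgHom _), map_smul, map_pow,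
      map_smul, map_pow, mapAlgHom_C, mapAlgHom_X, mapAlgHom_C, mapAlgHom_X]
    have h3 : (calOfV k).toAlgHom (pv n) = (tc ^ n - 1) • symShift k (psum n) := calOfV_pv k hn
    have h4 := tc_pow_sub_one_ne_zero hn
    rw [h3, smul_add, smul_smul, Polynomial.smul_C, smul_smul, inv_mul_cancel₀ h4, one_smul]
    congr 2
    rw [← neg_sub (tc ^ n), mul_neg, inv_mul_cancel₀ h4]
  exact DFunLike.congr_fun h F

/-- Under `F ↦ F[X / (t - 1)]` the kernel `Exp[-X w]` becomes `Exp[(1 - t) X w]`. -/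
lemma map_calOfV_hSer (k : ℕ) :
    (hSer k).map (calOfV k).toAlgHom.toRingHom = hlSer.map (symShift k).toRingHom := by
  rw [map_hSer, hlSer, map_expSeries]
  apply expSeries_congr
  intro n hn
  have h3 : (calOfV k).toAlgHom (pv n) = (tc ^ n - 1) • symShift k (psum n) := calOfV_pv k hn
  rw [h3, map_smul, ← neg_smul, neg_sub]

/-- On `x_{k+1}^n F[𝐗_{k+1}]` the transported `d₋` is the vertex operator `ℬ_n`. -/
lemma calOfVDMinus_xLast_pow_mul (k n : ℕ) (F : SymFun) :
    calOfVDMinus k (xLast k ^ n * symShift (k + 1) F) = symShift k (opB n F) := by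
  have h1 : symShift (k + 1) F = calOfV (k + 1) (1 ⊗ₜ scaleEquiv F) := by
    change _ = mulMap (k + 1) (1 ⊗ₜ scaleEquiv.symm (scaleEquiv F))
    rw [AlgEquiv.symm_apply_apply, mulMap_tmul, map_one, one_mul]
  change calOfV k (stdDMinus k ((calOfV (k + 1)).symm _)) = _
  rw [h1, ← calOfV_yv_last, ← map_pow, ← map_mul, AlgEquiv.symm_apply_apply, stdDMinus_eq,
    map_mul, map_pow, subVar_yv_last, opB_apply, vertexOp]
  refine (map_pair (calOfV k).toAlgHom.toRingHom _ _).trans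
    (Eq.trans ?_ (map_pair (symShift k).toRingHom _ _).symm)
  rw [map_calOfV_hSer]
  congr 1
  rw [Polynomial.map_mul, Polynomial.map_mul, map_calOfV_subVar, Polynomial.map_pow,
    Polynomial.map_pow, Polynomial.map_X, Polynomial.map_X]

/-- The two properties that define `∂⁻_{k+1}` determine it, as `𝒫(k+1)⁺` is spanned by the products
`f x_{k+1}^n F[𝐗_{k+1}]`. -/
lemma dMinus_unique {k : ℕ} {D D' : calP (k + 1) →ₗ[Kqt] calP k}
    (h1 : ∀ (f : MvPolynomial (Fin k) Kqt) (G : calP (k + 1)),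
      D (calIncl k (polyIncl k f) * G) = polyIncl k f * D G)
    (h1' : ∀ (f : MvPolynomial (Fin k) Kqt) (G : calP (k + 1)),
      D' (calIncl k (polyIncl k f) * G) = polyIncl k f * D' G)
    (h2 : ∀ (n : ℕ) (F : SymFun), D (xLast k ^ n * symShift (k + 1) F) =
      D' (xLast k ^ n * symShift (k + 1) F)) : D = D' := by
  have key : ∀ (f : MvPolynomial (Fin (k + 1)) Kqt) (n : ℕ) (F : SymFun),
      D (polyIncl (k + 1) f * (xLast k ^ n * symShift (k + 1) F)) =
        D' (polyIncl (k + 1) f * (xLast k ^ n * symShift (k + 1) F)) := by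
    intro f
    induction f using MvPolynomial.induction_on with
    | C c =>
      intro n F
      have hC : polyIncl (k + 1) (MvPolynomial.C c) = algebraMap Kqt _ c :=
        (polyIncl (k + 1)).commutes c
      rw [hC, ← Algebra.smul_def, map_smul, map_smul, h2]
    | add f g hf hg =>
      intro n F
      rw [map_add, add_mul, map_add, map_add, hf, hg]
    | mul_X f i hf =>
      intro n F
      rw [map_mul (polyIncl (k + 1))]
      induction i using Fin.lastCases with
      | last =>
        have hX : polyIncl (k + 1) (MvPolynomial.X (Fin.last k)) = xLast k :=
          Subtype.ext (coe_polyIncl_X _ _)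
        have e : ∀ a b c : calP (k + 1), a * b * (b ^ n * c) = a * (b ^ (n + 1) * c) := by
          intro a b c
          ring
        rw [hX, e, hf]
      | cast i =>
        have hX : polyIncl (k + 1) (MvPolynomial.X i.castSucc) =
            calIncl k (polyIncl k (MvPolynomial.X i)) :=
          Subtype.ext ((coe_polyIncl_X _ _).trans (coe_polyIncl_X k i).symm)
        rw [hX, mul_comm (polyIncl (k + 1) f), mul_assoc, h1, h1', hf]
  ext1 G
  obtain ⟨x, rfl⟩ := (mulMap_bijective (k + 1)).2 G
  induction x using TensorProduct.induction_on with
  | zero => rw [map_zero, map_zero, map_zero]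
  | add x y hx hy => rw [map_add, map_add, map_add, hx, hy]
  | tmul f F =>
    have := key f 0 F
    rwa [pow_zero, one_mul, ← mulMap_tmul] at this

lemma calDMinus_eq (k : ℕ) : calDMinus k = calOfVDMinus k := by
  have h : ∃ D : calP (k + 1) →ₗ[Kqt] calP k,
      (∀ (f : MvPolynomial (Fin k) Kqt) (G : calP (k + 1)),
        D (calIncl k (polyIncl k f) * G) = polyIncl k f * D G) ∧
      ∀ (n : ℕ) (F : SymFun), D (xLast k ^ n * symShift (k + 1) F) = symShift k (opB n F) :=
    ⟨calOfVDMinus k, calOfVDMinus_polyIncl_mul k, calOfVDMinus_xLast_pow_mul k⟩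
  rw [calDMinus, dif_pos h]
  refine dMinus_unique h.choose_spec.1 (calOfVDMinus_polyIncl_mul k) fun n F => ?_
  rw [h.choose_spec.2, calOfVDMinus_xLast_pow_mul]

lemma calOfV_stdDMinus (k : ℕ) (F : VStd (k + 1)) :
    calOfV k (stdDMinus k F) = calDMinus k (calOfV (k + 1) F) := by
  rw [calDMinus_eq]
  change _ = calOfV k (stdDMinus k ((calOfV (k + 1)).symm _))
  rw [AlgEquiv.symm_apply_apply]

lemma isHom_calOfV_symm : QuiverRep.IsHom calPRep stdRep fun k => (calOfV k).symm.toLinearMap where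
  T k i := by
    ext1 F
    obtain ⟨F, rfl⟩ := (calOfV (k + 1)).surjective F
    refine (AlgEquiv.symm_apply_eq (calOfV (k + 1))).2 ?_
    change calT k i (calOfV (k + 1) F) = calOfV (k + 1) (stdT k i ((calOfV (k + 1)).symm _))
    rw [AlgEquiv.symm_apply_apply, calOfV_stdT]
  dPlus k := by
    ext1 F
    obtain ⟨F, rfl⟩ := (calOfV k).surjective F
    refine (AlgEquiv.symm_apply_eq (calOfV (k + 1))).2 ?_
    change calDPlus k (calOfV k F) = calOfV (k + 1) (stdDPlus k ((calOfV k).symm _))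
    rw [AlgEquiv.symm_apply_apply, calOfV_stdDPlus]
  dPlusStar k := by
    ext1 F
    obtain ⟨F, rfl⟩ := (calOfV k).surjective F
    refine (AlgEquiv.symm_apply_eq (calOfV (k + 1))).2 ?_
    change calDPlusStar k (calOfV k F) = calOfV (k + 1) (stdDPlusStar k ((calOfV k).symm _))
    rw [AlgEquiv.symm_apply_apply, calOfV_stdDPlusStar]
  dMinus k := by
    ext1 F
    obtain ⟨F, rfl⟩ := (calOfV (k + 1)).surjective F
    refine (AlgEquiv.symm_apply_eq (calOfV k)).2 ?_
    change calDMinus k (calOfV (k + 1) F) = calOfV k (stdDMinus k ((calOfV (k + 1)).symm _))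
    rw [AlgEquiv.symm_apply_apply, calOfV_stdDMinus]

/-! ### Transfer of the relations along a morphism -/

namespace QuiverRep.IsHom

variable {M N : QuiverRep} {Φ : ∀ k, M.V k →ₗ[Kqt] N.V k} (h : IsHom M N Φ)
include h

lemma T_apply (k : ℕ) (i : Fin k) (v : M.V (k + 1)) :
    Φ (k + 1) (M.T k i v) = N.T k i (Φ (k + 1) v) := LinearMap.congr_fun (h.T k i) v

lemma dPlus_apply (k : ℕ) (v : M.V k) : Φ (k + 1) (M.dPlus k v) = N.dPlus k (Φ k v) :=
  LinearMap.congr_fun (h.dPlus k) v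

lemma dPlusStar_apply (k : ℕ) (v : M.V k) :
    Φ (k + 1) (M.dPlusStar k v) = N.dPlusStar k (Φ k v) := LinearMap.congr_fun (h.dPlusStar k) v

lemma dMinus_apply (k : ℕ) (v : M.V (k + 1)) :
    Φ k (M.dMinus k v) = N.dMinus k (Φ (k + 1) v) := LinearMap.congr_fun (h.dMinus k) v

lemma Tinv_apply (k : ℕ) (i : Fin k) (v : M.V (k + 1)) :
    Φ (k + 1) (M.Tinv k i v) = N.Tinv k i (Φ (k + 1) v) := by
  simp [Tinv, h.T_apply]

lemma comm_apply (k : ℕ) (v : M.V (k + 1)) :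
    Φ (k + 1) (M.comm k v) = N.comm k (Φ (k + 1) v) := by
  simp [comm, h.dPlus_apply, h.dMinus_apply]

lemma commStar_apply (k : ℕ) (v : M.V (k + 1)) :
    Φ (k + 1) (M.commStar k v) = N.commStar k (Φ (k + 1) v) := by
  simp [commStar, h.dPlusStar_apply, h.dMinus_apply]

lemma y_apply (k i : ℕ) (v : M.V (k + 1)) : Φ (k + 1) (M.y k i v) = N.y k i (Φ (k + 1) v) := by
  induction i generalizing v with
  | zero =>
    simp only [y, LinearMap.smul_apply, Module.End.mul_apply, map_smul, h.comm_apply]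
    rw [map_ofFn_reverse_prod (Φ (k + 1)) (h.T_apply k)]
  | succ i ih =>
    simp only [y]
    split_ifs with hi
    · simp only [LinearMap.smul_apply, Module.End.mul_apply, map_smul, h.Tinv_apply, ih]
    · exact map_zero _

lemma z_apply (k i : ℕ) (v : M.V (k + 1)) : Φ (k + 1) (M.z k i v) = N.z k i (Φ (k + 1) v) := by
  induction i generalizing v with
  | zero =>
    simp only [z, LinearMap.smul_apply, Module.End.mul_apply, map_smul, h.commStar_apply]
    rw [map_ofFn_reverse_prod (Φ (k + 1)) (h.Tinv_apply k)]
  | succ i ih =>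
    simp only [z]
    split_ifs with hi
    · simp only [LinearMap.smul_apply, Module.End.mul_apply, map_smul, h.T_apply, ih]
    · exact map_zero _

/-- The relations hold in a representation that embeds into one in which they hold. -/
theorem isDDPARep (hΦ : ∀ k, Function.Injective (Φ k)) (hN : N.IsDDPARep) : M.IsDDPARep := by
  constructor <;> intros
  all_goals
    refine LinearMap.ext fun v => hΦ _ ?_
    simp only [LinearMap.comp_apply, Module.End.mul_apply, LinearMap.smul_apply,
      LinearMap.add_apply, LinearMap.sub_apply, Module.End.one_apply, LinearMap.zero_apply,
      map_smul, map_add, map_sub, map_zero, h.T_apply, h.dPlus_apply,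
      h.dPlusStar_apply, h.dMinus_apply, h.comm_apply, h.commStar_apply, h.y_apply, h.z_apply]
  · exact LinearMap.congr_fun (hN.T_comm _ _ _ ‹_›) (Φ _ v)
  · exact LinearMap.congr_fun (hN.T_braid _ _ _ ‹_›) (Φ _ v)
  · rename_i k i
    refine Eq.trans ?_ (LinearMap.congr_fun (hN.T_quadratic k i) (Φ _ v))
    simp only [Module.End.mul_apply, LinearMap.sub_apply, LinearMap.add_apply,
      LinearMap.smul_apply, Module.End.one_apply, map_add, map_smul]
  · exact LinearMap.congr_fun (hN.dMinus_sq_T _) (Φ _ v)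
  · exact LinearMap.congr_fun (hN.T_dMinus _ _) (Φ _ v)
  · exact LinearMap.congr_fun (hN.T_dPlus_sq _) (Φ _ v)
  · exact LinearMap.congr_fun (hN.dPlus_T _ _) (Φ _ v)
  · exact LinearMap.congr_fun (hN.dMinus_comm _) (Φ _ v)
  · exact LinearMap.congr_fun (hN.comm_dPlus _) (Φ _ v)
  · exact LinearMap.congr_fun (hN.T_dPlusStar_sq _) (Φ _ v)
  · exact LinearMap.congr_fun (hN.dPlusStar_T _ _) (Φ _ v)
  · exact LinearMap.congr_fun (hN.dMinus_commStar _) (Φ _ v)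
  · exact LinearMap.congr_fun (hN.commStar_dPlusStar _) (Φ _ v)
  · exact LinearMap.congr_fun (hN.dPlus_z _ _ ‹_›) (Φ _ v)
  · exact LinearMap.congr_fun (hN.dPlusStar_y _ _ ‹_›) (Φ _ v)
  · exact LinearMap.congr_fun (hN.z_dPlus _) (Φ _ v)

end QuiverRep.IsHom

end DoubleDyck

end

open DoubleDyck
theorem mainTheorem3 :
    (∀ k, Function.Bijective (mulMap k)) ∧ calPRep.IsDDPARep ∧ stdRep.IsDDPARep ∧
    ∃ Φ : ∀ k, calP k ≃ₐ[Kqt] VStd k,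
      (∀ (k : ℕ) (f : MvPolynomial (Fin k) Kqt) (F : SymFun),
        Φ k (mulMap k (f ⊗ₜ[Kqt] F)) = f ⊗ₜ[Kqt] pleth (fun n => (tc ^ n - 1)⁻¹ • psum n) F) ∧
      QuiverRep.IsHom calPRep stdRep fun k => (Φ k).toLinearMap := by
  refine ⟨mulMap_bijective, ?_, stdRep_isDDPARep, fun k => (calOfV k).symm, calOfV_symm_mulMap,
    isHom_calOfV_symm⟩
  exact isHom_calOfV_symm.isDDPARep (fun k => (calOfV k).symm.injective) stdRep_isDDPARep
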